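/- Let $\mathbb R_+=[0,\infty)$, let $U\subset\mathbb R_+^2$ be relatively open (a coordinate neighbourhood of a regular corner), and let $$L=a(x,y)\,x\,\partial_x^2+b(x,y)\,y\,\partial_y^2+d(x,y)\,\partial_x+e(x,y)\,\partial_y$$ with $a,b,d,e\in C^\infty(U)$ (smooth up to the edges), $a,b>0$ on $U$, $d\ge 0$ on $U\cap\{x=0\}$ and $e\ge0$ on $U\cap\{y=0\}$. Let $h\in C_c^\infty(U)$ and let $q=(x_2,y_2)\in U$ with $x_2,y_2>0$ and $d(q),e(q)\ge 0$. Put $$L_M=a(q)\,x\,\partial_x^2+b(q)\,y\,\partial_y^2+d(q)\,\partial_x+e(q)\,\partial_y,\qquad \tilde L=L_M+h\,(L-L_M).$$ For $\delta\ge0$, $t>0$, $x\ge 0$ let $p^{\delta}_t(x,\cdot)$ be the measure on $\mathbb R_+$ with density on $(0,\infty)$ $$\frac1{x'}\Big(\frac{x'}{t}\Big)^{\delta}e^{-\frac{x+x'}{t}}\psi_\delta\Big(\frac{xx'}{t^2}\Big)\ \ (\delta>0),\qquad \frac{x}{t^2}e^{-\frac{x+x'}{t}}\psi_2\Big(\frac{xx'}{t^2}\Big)\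 \ (\delta=0),\qquad \psi_\delta(z)=\sum_{m\ge0}\frac{z^m}{m!\,\Gamma(m+\delta)},$$ with, for $\delta=0$ only, the additional atom $e^{-x/t}\delta_0$ at $0$. Let $K_t(x,y,\cdot)=p^{d(q)/a(q)}_{a(q)t}(x,\cdot)\otimes p^{e(q)/b(q)}_{b(q)t}(y,\cdot)$ be the kernel of $\partial_t-L_M$, and $$\mathbf K_tg(x,y)=\int_0^t\int_{\mathbb R_+^2}g(s,x_1,y_1)\,K_{t-s}(x,y,dx_1\,dy_1)\,ds,\qquad \mathbf Bg(t,x,y)=(\tilde L-L_M)\mathbf K_tg(x,y),$$ $$d(t,x,y)=\frac{(\sqrt x-\sqrt{x_2})^2}{2a(q)t}+\frac{(\sqrt y-\sqrt{y_2})^2}{2b(q)t}.$$ Let $T>0$, $j\le\frac32$ real and $0<\gamma<1$. Then there is a constant $C>0$, independent of $g$, such that the following holds for every measurable $g$. Assume that for all $t\in(0,T]$ and all $x,x',y,y'\ge0$ $$|g(t,x,y)|\le\frac1{t^j}e^{-d(t,x,y)},$$ $$|g(t,x,y)-g(t,x',y)|\le\frac{1}{t^{j+\frac\gamma2}}|\sqrt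 x-\sqrt{x'}|^\gamma\big(e^{-d(t,x,y)}+e^{-d(t,x',y)}\big),$$ $$|g(t,x,y)-g(t,x,y')|\le\frac{1}{t^{j+\frac\gamma2}}|\sqrt y-\sqrt{y'}|^\gamma\big(e^{-d(t,x,y)}+e^{-d(t,x,y')}\big).$$ Then $\mathbf Bg$ is well defined: for all $t\in(0,T]$, $x,y\ge0$ the integral $\mathbf K_tg(x,y)$ converges absolutely, $\partial_x\mathbf K_tg$ and $\partial_y\mathbf K_tg$ exist (one-sided on the edges), $\partial_x^2\mathbf K_tg$ exists where $x>0$, and $\partial_y^2\mathbf K_tg$ exists where $y>0$ (the terms $x\partial_x^2$, resp. $y\partial_y^2$, are read as $0$ at $x=0$, resp. $y=0$). Moreover, for all $t\in(0,T]$ and $x,x',y,y'\ge0$, $$|\mathbf Bg(t,x,y)|\le C\frac{\sqrt t}{t^j}e^{-\frac{d(t,x,y)}2},$$ $$|\mathbf Bg(t,x,y)-\mathbf Bg(t,x',y)|\le\frac{C}{t^{j+\frac{\gamma-1}2}}|\sqrt x-\sqrt{x'}|^\gamma\Big(e^{-\frac{d(t,x,y)}2}+e^{-\frac{d(t,x',y)}2}\Big),$$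 $$|\mathbf Bg(t,x,y)-\mathbf Bg(t,x,y')|\le\frac{C}{t^{j+\frac{\gamma-1}2}}|\sqrt y-\sqrt{y'}|^\gamma\Big(e^{-\frac{d(t,x,y)}2}+e^{-\frac{d(t,x,y')}2}\Big).$$ -/

import Mathlib

open MeasureTheory Set
open scoped ContDiff

noncomputable section

namespace Kimura

/-- The closed quadrant `ℝ₊²`, where `ℝ₊ = [0, ∞)`. -/
def quadrant : Set (ℝ × ℝ) := Ici 0 ×ˢ Ici 0

/-- `∂ₓ u` on `ℝ₊²` (one-sided at `x = 0`). -/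
def dx (u : ℝ × ℝ → ℝ) (p : ℝ × ℝ) : ℝ :=
  derivWithin (fun x => u (x, p.2)) (Ici 0) p.1

/-- `∂_y u` on `ℝ₊²` (one-sided at `y = 0`). -/
def dy (u : ℝ × ℝ → ℝ) (p : ℝ × ℝ) : ℝ :=
  derivWithin (fun y => u (p.1, y)) (Ici 0) p.2

/-- The coefficients of an operator `a x ∂ₓ² + b y ∂_y² + d ∂ₓ + e ∂_y`. -/
structure Coeffs where
  a : ℝ × ℝ → ℝ
  b : ℝ × ℝ → ℝ
  d : ℝ × ℝ → ℝ
  e : ℝ × ℝ → ℝ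

/-- The operator `L u = a x ∂ₓ² u + b y ∂_y² u + d ∂ₓ u + e ∂_y u`. -/
def Coeffs.op (L : Coeffs) (u : ℝ × ℝ → ℝ) (p : ℝ × ℝ) : ℝ :=
  L.a p * p.1 * dx (dx u) p + L.b p * p.2 * dy (dy u) p + L.d p * dx u p + L.e p * dy u p

/-- `L` is a generalized Kimura operator on the relatively open set `U ⊆ ℝ₊²`: its coefficients are
smooth on `U` (up to the boundary edges), `a` and `b` are positive, and the first order part does
not point outwards along the two edges. -/
structure Coeffs.IsKimuraOn (L : Coeffs) (U : Set (ℝ × ℝ)) : Prop where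
  smooth_a : ContDiffOn ℝ ∞ L.a U
  smooth_b : ContDiffOn ℝ ∞ L.b U
  smooth_d : ContDiffOn ℝ ∞ L.d U
  smooth_e : ContDiffOn ℝ ∞ L.e U
  pos_a : ∀ p ∈ U, 0 < L.a p
  pos_b : ∀ p ∈ U, 0 < L.b p
  inward_d : ∀ p ∈ U, p.1 = 0 → 0 ≤ L.d p
  inward_e : ∀ p ∈ U, p.2 = 0 → 0 ≤ L.e p

/-- The model operator `L_{q,M}`: the coefficients `a, b, d, e` are frozen at `q`. -/
def Coeffs.model (L : Coeffs) (q : ℝ × ℝ) : Coeffs where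
  a := fun _ => L.a q
  b := fun _ => L.b q
  d := fun _ => L.d q
  e := fun _ => L.e q

/-- `L̃ = L_{q,M} + h (L - L_{q,M})`. -/
def Coeffs.localized (L : Coeffs) (h : ℝ × ℝ → ℝ) (q : ℝ × ℝ) (u : ℝ × ℝ → ℝ) (p : ℝ × ℝ) : ℝ :=
  (L.model q).op u p + h p * (L.op u p - (L.model q).op u p)

/-- `h ∈ C_c^∞(U)`, for a relatively open subset `U` of the quadrant. -/
def IsCutoff (h : ℝ × ℝ → ℝ) (U : Set (ℝ × ℝ)) : Prop :=
  ContDiffOn ℝ ∞ h U ∧ ∃ K : Set (ℝ × ℝ), IsCompact K ∧ K ⊆ U ∧ ∀ p ∈ quadrant \ K, h p = 0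

/-- `ψ_d(z) = ∑ₘ zᵐ / (m! Γ(m + d))`, which is `z^((1-d)/2) I_{d-1}(2 √z)` with the modified Bessel
function `I_{d-1}` of the first kind. -/
def psi (d z : ℝ) : ℝ :=
  ∑' m : ℕ, z ^ m / ((m.factorial : ℝ) * Real.Gamma ((m : ℝ) + d))

/-- The density in `x' > 0` of the kernel of `∂ₜ - (x ∂ₓ² + d ∂ₓ)`:
`(x'/t)^d e^{-(x+x')/t} ψ_d(x x'/t²) / x'` for `d > 0`, and
`t⁻¹ e^{-(x+x')/t} (x/x')^{1/2} I₁(2 √(x x')/t) = (x/t²) e^{-(x+x')/t} ψ₂(x x'/t²)` for `d = 0`. -/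
def density (d t x x' : ℝ) : ℝ :=
  if d = 0 then x / t ^ 2 * Real.exp (-(x + x') / t) * psi 2 (x * x' / t ^ 2)
  else (x' / t) ^ d * Real.exp (-(x + x') / t) * psi d (x * x' / t ^ 2) / x'

/-- The one-dimensional kernel `p_t^d(x, dx')`, a measure on `ℝ₊`. For `d = 0` it has the
additional atom `e^{-x/t} δ₀`. -/
def kernel₁ (d t x : ℝ) : Measure ℝ :=
  (volume.restrict (Ioi 0)).withDensity (fun x' => ENNReal.ofReal (density d t x x')) +
    if d = 0 then ENNReal.ofReal (Real.exp (-x / t)) • Measure.dirac 0 else 0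

/-- The kernel `K_t(x, y, dx₁ dy₁) = p^{d(q)/a(q)}_{a(q)t}(x, dx₁) p^{e(q)/b(q)}_{b(q)t}(y, dy₁)` of
the model operator `L_{q,M}`. -/
def Coeffs.modelKernel (L : Coeffs) (q : ℝ × ℝ) (t : ℝ) (p : ℝ × ℝ) : Measure (ℝ × ℝ) :=
  (kernel₁ (L.d q / L.a q) (L.a q * t) p.1).prod (kernel₁ (L.e q / L.b q) (L.b q * t) p.2)

/-- The solution operator of the model problem with right hand side `g` and zero initial data:
`(𝐊 g)(t, p) = ∫₀ᵗ ∫ K_{t-s}(p, dz) g(s, z) ds`. -/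
def Coeffs.solution (L : Coeffs) (q : ℝ × ℝ) (g : ℝ → ℝ × ℝ → ℝ) (t : ℝ) (p : ℝ × ℝ) : ℝ :=
  ∫ s in Ioo 0 t, ∫ z, g s z ∂(L.modelKernel q (t - s) p)

/-- `𝐁 g = (L̃ - L_{q,M}) 𝐊 g`. -/
def Coeffs.perturbation (L : Coeffs) (h : ℝ × ℝ → ℝ) (q : ℝ × ℝ) (g : ℝ → ℝ × ℝ → ℝ)
    (t : ℝ) (p : ℝ × ℝ) : ℝ :=
  L.localized h q (L.solution q g t) p - (L.model q).op (L.solution q g t) p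

/-- `(√x - √x₂)² / (2 a(q) t) + (√y - √y₂)² / (2 b(q) t)` for `p = (x, y)`, `q = (x₂, y₂)`. -/
def Coeffs.dist (L : Coeffs) (q : ℝ × ℝ) (t : ℝ) (p : ℝ × ℝ) : ℝ :=
  (√p.1 - √q.1) ^ 2 / (2 * L.a q * t) + (√p.2 - √q.2) ^ 2 / (2 * L.b q * t)

/-- The integral that defines `(𝐊 g)(t, p)` converges absolutely. -/
def Coeffs.SolutionConverges (L : Coeffs) (q : ℝ × ℝ) (g : ℝ → ℝ × ℝ → ℝ) (t : ℝ)
    (p : ℝ × ℝ) : Prop :=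
  (∀ s ∈ Ioo 0 t, Integrable (g s) (L.modelKernel q (t - s) p)) ∧
    IntegrableOn (fun s => ∫ z, |g s z| ∂(L.modelKernel q (t - s) p)) (Ioo 0 t)

/-- The derivatives of `u` in the operator `a x ∂ₓ² + b y ∂_y² + d ∂ₓ + e ∂_y` exist at `p ∈ ℝ₊²`:
the first order ones everywhere (one-sided on the edges), `∂ₓ²` where `x > 0`, and `∂_y²` where
`y > 0` (the factors `x` and `y` vanish otherwise). -/
def HasKimuraDerivs (u : ℝ × ℝ → ℝ) (p : ℝ × ℝ) : Prop :=
  DifferentiableWithinAt ℝ (fun x => u (x, p.2)) (Ici 0) p.1 ∧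
    DifferentiableWithinAt ℝ (fun y => u (p.1, y)) (Ici 0) p.2 ∧
    (0 < p.1 → DifferentiableAt ℝ (fun x => dx u (x, p.2)) p.1) ∧
    (0 < p.2 → DifferentiableAt ℝ (fun y => dy u (p.1, y)) p.2)

end Kimura

end

/-!
The perturbation `𝐁 g = h (L - L_M) 𝐊 g` is a sum of four terms `κ D (𝐊 g)`, where `D` is one of
`x ∂ₓ²`, `y ∂_y²`, `∂ₓ`, `∂_y` and `κ = h (c - c(q))` for the corresponding coefficient `c`. In the
variables `(√x, √y)` the function `κ` is Lipschitz and vanishes at `q` (`exists_coeffBound`), and a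
factor `|√x - √x₂|` in front of a Gaussian at time `t` is worth `√t`, at the expense of a part of
the exponent (`abs_mul_gauss_le`). This is the gain of `√t` in the theorem, and the loss from
`e^{-d}` to `e^{-d/2}` leaves room for all Gaussian constants. It remains to bound `D (𝐊 g)` by
`t^{-j}` times a Gaussian with exponent `4/5`, with the corresponding weighted Hölder bound
(`exists_potential_estimates`).

The one-dimensional kernel `p_τ^δ(x, ·)` is a Poisson mixture of Gamma laws
(`kernel₁_eq_poiGamma`): the shape is `δ + N` with `N` Poisson of mean `z = x/τ`. The derivative of a
Poisson average in `z` is the Poisson average of the difference sequence, so that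
`τ ∂ₓ p_τ^δ = p_τ^{δ+1} - p_τ^δ` (`hasDerivWithinAt_kerDiff`). Summation by parts turns
`z^{k/2} ∂_z^k` into multiplication of the Poisson weights by a Charlier polynomial whose second
moment is at most `k!`. Hence `√x ∂ₓ`, `x ∂ₓ²` and `x^{3/2} ∂ₓ³` of the kernel are bounded by the
kernel with square integrable weights, uniformly up to the boundary.

Gaussian bounds in `√x` for the kernel follow from its moment generating function, or from the Gamma
densities, by an exponential tilt (`exists_lintegral_exp_sq_le`, `exists_density_le`), and
they pass to weighted mixtures because `b e^{9r/20} ≤ b² + e^{9r/10}` (`exists_gaussBound`). For a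
functional with these bounds one has three estimates: Gaussian data at time `s` yield a Gaussian at
time `s + τ`; if `s` is small there is in addition a factor `√(s/τ)`, since the data are
concentrated near an interior point; and if the functional annihilates constants, Hölder
continuous data yield a factor `τ^{γ/2}`. With `τ = t - s`, the second estimate is used, in both
variables, for `s < t/2`, the third one for `s ≥ t/2`. The resulting bound `majorant` is integrable
over `s ∈ (0, t)` with integral of order `t^{-j}`. The Hölder bounds of `D (𝐊 g)` come from
splitting the time integral at `τ = Δ²`, where `Δ` is the distance of the two points: for larger `τ`
the kernels are Lipschitz with constant of order `τ^{-1/2}`.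

The derivatives in `y` are obtained by exchanging the variables.
-/

noncomputable section

namespace Kimura

/-! ### Poisson averages and Charlier multipliers -/

/-- The Poisson weights `e^{-z} z^m / m!`. -/
def poi (z : ℝ) (m : ℕ) : ℝ := Real.exp (-z) * (z ^ m / (m.factorial : ℝ))

/-- The Poisson average `∑ₘ e^{-z} z^m / m! F(m)` of a sequence. -/
def poiAvg (z : ℝ) (F : ℕ → ℝ) : ℝ := ∑' m, poi z m * F m

/-- Sequences of at most geometric growth; their Poisson averages converge. -/
def GeomBdd (F : ℕ → ℝ) : Prop := ∃ C K : ℝ, 0 ≤ K ∧ ∀ m, |F m| ≤ C * K ^ m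

lemma poi_nonneg {z : ℝ} (hz : 0 ≤ z) (m : ℕ) : 0 ≤ poi z m := by
  unfold poi; positivity

lemma GeomBdd.of_bdd {F : ℕ → ℝ} {C : ℝ} (h : ∀ m, |F m| ≤ C) : GeomBdd F :=
  ⟨C, 1, by norm_num, by simpa using h⟩

lemma geomBdd_const (c : ℝ) : GeomBdd (fun _ => c) := GeomBdd.of_bdd (fun _ => le_rfl)

lemma geomBdd_natCast : GeomBdd (fun m => (m : ℝ)) := by
  refine ⟨1, 2, by norm_num, fun m => ?_⟩
  rw [abs_of_nonneg (Nat.cast_nonneg m), one_mul]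
  have := (Nat.lt_two_pow_self (n := m)).le
  simp only
  exact_mod_cast this

lemma GeomBdd.mul {F G : ℕ → ℝ} (hF : GeomBdd F) (hG : GeomBdd G) :
    GeomBdd (fun m => F m * G m) := by
  obtain ⟨C, K, hK, h⟩ := hF
  obtain ⟨C', K', hK', h'⟩ := hG
  refine ⟨C * C', K * K', by positivity, fun m => ?_⟩
  rw [abs_mul]
  calc |F m| * |G m| ≤ (C * K ^ m) * (C' * K' ^ m) :=
        mul_le_mul (h m) (h' m) (abs_nonneg _) ((abs_nonneg _).trans (h m))
    _ = C * C' * (K * K') ^ m := by rw [mul_pow]; ring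

lemma GeomBdd.add {F G : ℕ → ℝ} (hF : GeomBdd F) (hG : GeomBdd G) :
    GeomBdd (fun m => F m + G m) := by
  obtain ⟨C, K, hK, h⟩ := hF
  obtain ⟨C', K', hK', h'⟩ := hG
  refine ⟨|C| + |C'|, max K K', le_max_of_le_left hK, fun m => ?_⟩
  have e1 : C * K ^ m ≤ |C| * (max K K') ^ m :=
    mul_le_mul (le_abs_self _) (pow_le_pow_left₀ hK (le_max_left _ _) _) (by positivity)
      (abs_nonneg _)
  have e2 : C' * K' ^ m ≤ |C'| * (max K K') ^ m :=
    mul_le_mul (le_abs_self _) (pow_le_pow_left₀ hK' (le_max_right _ _) _) (by positivity)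
      (abs_nonneg _)
  linarith [abs_add_le (F m) (G m), h m, h' m]

lemma GeomBdd.const_mul {F : ℕ → ℝ} (hF : GeomBdd F) (c : ℝ) : GeomBdd (fun m => c * F m) :=
  (geomBdd_const c).mul hF

lemma GeomBdd.sub {F G : ℕ → ℝ} (hF : GeomBdd F) (hG : GeomBdd G) :
    GeomBdd (fun m => F m - G m) := by
  simpa [sub_eq_add_neg] using hF.add (hG.const_mul (-1))

lemma GeomBdd.div_const {F : ℕ → ℝ} (hF : GeomBdd F) (c : ℝ) : GeomBdd (fun m => F m / c) := by
  simpa [div_eq_inv_mul] using hF.const_mul c⁻¹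

lemma GeomBdd.succ {F : ℕ → ℝ} (hF : GeomBdd F) : GeomBdd (fun m => F (m + 1)) := by
  obtain ⟨C, K, hK, h⟩ := hF
  exact ⟨C * K, K, hK, fun m => (h (m + 1)).trans (by rw [pow_succ]; apply le_of_eq; ring)⟩

lemma GeomBdd.summable {F : ℕ → ℝ} (hF : GeomBdd F) (z : ℝ) :
    Summable (fun m => poi z m * F m) := by
  obtain ⟨C, K, hK, h⟩ := hF
  refine Summable.of_norm_bounded
    (g := fun m => Real.exp (-z) * C * ((|z| * K) ^ m / (m.factorial : ℝ)))
    ((Real.summable_pow_div_factorial _).mul_left _) (fun m => ?_)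
  rw [Real.norm_eq_abs, poi, abs_mul, abs_mul, abs_div, abs_pow, abs_of_pos (Real.exp_pos _),
    Nat.abs_cast, mul_pow]
  calc Real.exp (-z) * (|z| ^ m / (m.factorial : ℝ)) * |F m|
      ≤ Real.exp (-z) * (|z| ^ m / (m.factorial : ℝ)) * (C * K ^ m) := by
        gcongr; exact h m
    _ = _ := by ring

lemma poiAvg_add {F G : ℕ → ℝ} (hF : GeomBdd F) (hG : GeomBdd G) (z : ℝ) :
    poiAvg z (fun m => F m + G m) = poiAvg z F + poiAvg z G := by
  unfold poiAvg
  rw [← (hF.summable z).tsum_add (hG.summable z)]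
  simp only [mul_add]

lemma poiAvg_const_mul (c : ℝ) (F : ℕ → ℝ) (z : ℝ) :
    poiAvg z (fun m => c * F m) = c * poiAvg z F := by
  unfold poiAvg
  rw [← tsum_mul_left]
  exact tsum_congr fun m => by ring

lemma poiAvg_sub {F G : ℕ → ℝ} (hF : GeomBdd F) (hG : GeomBdd G) (z : ℝ) :
    poiAvg z (fun m => F m - G m) = poiAvg z F - poiAvg z G := by
  unfold poiAvg
  rw [← (hF.summable z).tsum_sub (hG.summable z)]
  simp only [mul_sub]

lemma hasSum_poi (z : ℝ) : HasSum (poi z) 1 := by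
  have h := (NormedSpace.expSeries_div_hasSum_exp (𝔸 := ℝ) z).mul_left (Real.exp (-z))
  rw [← Real.exp_eq_exp_ℝ, ← Real.exp_add, neg_add_cancel, Real.exp_zero] at h
  exact h

lemma poiAvg_const (z c : ℝ) : poiAvg z (fun _ => c) = c := by
  unfold poiAvg
  rw [tsum_mul_right, (hasSum_poi z).tsum_eq, one_mul]

lemma poi_succ (z : ℝ) (m : ℕ) : poi z (m + 1) * ((m : ℝ) + 1) = z * poi z m := by
  unfold poi
  rw [Nat.factorial_succ]
  push_cast
  have : (m.factorial : ℝ) ≠ 0 := by positivity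
  have : (m : ℝ) + 1 ≠ 0 := by positivity
  field_simp
  ring

/-- Summation by parts for Poisson averages: `z E F(N + 1) = E N F(N)`. -/
lemma mul_poiAvg_succ {F : ℕ → ℝ} (hF : GeomBdd F) (z : ℝ) :
    z * poiAvg z (fun m => F (m + 1)) = poiAvg z (fun m => (m : ℝ) * F m) := by
  unfold poiAvg
  rw [((geomBdd_natCast.mul hF).summable z).tsum_eq_zero_add, ← tsum_mul_left]
  simp only [Nat.cast_zero, zero_mul, mul_zero, zero_add]
  refine tsum_congr fun m => ?_
  push_cast
  linear_combination -(F (m + 1)) * poi_succ z m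

lemma mul_poiAvg_succ_two {F : ℕ → ℝ} (hF : GeomBdd F) (z : ℝ) :
    z ^ 2 * poiAvg z (fun m => F (m + 2)) =
      poiAvg z (fun m => (m : ℝ) * ((m : ℝ) - 1) * F m) := by
  have h1 := mul_poiAvg_succ hF.succ z
  have h2 := mul_poiAvg_succ (F := fun m => ((m : ℝ) - 1) * F m)
    ((geomBdd_natCast.sub (geomBdd_const 1)).mul hF) z
  simp only [Nat.cast_add, Nat.cast_one, add_sub_cancel_right] at h2
  rw [sq, mul_assoc, h1, h2]
  simp only [mul_assoc]

lemma mul_poiAvg_succ_three {F : ℕ → ℝ} (hF : GeomBdd F) (z : ℝ) :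
    z ^ 3 * poiAvg z (fun m => F (m + 3)) =
      poiAvg z (fun m => (m : ℝ) * ((m : ℝ) - 1) * ((m : ℝ) - 2) * F m) := by
  have h1 := mul_poiAvg_succ_two hF.succ z
  have h2 := mul_poiAvg_succ (F := fun m => ((m : ℝ) - 1) * ((m : ℝ) - 2) * F m)
    (((geomBdd_natCast.sub (geomBdd_const 1)).mul
      (geomBdd_natCast.sub (geomBdd_const 2))).mul hF) z
  rw [pow_succ', mul_assoc, h1, show (fun m : ℕ => (m : ℝ) * ((m : ℝ) - 1) * F (m + 1)) =
    (fun m : ℕ => (((m + 1 : ℕ) : ℝ) - 1) * (((m + 1 : ℕ) : ℝ) - 2) * F (m + 1)) from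
      funext fun m => by push_cast; ring, h2]
  simp only [mul_assoc]

/-- The multiplier (a normalized Charlier polynomial in `m`) that represents `√z ∂_z` on Poisson
averages. -/
def charlier₁ (z : ℝ) (m : ℕ) : ℝ := ((m : ℝ) - z) / √z

/-- The multiplier that represents `z ∂_z²` on Poisson averages. -/
def charlier₂ (z : ℝ) (m : ℕ) : ℝ := ((m : ℝ) * ((m : ℝ) - 1) - 2 * z * m + z ^ 2) / z

/-- The multiplier that represents `z^{3/2} ∂_z³` on Poisson averages. -/
def charlier₃ (z : ℝ) (m : ℕ) : ℝ :=
  ((m : ℝ) * ((m : ℝ) - 1) * ((m : ℝ) - 2) - 3 * z * (m * ((m : ℝ) - 1)) + 3 * z ^ 2 * m - z ^ 3)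
    / (z * √z)

lemma geomBdd_charlier₁ (z : ℝ) : GeomBdd (charlier₁ z) :=
  (geomBdd_natCast.sub (geomBdd_const z)).div_const _

lemma geomBdd_charlier₂ (z : ℝ) : GeomBdd (charlier₂ z) :=
  (((geomBdd_natCast.mul (geomBdd_natCast.sub (geomBdd_const 1))).sub
    (geomBdd_natCast.const_mul (2 * z))).add (geomBdd_const (z ^ 2))).div_const _

lemma geomBdd_charlier₃ (z : ℝ) : GeomBdd (charlier₃ z) :=
  (((((geomBdd_natCast.mul (geomBdd_natCast.sub (geomBdd_const 1))).mul
    (geomBdd_natCast.sub (geomBdd_const 2))).sub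
    ((geomBdd_natCast.mul (geomBdd_natCast.sub (geomBdd_const 1))).const_mul (3 * z))).add
    (geomBdd_natCast.const_mul (3 * z ^ 2))).sub (geomBdd_const (z ^ 3))).div_const _

lemma poiAvg_charlier₁_mul {F : ℕ → ℝ} (hF : GeomBdd F) {z : ℝ} (hz : 0 ≤ z) :
    poiAvg z (fun m => charlier₁ z m * F m) =
      √z * (poiAvg z (fun m => F (m + 1)) - poiAvg z F) := by
  rcases hz.eq_or_lt with rfl | hz
  · simp [charlier₁, poiAvg]
  have hs : √z ≠ 0 := (Real.sqrt_pos.2 hz).ne'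
  have hss : √z * √z = z := Real.mul_self_sqrt hz.le
  have e : (fun m => charlier₁ z m * F m) =
      fun m : ℕ => (1 / √z) * ((m : ℝ) * F m - z * F m) := by
    funext m; unfold charlier₁; ring
  rw [e, poiAvg_const_mul, poiAvg_sub (geomBdd_natCast.mul hF) (hF.const_mul z), poiAvg_const_mul,
    ← mul_poiAvg_succ hF]
  field_simp
  linear_combination (poiAvg z F - poiAvg z (fun m => F (m + 1))) * hss

lemma poiAvg_charlier₂_mul {F : ℕ → ℝ} (hF : GeomBdd F) {z : ℝ} (hz : 0 ≤ z) :
    poiAvg z (fun m => charlier₂ z m * F m) =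
      z * (poiAvg z (fun m => F (m + 2)) - 2 * poiAvg z (fun m => F (m + 1)) + poiAvg z F) := by
  rcases hz.eq_or_lt with rfl | hz
  · simp [charlier₂, poiAvg]
  have e : (fun m => charlier₂ z m * F m) =
      fun m : ℕ => (1 / z) * ((m : ℝ) * ((m : ℝ) - 1) * F m - (2 * z) * ((m : ℝ) * F m)
        + z ^ 2 * F m) := by
    funext m; unfold charlier₂; ring
  have g1 := (geomBdd_natCast.mul (geomBdd_natCast.sub (geomBdd_const 1))).mul hF
  have g2 := (geomBdd_natCast.mul hF).const_mul (2 * z)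
  rw [e, poiAvg_const_mul, poiAvg_add (g1.sub g2) (hF.const_mul (z ^ 2)), poiAvg_sub g1 g2,
    poiAvg_const_mul, poiAvg_const_mul, ← mul_poiAvg_succ hF, ← mul_poiAvg_succ_two hF]
  field_simp

lemma poiAvg_charlier₃_mul {F : ℕ → ℝ} (hF : GeomBdd F) {z : ℝ} (hz : 0 ≤ z) :
    poiAvg z (fun m => charlier₃ z m * F m) =
      z * √z * (poiAvg z (fun m => F (m + 3)) - 3 * poiAvg z (fun m => F (m + 2))
        + 3 * poiAvg z (fun m => F (m + 1)) - poiAvg z F) := by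
  rcases hz.eq_or_lt with rfl | hz
  · simp [charlier₃, poiAvg]
  have hs : √z ≠ 0 := (Real.sqrt_pos.2 hz).ne'
  have hss : √z ^ 2 = z := Real.sq_sqrt hz.le
  have e : (fun m => charlier₃ z m * F m) =
      fun m : ℕ => (1 / (z * √z)) * ((m : ℝ) * ((m : ℝ) - 1) * ((m : ℝ) - 2) * F m
        - (3 * z) * ((m : ℝ) * ((m : ℝ) - 1) * F m) + (3 * z ^ 2) * ((m : ℝ) * F m)
        - z ^ 3 * F m) := by
    funext m; unfold charlier₃; ring
  have g1 := ((geomBdd_natCast.mul (geomBdd_natCast.sub (geomBdd_const 1))).mul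
    (geomBdd_natCast.sub (geomBdd_const 2))).mul hF
  have g2 := ((geomBdd_natCast.mul (geomBdd_natCast.sub (geomBdd_const 1))).mul hF).const_mul
    (3 * z)
  have g3 := (geomBdd_natCast.mul hF).const_mul (3 * z ^ 2)
  rw [e, poiAvg_const_mul, poiAvg_sub ((g1.sub g2).add g3) (hF.const_mul (z ^ 3)),
    poiAvg_add (g1.sub g2) g3, poiAvg_sub g1 g2,
    poiAvg_const_mul, poiAvg_const_mul, poiAvg_const_mul, ← mul_poiAvg_succ hF,
    ← mul_poiAvg_succ_two hF, ← mul_poiAvg_succ_three hF]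
  field_simp
  rw [hss]

/-- Summation by parts turns `E c_k²` into `z^{k/2}` times the average of the `k`-th difference of
`c_k`, which is the constant `k! z^{-k/2}`; hence `E c_k² = k!` for `z > 0`. The common bound `6`
serves `k ≤ 3`. -/
lemma poiAvg_charlier₁_sq {z : ℝ} (hz : 0 ≤ z) :
    poiAvg z (fun m => charlier₁ z m * charlier₁ z m) ≤ 6 := by
  rcases hz.eq_or_lt with rfl | hz
  · simp [charlier₁, poiAvg]
  have hs : √z ≠ 0 := (Real.sqrt_pos.2 hz).ne'
  rw [poiAvg_charlier₁_mul (geomBdd_charlier₁ z) hz.le,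
    ← poiAvg_sub (geomBdd_charlier₁ z).succ (geomBdd_charlier₁ z),
    show (fun m : ℕ => charlier₁ z (m + 1) - charlier₁ z m) = fun _ => 1 / √z from
      funext fun m => by unfold charlier₁; push_cast; ring, poiAvg_const]
  field_simp
  norm_num

lemma poiAvg_charlier₂_sq {z : ℝ} (hz : 0 ≤ z) :
    poiAvg z (fun m => charlier₂ z m * charlier₂ z m) ≤ 6 := by
  rcases hz.eq_or_lt with rfl | hz
  · simp [charlier₂, poiAvg]
  have g := geomBdd_charlier₂ z
  rw [poiAvg_charlier₂_mul g hz.le, ← poiAvg_const_mul,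
    ← poiAvg_sub g.succ.succ (g.succ.const_mul 2),
    ← poiAvg_add (g.succ.succ.sub (g.succ.const_mul 2)) g,
    show (fun m : ℕ => charlier₂ z (m + 2) - 2 * charlier₂ z (m + 1) + charlier₂ z m) =
      fun _ => 2 / z from
      funext fun m => by unfold charlier₂; push_cast; ring, poiAvg_const]
  field_simp
  norm_num

lemma poiAvg_charlier₃_sq {z : ℝ} (hz : 0 ≤ z) :
    poiAvg z (fun m => charlier₃ z m * charlier₃ z m) ≤ 6 := by
  rcases hz.eq_or_lt with rfl | hz
  · simp [charlier₃, poiAvg]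
  have hs : √z ≠ 0 := (Real.sqrt_pos.2 hz).ne'
  have g := geomBdd_charlier₃ z
  have g1 := g.succ.succ.succ.sub (g.succ.succ.const_mul 3)
  rw [poiAvg_charlier₃_mul g hz.le, ← poiAvg_const_mul, ← poiAvg_const_mul,
    ← poiAvg_sub g.succ.succ.succ (g.succ.succ.const_mul 3),
    ← poiAvg_add g1 (g.succ.const_mul 3), ← poiAvg_sub (g1.add (g.succ.const_mul 3)) g,
    show (fun m : ℕ => charlier₃ z (m + 3) - 3 * charlier₃ z (m + 2) + 3 * charlier₃ z (m + 1)
      - charlier₃ z m) = fun _ => 6 / (z * √z) from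
      funext fun m => by unfold charlier₃; push_cast; ring, poiAvg_const]
  field_simp
  norm_num

/-- The derivative of a Poisson average is the Poisson average of the difference sequence. -/
lemma hasDerivAt_poiAvg {F : ℕ → ℝ} (hF : GeomBdd F) (z : ℝ) :
    HasDerivAt (fun z => poiAvg z F) (poiAvg z (fun m => F (m + 1)) - poiAvg z F) z := by
  obtain ⟨C, K, hK, h⟩ := id hF
  have e : ∀ y, poiAvg y F = Real.exp (-y) * ∑' m : ℕ, y ^ m / (m.factorial : ℝ) * F m := by
    intro y
    unfold poiAvg poi
    rw [← tsum_mul_left]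
    exact tsum_congr fun m => by ring
  have hsum : ∀ {G : ℕ → ℝ}, GeomBdd G → ∀ y : ℝ,
      Summable fun m : ℕ => y ^ m / (m.factorial : ℝ) * G m := by
    intro G hG y
    have := (hG.summable y).mul_left (Real.exp y)
    refine this.congr fun m => ?_
    unfold poi
    rw [← mul_assoc, ← mul_assoc, ← Real.exp_add, add_neg_cancel, Real.exp_zero, one_mul]
  set R : ℝ := |z| + 1
  have hR : 0 ≤ R := by positivity
  have hd : HasDerivAt (fun y => ∑' m : ℕ, y ^ m / (m.factorial : ℝ) * F m)
      (∑' m : ℕ, ((m : ℝ) * z ^ (m - 1)) / (m.factorial : ℝ) * F m) z := by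
    have hK1 : 0 ≤ K * R := by positivity
    refine hasDerivAt_tsum_of_isPreconnected (t := Metric.ball 0 R) (y₀ := z)
      (u := fun m : ℕ => ((m : ℝ) * R ^ (m - 1)) / (m.factorial : ℝ) * (C * K ^ m))
      (g := fun (m : ℕ) (y : ℝ) => y ^ m / (m.factorial : ℝ) * F m)
      (g' := fun (m : ℕ) (y : ℝ) => ((m : ℝ) * y ^ (m - 1)) / (m.factorial : ℝ) * F m) ?_
      Metric.isOpen_ball (convex_ball 0 R).isPreconnected ?_ ?_ ?_ (hsum hF z) ?_
    · refine (summable_nat_add_iff 1).1 ?_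
      refine ((Real.summable_pow_div_factorial (R * K)).mul_left (C * K)).congr fun m => ?_
      rw [Nat.factorial_succ]
      push_cast
      have : (m.factorial : ℝ) ≠ 0 := by positivity
      have : (m : ℝ) + 1 ≠ 0 := by positivity
      field_simp
      ring_nf
    · intro m y _
      exact ((hasDerivAt_pow m y).div_const _).mul_const _
    · intro m y hy
      have hy' : |y| ≤ R := by simpa using (Metric.mem_ball.1 hy).le
      rw [Real.norm_eq_abs, abs_mul, abs_div, abs_mul, Nat.abs_cast, Nat.abs_cast, abs_pow]
      gcongr
      exact h m
    · simp [R]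
    · simp [R]
  have e2 : (∑' m : ℕ, ((m : ℝ) * z ^ (m - 1)) / (m.factorial : ℝ) * F m) =
      ∑' m : ℕ, z ^ m / (m.factorial : ℝ) * F (m + 1) := by
    have hs : Summable fun m : ℕ => ((m : ℝ) * z ^ (m - 1)) / (m.factorial : ℝ) * F m := by
      refine (summable_nat_add_iff 1).1 ((hsum hF.succ z).congr fun m => ?_)
      rw [Nat.factorial_succ]
      push_cast
      have : (m : ℝ) + 1 ≠ 0 := by positivity
      field_simp
    rw [hs.tsum_eq_zero_add]
    simp only [Nat.cast_zero, zero_mul, zero_div, zero_add]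
    refine tsum_congr fun m => ?_
    rw [Nat.factorial_succ]
    push_cast
    have : (m : ℝ) + 1 ≠ 0 := by positivity
    field_simp
  have hfin := ((hasDerivAt_neg z).exp).mul hd
  rw [e2] at hfin
  have e3 : poiAvg z (fun m => F (m + 1)) =
      Real.exp (-z) * ∑' m : ℕ, z ^ m / (m.factorial : ℝ) * F (m + 1) := by
    unfold poiAvg poi
    rw [← tsum_mul_left]
    exact tsum_congr fun m => by ring
  rw [show (fun z => poiAvg z F) = _ from funext e, e3]
  refine hfin.congr_deriv ?_
  rw [e z]
  ring

/-! ### The kernel as a Poisson mixture of Gamma laws -/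

/-- The density of the Gamma law with shape `k` and scale `τ`. -/
def gammaDensity (k τ x : ℝ) : ℝ := x ^ (k - 1) * Real.exp (-x / τ) / (τ ^ k * Real.Gamma k)

/-- The Gamma law with shape `k ≥ 0` and scale `τ`; for `k = 0` it is the point mass at `0`. -/
def gammaLaw (k τ : ℝ) : Measure ℝ :=
  if k = 0 then Measure.dirac 0
  else (volume.restrict (Ioi 0)).withDensity (fun x => ENNReal.ofReal (gammaDensity k τ x))

/-- The mixture `∑ₘ b(m) e^{-z} z^m / m! Γ(m + δ, τ)` of Gamma laws with Poisson weights and an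
additional weight `b`. -/
def poiGamma (δ τ z : ℝ) (b : ℕ → ℝ) : Measure ℝ :=
  Measure.sum fun m : ℕ => ENNReal.ofReal (poi z m * b m) • gammaLaw (m + δ) τ

lemma measurable_gammaDensity (k : ℝ) : Measurable (fun w : ℝ × ℝ => gammaDensity k w.1 w.2) := by
  unfold gammaDensity
  fun_prop

lemma measurable_gammaDensity' (k τ : ℝ) : Measurable (gammaDensity k τ) :=
  (measurable_gammaDensity k).comp (measurable_const.prodMk measurable_id)

lemma gammaDensity_nonneg {k τ x : ℝ} (hk : 0 ≤ k) (hτ : 0 < τ) (hx : 0 < x) :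
    0 ≤ gammaDensity k τ x := by
  unfold gammaDensity
  have := Real.Gamma_nonneg_of_nonneg hk
  positivity

lemma gammaDensity_zero (τ x : ℝ) : gammaDensity 0 τ x = 0 := by
  simp [gammaDensity, Real.Gamma_zero]

lemma gammaDensity_eq {k τ x : ℝ} (hτ : 0 < τ) (hx : 0 < x) :
    gammaDensity k τ x = ((x / τ) ^ (k - 1) * Real.exp (-(x / τ)) / Real.Gamma k) / τ := by
  unfold gammaDensity
  rw [Real.div_rpow hx.le hτ.le, Real.rpow_sub_one hτ.ne', neg_div]
  field_simp

/-- The moment generating function of the Gamma law. -/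
lemma lintegral_exp_gammaLaw {k τ l : ℝ} (hk : 0 ≤ k) (hτ : 0 < τ) (hl : l < 1) :
    ∫⁻ x, ENNReal.ofReal (Real.exp (l * (x / τ))) ∂gammaLaw k τ =
      ENNReal.ofReal ((1 - l) ^ (-k)) := by
  unfold gammaLaw
  rcases hk.eq_or_lt with rfl | hk
  · simp
  rw [if_neg hk.ne', lintegral_withDensity_eq_lintegral_mul _
    (measurable_gammaDensity' k τ).ennreal_ofReal (by fun_prop)]
  have h1l : 0 < 1 - l := by linarith
  have hr : 0 < (1 - l) / τ := by positivity
  have hΓ := Real.Gamma_pos_of_pos hk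
  have hint := Real.integral_rpow_mul_exp_neg_mul_Ioi hk hr
  have hi : IntegrableOn (fun t : ℝ => t ^ (k - 1) * Real.exp (-((1 - l) / τ * t))) (Ioi 0) := by
    by_contra hcon
    rw [integral_undef hcon] at hint
    have : 0 < (1 / ((1 - l) / τ)) ^ k * Real.Gamma k := by positivity
    linarith
  have e : ∀ x ∈ Ioi (0 : ℝ), ((fun x => ENNReal.ofReal (gammaDensity k τ x)) *
      fun x => ENNReal.ofReal (Real.exp (l * (x / τ)))) x =
      ENNReal.ofReal ((1 / (τ ^ k * Real.Gamma k)) *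
        (x ^ (k - 1) * Real.exp (-((1 - l) / τ * x)))) := by
    intro x hx
    have hx : 0 < x := hx
    rw [Pi.mul_apply, ← ENNReal.ofReal_mul (gammaDensity_nonneg hk.le hτ hx)]
    congr 1
    unfold gammaDensity
    rw [show -((1 - l) / τ * x) = -x / τ + l * (x / τ) by ring, Real.exp_add]
    ring
  rw [setLIntegral_congr_fun measurableSet_Ioi e,
    ← ofReal_integral_eq_lintegral_ofReal (hi.const_mul _)
      ((ae_restrict_mem measurableSet_Ioi).mono fun x hx => by
        have hx : 0 < x := hx
        simp only [Pi.zero_apply]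
        positivity), integral_const_mul, hint]
  congr 1
  rw [one_div_div, Real.div_rpow hτ.le h1l.le, Real.rpow_neg h1l.le]
  have := Real.rpow_pos_of_pos hτ k
  have := Real.rpow_pos_of_pos h1l k
  field_simp

lemma isProbabilityMeasure_gammaLaw {k τ : ℝ} (hk : 0 ≤ k) (hτ : 0 < τ) :
    IsProbabilityMeasure (gammaLaw k τ) := by
  have h := lintegral_exp_gammaLaw hk hτ zero_lt_one
  simp at h
  exact ⟨h⟩

lemma lintegral_poiGamma (δ τ z : ℝ) (b : ℕ → ℝ) (f : ℝ → ENNReal) :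
    ∫⁻ x, f x ∂poiGamma δ τ z b =
      ∑' m : ℕ, ENNReal.ofReal (poi z m * b m) * ∫⁻ x, f x ∂gammaLaw (m + δ) τ := by
  unfold poiGamma
  rw [lintegral_sum_measure]
  simp

lemma setLIntegral_poiGamma (δ τ z : ℝ) (b : ℕ → ℝ) (f : ℝ → ENNReal) {s : Set ℝ}
    (hs : MeasurableSet s) :
    ∫⁻ x in s, f x ∂poiGamma δ τ z b =
      ∑' m : ℕ, ENNReal.ofReal (poi z m * b m) * ∫⁻ x in s, f x ∂gammaLaw (m + δ) τ := by
  unfold poiGamma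
  rw [Measure.restrict_sum _ hs, lintegral_sum_measure]
  simp [Measure.restrict_smul]

lemma setLIntegral_gammaLaw {k τ c : ℝ} (hc : 0 < c) {f : ℝ → ENNReal} (hf : Measurable f) :
    ∫⁻ x in Ioi c, f x ∂gammaLaw k τ =
      ∫⁻ x in Ioi c, ENNReal.ofReal (gammaDensity k τ x) * f x := by
  unfold gammaLaw
  split_ifs with h
  · subst h
    rw [restrict_dirac' measurableSet_Ioi, if_neg (by simpa using hc.le)]
    simp [gammaDensity_zero]
  · rw [restrict_withDensity measurableSet_Ioi, Measure.restrict_restrict measurableSet_Ioi,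
      inter_eq_left.2 (Ioi_subset_Ioi hc.le), lintegral_withDensity_eq_lintegral_mul _
      (measurable_gammaDensity' k τ).ennreal_ofReal hf]
    rfl

/-- A mixture of Gamma laws with positive shapes has the mixture of the densities as density. -/
lemma sum_gammaLaw_eq_withDensity {τ : ℝ} (hτ : 0 < τ) {k c : ℕ → ℝ} (hk : ∀ m, 0 < k m)
    (hc : ∀ m, 0 ≤ c m) {D : ℝ → ℝ}
    (hD : ∀ x, 0 < x → HasSum (fun m => c m * gammaDensity (k m) τ x) (D x)) :
    Measure.sum (fun m : ℕ => ENNReal.ofReal (c m) • gammaLaw (k m) τ) =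
      (volume.restrict (Ioi 0)).withDensity (fun x => ENNReal.ofReal (D x)) := by
  have e : ∀ m, ENNReal.ofReal (c m) • gammaLaw (k m) τ = (volume.restrict (Ioi 0)).withDensity
      (fun x => ENNReal.ofReal (c m) * ENNReal.ofReal (gammaDensity (k m) τ x)) := by
    intro m
    rw [gammaLaw, if_neg (hk m).ne', ← withDensity_smul _
      (measurable_gammaDensity' _ τ).ennreal_ofReal]
    rfl
  simp only [e]
  rw [← withDensity_tsum (fun m => (measurable_gammaDensity' _ τ).ennreal_ofReal.const_mul _)]
  refine withDensity_congr_ae ((ae_restrict_mem measurableSet_Ioi).mono fun x hx => ?_)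
  have hx : 0 < x := hx
  beta_reduce
  rw [ENNReal.tsum_apply, ← (hD x hx).tsum_eq, ENNReal.ofReal_tsum_of_nonneg
    (fun m => mul_nonneg (hc m) (gammaDensity_nonneg (hk m).le hτ hx)) (hD x hx).summable]
  exact tsum_congr fun m => (ENNReal.ofReal_mul (hc m)).symm

lemma geomBdd_one_div_Gamma {δ : ℝ} (hδ : 0 < δ) :
    GeomBdd (fun m : ℕ => 1 / Real.Gamma (m + δ)) := by
  refine ⟨1 / Real.Gamma δ, 1 / δ, by positivity, fun m => ?_⟩
  induction m with
  | zero => simp [abs_of_pos (Real.Gamma_pos_of_pos hδ)]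
  | succ m ih =>
    have h0 : (0 : ℝ) < m + δ := by positivity
    have hΓ := Real.Gamma_pos_of_pos h0
    have e : 1 / Real.Gamma (((m + 1 : ℕ) : ℝ) + δ) = 1 / Real.Gamma (m + δ) * (1 / (m + δ)) := by
      rw [show ((m + 1 : ℕ) : ℝ) + δ = m + δ + 1 by push_cast; ring, Real.Gamma_add_one h0.ne']
      field_simp
    beta_reduce at ih ⊢
    rw [e, abs_mul, pow_succ, ← mul_assoc]
    refine mul_le_mul ih ?_ (abs_nonneg _) ((abs_nonneg _).trans ih)
    rw [abs_of_pos (by positivity)]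
    exact one_div_le_one_div_of_le hδ (by linarith [Nat.cast_nonneg (α := ℝ) m])

lemma hasSum_psi {δ : ℝ} (hδ : 0 < δ) (w : ℝ) :
    HasSum (fun m : ℕ => w ^ m / ((m.factorial : ℝ) * Real.Gamma ((m : ℝ) + δ))) (psi δ w) := by
  have h := ((geomBdd_one_div_Gamma hδ).summable w).mul_left (Real.exp w)
  refine Summable.hasSum (h.congr fun m => ?_)
  unfold poi
  rw [← mul_assoc, ← mul_assoc, ← Real.exp_add, add_neg_cancel, Real.exp_zero, one_mul,
    div_mul_div_comm, mul_one]

/-- The kernel is the law of a Gamma variable whose shape is shifted by a Poisson variable. -/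
lemma kernel₁_eq_poiGamma {δ τ x : ℝ} (hδ : 0 ≤ δ) (hτ : 0 < τ) (hx : 0 ≤ x) :
    kernel₁ δ τ x = poiGamma δ τ (x / τ) (fun _ => 1) := by
  have hz : 0 ≤ x / τ := by positivity
  unfold kernel₁ poiGamma
  simp only [mul_one]
  rcases hδ.eq_or_lt with rfl | hδ
  · have hsplit : ∀ μ : ℕ → Measure ℝ, Measure.sum μ = Measure.sum (fun m => μ (m + 1)) + μ 0 := by
      intro μ
      ext s hs
      rw [Measure.sum_apply _ hs, Measure.add_apply, Measure.sum_apply _ hs,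
        tsum_eq_zero_add' ENNReal.summable, add_comm]
    rw [hsplit, if_pos rfl]
    congr 1
    · symm
      refine sum_gammaLaw_eq_withDensity hτ (k := fun m => ((m + 1 : ℕ) : ℝ) + 0)
        (fun m => by positivity) (fun m => poi_nonneg hz _) (fun y hy => ?_)
      have h := (hasSum_psi (δ := 2) two_pos (x * y / τ ^ 2)).mul_left
        (x / τ ^ 2 * Real.exp (-(x + y) / τ))
      rw [density, if_pos rfl]
      refine h.congr_fun fun m => ?_
      unfold poi gammaDensity
      rw [show ((m : ℝ) + 2) = ((m + 1 : ℕ) : ℝ) + 1 by push_cast; ring,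
        Real.Gamma_nat_eq_factorial, add_zero,
        show (((m + 1 : ℕ) : ℝ)) = (m : ℝ) + 1 by push_cast; ring, Real.Gamma_nat_eq_factorial,
        add_sub_cancel_right, Real.rpow_natCast, Real.rpow_add_one hτ.ne', Real.rpow_natCast,
        show -(x + y) / τ = -(x / τ) + -y / τ by ring, Real.exp_add, div_pow, div_pow, mul_pow]
      field_simp
      ring
    · simp [poi, gammaLaw, neg_div]
  · rw [if_neg hδ.ne', add_zero]
    symm
    refine sum_gammaLaw_eq_withDensity hτ (fun m => by positivity) (fun m => poi_nonneg hz _)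
      (fun y hy => ?_)
    have h := (hasSum_psi hδ (x * y / τ ^ 2)).mul_left
        ((y / τ) ^ δ * Real.exp (-(x + y) / τ) / y)
    rw [density, if_neg hδ.ne', mul_div_right_comm]
    refine h.congr_fun fun m => ?_
    unfold poi gammaDensity
    have hΓ := Real.Gamma_pos_of_pos (show (0 : ℝ) < m + δ by positivity)
    rw [show -(x + y) / τ = -(x / τ) + -y / τ by ring, Real.exp_add, div_pow, div_pow, mul_pow,
      Real.div_rpow hy.le hτ.le, Real.rpow_sub_one hy.ne', Real.rpow_add hy, Real.rpow_add hτ,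
      Real.rpow_natCast, Real.rpow_natCast]
    have := Real.rpow_pos_of_pos hτ δ
    field_simp
    ring

lemma isProbabilityMeasure_poiGamma {δ τ z : ℝ} (hδ : 0 ≤ δ) (hτ : 0 < τ) (hz : 0 ≤ z) :
    IsProbabilityMeasure (poiGamma δ τ z (fun _ => 1)) := by
  constructor
  rw [← lintegral_one, lintegral_poiGamma]
  have : ∀ m : ℕ, ∫⁻ x, 1 ∂gammaLaw (m + δ) τ = 1 := fun m => by
    have := isProbabilityMeasure_gammaLaw (k := m + δ) (by positivity) hτ
    simp
  simp only [this, mul_one]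
  rw [← ENNReal.ofReal_tsum_of_nonneg (poi_nonneg hz) (hasSum_poi z).summable,
    (hasSum_poi z).tsum_eq, ENNReal.ofReal_one]

/-- The moment generating function of the kernel. -/
lemma lintegral_exp_poiGamma {δ τ z l : ℝ} (hδ : 0 ≤ δ) (hτ : 0 < τ) (hz : 0 ≤ z) (hl : l < 1) :
    ∫⁻ x, ENNReal.ofReal (Real.exp (l * (x / τ))) ∂poiGamma δ τ z (fun _ => 1) =
      ENNReal.ofReal ((1 - l) ^ (-δ) * Real.exp (z * l / (1 - l))) := by
  have h1l : 0 < 1 - l := by linarith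
  rw [lintegral_poiGamma]
  have e : ∀ m : ℕ, ENNReal.ofReal (poi z m * 1) *
      ∫⁻ x, ENNReal.ofReal (Real.exp (l * (x / τ))) ∂gammaLaw (m + δ) τ =
      ENNReal.ofReal ((1 - l) ^ (-δ) * Real.exp (-z) *
        ((z / (1 - l)) ^ m / (m.factorial : ℝ))) := by
    intro m
    rw [lintegral_exp_gammaLaw (by positivity) hτ hl, mul_one,
      ← ENNReal.ofReal_mul (poi_nonneg hz m), neg_add, Real.rpow_add h1l, Real.rpow_neg h1l.le,
      Real.rpow_natCast]
    congr 1
    unfold poi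
    rw [div_pow]
    field_simp
  have hs := (NormedSpace.expSeries_div_hasSum_exp (𝔸 := ℝ) (z / (1 - l))).mul_left
    ((1 - l) ^ (-δ) * Real.exp (-z))
  rw [tsum_congr e, ← ENNReal.ofReal_tsum_of_nonneg (fun m => by positivity) hs.summable,
    hs.tsum_eq, ← Real.exp_eq_exp_ℝ, mul_assoc, ← Real.exp_add]
  congr 3
  field_simp
  ring

/-! ### Gaussian bounds for the kernel -/

/-- A uniform Stirling-type bound: the maximum of the Gamma density of shape `k` is `O(k^{-1/2})`.
It comes from restricting the Gamma integral to `[a, a + √a]`, `a = k - 1/2`. -/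
lemma rpow_mul_exp_neg_le_Gamma {k Y : ℝ} (hk : 1 ≤ k) (hY : 0 < Y) :
    Y ^ (k - 1 / 2) * Real.exp (-Y) ≤ 3 * Real.Gamma k := by
  set a : ℝ := k - 1 / 2 with ha
  have ha2 : 1 / 2 ≤ a := by linarith
  have ha0 : 0 < a := by linarith
  have h1 : Y ^ a * Real.exp (-Y) ≤ a ^ a * Real.exp (-a) := by
    have h := Real.add_one_le_exp (Y / a - 1)
    have h' : Y ^ a ≤ (a * Real.exp (Y / a - 1)) ^ a := by
      refine Real.rpow_le_rpow hY.le ?_ ha0.le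
      have : Y / a ≤ Real.exp (Y / a - 1) := by linarith
      calc Y = a * (Y / a) := by field_simp
        _ ≤ _ := by gcongr
    rw [Real.mul_rpow ha0.le (Real.exp_pos _).le, ← Real.exp_mul,
      show (Y / a - 1) * a = Y - a by field_simp] at h'
    calc Y ^ a * Real.exp (-Y) ≤ a ^ a * Real.exp (Y - a) * Real.exp (-Y) := by gcongr
      _ = a ^ a * Real.exp (-a) := by rw [mul_assoc, ← Real.exp_add]; ring_nf
  refine h1.trans ?_
  have hsa : 0 < √a := Real.sqrt_pos.2 ha0
  have hsq : √a ^ 2 = a := Real.sq_sqrt ha0.le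
  have hΓ := Real.Gamma_eq_integral (s := k) (by linarith)
  have hconv := Real.GammaIntegral_convergent (s := k) (by linarith)
  have hsub : Ioc a (a + √a) ⊆ Ioi 0 := fun x hx => ha0.trans hx.1
  have hle : ∫ x in Ioc a (a + √a), Real.exp (-x) * x ^ (k - 1) ≤ Real.Gamma k := by
    rw [hΓ]
    refine setIntegral_mono_set hconv ?_ hsub.eventuallyLE
    exact (ae_restrict_mem measurableSet_Ioi).mono fun x hx => by
      have hx : 0 < x := hx
      simp only [Pi.zero_apply]; positivity
  have hsa3 : a + √a ≤ 3 * a := by nlinarith [sq_nonneg (√a - 1)]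
  have hlow : ∀ x ∈ Ioc a (a + √a),
      a ^ a * Real.exp (-a) * Real.exp (-(1 / 2)) / √(3 * a) ≤ Real.exp (-x) * x ^ (k - 1) := by
    intro x hx
    have hx0 : 0 < x := hsub hx
    have hw : 0 ≤ (x - a) / a := div_nonneg (by linarith [hx.1]) ha0.le
    have hlog := Real.le_log_one_add_of_nonneg hw
    have hx1 : 1 + (x - a) / a = x / a := by field_simp; ring
    rw [hx1] at hlog
    have hlog2 : (x - a) / a - ((x - a) / a) ^ 2 / 2 ≤ Real.log (x / a) := by
      refine le_trans ?_ hlog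
      rw [le_div_iff₀ (by linarith)]
      nlinarith [pow_nonneg hw 3]
    have hxa : a * (((x - a) / a) - ((x - a) / a) ^ 2 / 2) ≥ (x - a) - 1 / 2 := by
      have h1 : (x - a) ^ 2 ≤ a := by
        rw [← hsq]
        exact pow_le_pow_left₀ (by linarith [hx.1]) (by linarith [hx.2]) 2
      have h2 : a * (((x - a) / a) - ((x - a) / a) ^ 2 / 2) = (x - a) - (x - a) ^ 2 / a / 2 := by
        field_simp
      have h3 : (x - a) ^ 2 / a ≤ 1 := by rw [div_le_one ha0]; exact h1
      rw [h2]; linarith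
    have hpow : a ^ a * Real.exp ((x - a) - 1 / 2) ≤ x ^ a := by
      have : x ^ a = a ^ a * (x / a) ^ a := by
        rw [← Real.mul_rpow ha0.le (by positivity)]; congr 1; field_simp
      rw [this, Real.rpow_def_of_pos (show 0 < x / a by positivity)]
      gcongr
      nlinarith [mul_le_mul_of_nonneg_left hlog2 ha0.le]
    have hk1 : x ^ (k - 1) = x ^ a / √x := by
      rw [Real.sqrt_eq_rpow, ← Real.rpow_sub hx0]; congr 1; rw [ha]; ring
    have hsx : √x ≤ √(3 * a) := Real.sqrt_le_sqrt (by linarith [hx.2])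
    rw [hk1]
    calc a ^ a * Real.exp (-a) * Real.exp (-(1 / 2)) / √(3 * a)
        ≤ a ^ a * Real.exp (-a) * Real.exp (-(1 / 2)) / √x := by
          have := Real.sqrt_pos.2 hx0
          gcongr
      _ = Real.exp (-x) * ((a ^ a * Real.exp ((x - a) - 1 / 2)) / √x) := by
          rw [show -a = -x + (x - a) by ring, Real.exp_add,
            show (x - a) - 1 / 2 = (x - a) + -(1 / 2) by ring, Real.exp_add]
          ring
      _ ≤ _ := by gcongr
  have hint : a ^ a * Real.exp (-a) * Real.exp (-(1 / 2)) / √(3 * a) * √a ≤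
      ∫ x in Ioc a (a + √a), Real.exp (-x) * x ^ (k - 1) := by
    have h := setIntegral_mono_on (μ := volume)
      (integrableOn_const (C := a ^ a * Real.exp (-a) * Real.exp (-(1 / 2)) / √(3 * a))
        (by simp)) (hconv.mono_set hsub)
      measurableSet_Ioc hlow
    rw [setIntegral_const] at h
    simpa [mul_comm, hsa.le] using h
  have h3 : √(3 * a) = √3 * √a := Real.sqrt_mul (by norm_num) a
  have hs3 : √3 ≤ 1.733 := Real.sqrt_le_iff.2 ⟨by norm_num, by norm_num⟩
  have he : Real.exp (1 / 2) ≤ 1.65 := by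
    have h := Real.exp_one_lt_d9
    have h2 : Real.exp (1 / 2) ^ 2 = Real.exp 1 := by
      rw [← Real.exp_nat_mul]; norm_num
    nlinarith [Real.exp_pos (1 / 2)]
  have hee : Real.exp (1 / 2) * Real.exp (-(1 / 2)) = 1 := by rw [← Real.exp_add]; simp
  have hs30 : 0 < √3 := by positivity
  have hfin := hint.trans hle
  rw [h3, div_mul_eq_mul_div, mul_div_mul_right _ _ hsa.ne', div_le_iff₀ hs30] at hfin
  have hG : 0 < Real.Gamma k := Real.Gamma_pos_of_pos (by linarith)
  calc a ^ a * Real.exp (-a) = a ^ a * Real.exp (-a) * Real.exp (-(1 / 2)) * Real.exp (1 / 2) := by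
        rw [mul_assoc _ (Real.exp (-(1 / 2))), mul_comm (Real.exp (-(1 / 2))), hee, mul_one]
    _ ≤ Real.Gamma k * √3 * Real.exp (1 / 2) := by gcongr
    _ ≤ Real.Gamma k * 1.733 * 1.65 := by gcongr
    _ ≤ 3 * Real.Gamma k := by nlinarith

/-- Away from `0` the Gamma densities of shape `m + δ` are bounded by a multiple of `Y^{-1/2}`,
uniformly in `m`. -/
lemma exists_gamma_bound {δ c : ℝ} (hδ : 0 ≤ δ) (hc : 0 < c) :
    ∃ C : ℝ, 0 < C ∧ ∀ (m : ℕ) (Y : ℝ), c ≤ Y →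
      Y ^ ((m : ℝ) + δ - 1) * Real.exp (-Y) / Real.Gamma (m + δ) ≤ C / √Y := by
  have hΓ0 : 0 ≤ Real.Gamma δ := Real.Gamma_nonneg_of_nonneg hδ
  refine ⟨3 + c ^ (δ - 1) / Real.Gamma δ, by positivity, fun m Y hY => ?_⟩
  have hY0 : 0 < Y := hc.trans_le hY
  have hs : 0 < √Y := Real.sqrt_pos.2 hY0
  by_cases hk : 1 ≤ (m : ℝ) + δ
  · have h := rpow_mul_exp_neg_le_Gamma hk hY0
    have hG : 0 < Real.Gamma (m + δ) := Real.Gamma_pos_of_pos (by linarith)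
    have e : Y ^ ((m : ℝ) + δ - 1) = Y ^ ((m : ℝ) + δ - 1 / 2) / √Y := by
      rw [Real.sqrt_eq_rpow, ← Real.rpow_sub hY0]; congr 1; ring
    rw [e, div_mul_eq_mul_div, div_div, div_le_div_iff₀ (by positivity) hs]
    have h0 : 0 ≤ c ^ (δ - 1) / Real.Gamma δ := by positivity
    have h2 : Y ^ ((m : ℝ) + δ - 1 / 2) * Real.exp (-Y) * √Y ≤ 3 * Real.Gamma (m + δ) * √Y := by
      gcongr
    have : 0 ≤ c ^ (δ - 1) / Real.Gamma δ * (√Y * Real.Gamma (m + δ)) := by positivity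
    nlinarith
  · have hm : m = 0 := by
      by_contra hm
      have : (1 : ℝ) ≤ m := by exact_mod_cast Nat.one_le_iff_ne_zero.2 hm
      exact hk (by linarith)
    subst hm
    simp only [Nat.cast_zero, zero_add] at hk ⊢
    have h1 : Y ^ (δ - 1) ≤ c ^ (δ - 1) :=
      Real.rpow_le_rpow_of_nonpos hc hY (by linarith)
    have h2 : Real.exp (-Y) ≤ 1 / √Y := by
      rw [le_div_iff₀ hs]
      have h3 : √Y ≤ Real.exp Y := by
        have := Real.add_one_le_exp Y
        nlinarith [Real.sq_sqrt hY0.le, sq_nonneg (√Y - 1)]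
      calc Real.exp (-Y) * √Y ≤ Real.exp (-Y) * Real.exp Y := by gcongr
        _ = 1 := by rw [← Real.exp_add]; simp
    calc Y ^ (δ - 1) * Real.exp (-Y) / Real.Gamma δ
        ≤ c ^ (δ - 1) * (1 / √Y) / Real.Gamma δ := by gcongr
      _ = c ^ (δ - 1) / Real.Gamma δ / √Y := by ring
      _ ≤ _ := by gcongr; linarith

/-- The exponent of the optimal exponential tilt `1 - l = (s + 1) / (ξ + 1)`; the shift by `1`
keeps the tilt away from its singularity and costs only the linear term `|ξ - s|`. -/
lemma tilt_exponent {s ξ : ℝ} (hs : 0 ≤ s) (hξ : 0 ≤ ξ) :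
    s ^ 2 * (1 - (s + 1) / (ξ + 1)) / ((s + 1) / (ξ + 1)) - (1 - (s + 1) / (ξ + 1)) * ξ ^ 2 ≤
      -(ξ - s) ^ 2 + |ξ - s| := by
  have h1 : 0 < s + 1 := by linarith
  have h2 : 0 < ξ + 1 := by linarith
  have e : s ^ 2 * (1 - (s + 1) / (ξ + 1)) / ((s + 1) / (ξ + 1)) -
      (1 - (s + 1) / (ξ + 1)) * ξ ^ 2 =
      -(ξ - s) ^ 2 + (ξ - s) ^ 2 / ((s + 1) * (ξ + 1)) := by
    field_simp
    ring
  rw [e]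
  gcongr
  rw [div_le_iff₀ (by positivity), ← sq_abs, sq]
  gcongr
  rw [abs_le]
  constructor <;> nlinarith [mul_nonneg hs hξ]

lemma tilt_ratio {s ξ : ℝ} (hs : 0 ≤ s) (hξ : 0 ≤ ξ) :
    (s + 1) / (ξ + 1) ≤ 1 + |ξ - s| ∧ ((s + 1) / (ξ + 1))⁻¹ ≤ 1 + |ξ - s| := by
  have h1 : 0 < s + 1 := by linarith
  have h2 : 0 < ξ + 1 := by linarith
  have h3 := abs_nonneg (ξ - s)
  rw [inv_div, div_le_iff₀ h1, div_le_iff₀ h2]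
  constructor
  · nlinarith [neg_abs_le (ξ - s), mul_nonneg h3 hξ]
  · nlinarith [le_abs_self (ξ - s), mul_nonneg h3 hs]

lemma rpow_tilt_le {s ξ p : ℝ} (hs : 0 ≤ s) (hξ : 0 ≤ ξ) :
    ((s + 1) / (ξ + 1)) ^ p ≤ (1 + |ξ - s|) ^ |p| := by
  obtain ⟨h1, h2⟩ := tilt_ratio hs hξ
  have h0 : 0 < (s + 1) / (ξ + 1) := by positivity
  rcases le_total 0 p with hp | hp
  · rw [abs_of_nonneg hp]
    exact Real.rpow_le_rpow h0.le h1 hp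
  · rw [abs_of_nonpos hp, ← inv_inv ((s + 1) / (ξ + 1)), Real.inv_rpow (by positivity),
      ← Real.rpow_neg (by positivity)]
    exact Real.rpow_le_rpow (by positivity) h2 (by linarith)

/-- A tilted exponential moment of the kernel, with `z = s²`. -/
lemma lintegral_tilt_le {δ τ s ξ : ℝ} (hδ : 0 ≤ δ) (hτ : 0 < τ) (hs : 0 ≤ s) (hξ : 0 ≤ ξ) :
    ∫⁻ x, ENNReal.ofReal (Real.exp ((1 - (s + 1) / (ξ + 1)) * (x / τ - ξ ^ 2)))
      ∂poiGamma δ τ (s ^ 2) (fun _ => 1) ≤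
      ENNReal.ofReal ((1 + |ξ - s|) ^ δ * Real.exp (-(ξ - s) ^ 2 + |ξ - s|)) := by
  have h0 : 0 < (s + 1) / (ξ + 1) := by positivity
  set l := 1 - (s + 1) / (ξ + 1) with hl
  have hl1 : 1 - l = (s + 1) / (ξ + 1) := by rw [hl]; ring
  have e : ∀ x, ENNReal.ofReal (Real.exp (l * (x / τ - ξ ^ 2))) =
      ENNReal.ofReal (Real.exp (-(l * ξ ^ 2))) * ENNReal.ofReal (Real.exp (l * (x / τ))) := by
    intro x
    rw [← ENNReal.ofReal_mul (Real.exp_pos _).le, ← Real.exp_add]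
    congr 2
    ring
  simp only [e]
  rw [lintegral_const_mul _ (by fun_prop), lintegral_exp_poiGamma hδ hτ (sq_nonneg s) (by linarith),
    ← ENNReal.ofReal_mul (Real.exp_pos _).le, hl1]
  refine ENNReal.ofReal_le_ofReal ?_
  have h1 := rpow_tilt_le (p := -δ) hs hξ
  rw [abs_neg, abs_of_nonneg hδ] at h1
  have h2 := tilt_exponent hs hξ
  rw [← hl] at h2
  calc Real.exp (-(l * ξ ^ 2)) *
        (((s + 1) / (ξ + 1)) ^ (-δ) * Real.exp (s ^ 2 * l / ((s + 1) / (ξ + 1))))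
      = ((s + 1) / (ξ + 1)) ^ (-δ) *
        Real.exp (s ^ 2 * l / ((s + 1) / (ξ + 1)) - l * ξ ^ 2) := by
        rw [sub_eq_add_neg, Real.exp_add]; ring
    _ ≤ _ := by gcongr

/-- The Gaussian moments with exponent below the critical one converge. -/
lemma summable_gaussian_tail (δ : ℝ) (hδ : 0 ≤ δ) :
    Summable fun n : ℕ => Real.exp (9 / 10 * ((n : ℝ) + 1) ^ 2) *
      ((1 + (n : ℝ)) ^ δ * Real.exp (-(n : ℝ) ^ 2 + n)) := by
  have hg : Summable fun n : ℕ => Real.exp (9 / 10 + 10 * (4 + δ) ^ 2) * Real.exp (-1) ^ n := by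
    refine (summable_geometric_of_lt_one (Real.exp_pos _).le ?_).mul_left _
    rw [Real.exp_lt_one_iff]; norm_num
  refine Summable.of_nonneg_of_le (fun n => by positivity) (fun n => ?_) hg
  have hn : (0 : ℝ) ≤ n := Nat.cast_nonneg n
  have h1 : (1 + (n : ℝ)) ^ δ ≤ Real.exp (n * δ) := by
    rw [Real.exp_mul]
    exact Real.rpow_le_rpow (by positivity) (by linarith [Real.add_one_le_exp (n : ℝ)]) hδ
  calc _ ≤ Real.exp (9 / 10 * ((n : ℝ) + 1) ^ 2) *
      (Real.exp (n * δ) * Real.exp (-(n : ℝ) ^ 2 + n)) := by gcongr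
    _ = Real.exp (9 / 10 * ((n : ℝ) + 1) ^ 2 + (n * δ + (-(n : ℝ) ^ 2 + n))) := by
      simp only [Real.exp_add]
    _ ≤ Real.exp (9 / 10 + 10 * (4 + δ) ^ 2 + n * (-1)) := by
      refine Real.exp_le_exp.2 ?_
      nlinarith [sq_nonneg ((n : ℝ) - 20 * (4 + δ)), mul_nonneg hn hδ]
    _ = _ := by rw [Real.exp_add, Real.exp_nat_mul]

lemma sqrt_sub_sq_div {τ : ℝ} (hτ : 0 < τ) (x y : ℝ) :
    (√x - √y) ^ 2 / τ = (√(y / τ) - √(x / τ)) ^ 2 := by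
  rw [Real.sqrt_div' _ hτ.le, Real.sqrt_div' _ hτ.le, ← sub_div, div_pow, Real.sq_sqrt hτ.le]
  ring

/-- The Gaussian exponential is dominated by a series of linear exponentials, to which the formula
for the moment generating function applies. -/
lemma exp_sq_le_tsum (s X : ℝ) (hs : 0 ≤ s) :
    ENNReal.ofReal (Real.exp (9 / 10 * (√X - s) ^ 2)) ≤
      ∑' n : ℕ, (ENNReal.ofReal (Real.exp (9 / 10 * ((n : ℝ) + 1) ^ 2)) *
        ENNReal.ofReal (Real.exp ((1 - (s + 1) / (s + n + 1)) * (X - (s + n) ^ 2))) +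
        if (n : ℝ) ≤ s then ENNReal.ofReal (Real.exp (9 / 10 * ((n : ℝ) + 1) ^ 2)) *
        ENNReal.ofReal (Real.exp ((1 - (s + 1) / (s - n + 1)) * (X - (s - n) ^ 2))) else 0) := by
  set n := ⌊|√X - s|⌋₊ with hn
  have hn1 : (n : ℝ) ≤ |√X - s| := Nat.floor_le (abs_nonneg _)
  have hn2 : |√X - s| < n + 1 := Nat.lt_floor_add_one _
  have hn0 : (0 : ℝ) ≤ n := Nat.cast_nonneg n
  have hX0 : 0 ≤ √X := Real.sqrt_nonneg X
  have hmain : ENNReal.ofReal (Real.exp (9 / 10 * (√X - s) ^ 2)) ≤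
      ENNReal.ofReal (Real.exp (9 / 10 * ((n : ℝ) + 1) ^ 2)) := by
    refine ENNReal.ofReal_le_ofReal (Real.exp_le_exp.2 ?_)
    rw [← sq_abs (√X - s)]
    have := abs_nonneg (√X - s)
    gcongr
  have hexp : ∀ y : ℝ, 0 ≤ y → ENNReal.ofReal (Real.exp (9 / 10 * ((n : ℝ) + 1) ^ 2)) ≤
      ENNReal.ofReal (Real.exp (9 / 10 * ((n : ℝ) + 1) ^ 2)) * ENNReal.ofReal (Real.exp y) := by
    intro y hy
    rw [← ENNReal.ofReal_mul (Real.exp_pos _).le]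
    refine ENNReal.ofReal_le_ofReal ?_
    exact le_mul_of_one_le_right (Real.exp_pos _).le (Real.one_le_exp hy)
  refine le_trans ?_ (ENNReal.le_tsum n)
  refine hmain.trans ?_
  rcases le_or_gt s (√X) with h | h
  · refine le_trans (hexp _ ?_) le_self_add
    rw [abs_of_nonneg (by linarith)] at hn1
    rcases Nat.eq_zero_or_pos n with h0 | h0
    · have h1 : s + 1 ≠ 0 := by positivity
      rw [h0]
      simp [h1]
    · have h1 : (1 : ℝ) ≤ n := by exact_mod_cast h0
      have hX : 0 < X := Real.sqrt_pos.1 (by linarith)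
      refine mul_nonneg ?_ ?_
      · rw [sub_nonneg, div_le_one (by positivity)]; linarith
      · rw [sub_nonneg, ← Real.sq_sqrt hX.le]
        gcongr
        linarith
  · rw [abs_of_neg (by linarith)] at hn1
    have hns : (n : ℝ) ≤ s := by linarith
    rw [if_pos hns]
    refine le_trans (hexp _ ?_) le_add_self
    refine mul_nonneg_of_nonpos_of_nonpos ?_ ?_
    · rw [sub_nonpos, one_le_div (by linarith)]; linarith
    · have h1 : X ≤ √X ^ 2 := by
        rcases le_total 0 X with hX | hX
        · rw [Real.sq_sqrt hX]
        · exact hX.trans (sq_nonneg _)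
      have h2 : √X ^ 2 ≤ (s - n) ^ 2 := by gcongr; linarith
      linarith

/-- Gaussian moments of the kernel, bounded uniformly in the starting point and in time. -/
lemma exists_lintegral_exp_sq_le {δ : ℝ} (hδ : 0 ≤ δ) :
    ∃ C : ℝ, 0 < C ∧ ∀ τ x : ℝ, 0 < τ → 0 ≤ x →
      ∫⁻ x', ENNReal.ofReal (Real.exp (9 / 10 * ((√x - √x') ^ 2 / τ)))
        ∂poiGamma δ τ (x / τ) (fun _ => 1) ≤ ENNReal.ofReal C := by
  set a : ℕ → ℝ := fun n => Real.exp (9 / 10 * ((n : ℝ) + 1) ^ 2) *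
      ((1 + (n : ℝ)) ^ δ * Real.exp (-(n : ℝ) ^ 2 + n)) with ha
  have ha0 : ∀ n, 0 ≤ a n := fun n => by positivity
  have hsum : Summable a := summable_gaussian_tail δ hδ
  refine ⟨∑' n, (a n + a n) + 1, ?_, fun τ x hτ hx => ?_⟩
  · have : 0 ≤ ∑' n, (a n + a n) := tsum_nonneg fun n => add_nonneg (ha0 n) (ha0 n)
    linarith
  set s := √(x / τ) with hs
  have hs0 : 0 ≤ s := Real.sqrt_nonneg _
  have hz : x / τ = s ^ 2 := (Real.sq_sqrt (by positivity)).symm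
  simp only [sqrt_sub_sq_div hτ]
  rw [← hs, hz]
  calc _ ≤ ∫⁻ x', ∑' n : ℕ, (ENNReal.ofReal (Real.exp (9 / 10 * ((n : ℝ) + 1) ^ 2)) *
        ENNReal.ofReal (Real.exp ((1 - (s + 1) / (s + n + 1)) * (x' / τ - (s + n) ^ 2))) +
        if (n : ℝ) ≤ s then ENNReal.ofReal (Real.exp (9 / 10 * ((n : ℝ) + 1) ^ 2)) *
        ENNReal.ofReal (Real.exp ((1 - (s + 1) / (s - n + 1)) * (x' / τ - (s - n) ^ 2))) else 0)
        ∂poiGamma δ τ (s ^ 2) (fun _ => 1) :=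
        lintegral_mono fun x' => exp_sq_le_tsum s (x' / τ) hs0
    _ ≤ ∑' n : ℕ, ENNReal.ofReal (a n + a n) := by
        rw [lintegral_tsum]
        · refine ENNReal.tsum_le_tsum fun n => ?_
          rw [lintegral_add_left (by fun_prop), ENNReal.ofReal_add (ha0 n) (ha0 n)]
          have hn0 : (0 : ℝ) ≤ n := Nat.cast_nonneg n
          refine add_le_add ?_ ?_
          · rw [lintegral_const_mul _ (by fun_prop), ha, ENNReal.ofReal_mul (Real.exp_pos _).le]
            have h := lintegral_tilt_le (ξ := s + n) hδ hτ hs0 (by positivity)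
            rw [add_sub_cancel_left, abs_of_nonneg hn0] at h
            gcongr
          · split_ifs with hns
            · rw [lintegral_const_mul _ (by fun_prop), ha, ENNReal.ofReal_mul (Real.exp_pos _).le]
              have h := lintegral_tilt_le (ξ := s - n) hδ hτ hs0 (by linarith)
              rw [sub_sub_cancel_left, abs_neg, abs_of_nonneg hn0, neg_sq] at h
              gcongr
            · simp
        · intro n
          split_ifs <;> fun_prop
    _ = ENNReal.ofReal (∑' n, (a n + a n)) := by
        rw [ENNReal.ofReal_tsum_of_nonneg (fun n => add_nonneg (ha0 n) (ha0 n)) (hsum.add hsum)]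
    _ ≤ _ := ENNReal.ofReal_le_ofReal (by linarith)

/-- The Gamma density in terms of the Gamma density with the rate multiplied by `ϱ`, which in the
application is the ratio `(s + 1) / (ξ + 1)` with `s = √(x/τ)` and `ξ = √(x'/τ)`. -/
lemma gammaDensity_tilt {k τ x ϱ : ℝ} (hτ : 0 < τ) (hx : 0 < x) (hϱ : 0 < ϱ) :
    gammaDensity k τ x = ϱ ^ (1 - k) * Real.exp (-((1 - ϱ) * (x / τ))) *
      ((ϱ * (x / τ)) ^ (k - 1) * Real.exp (-(ϱ * (x / τ))) / Real.Gamma k) / τ := by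
  have hX : 0 < x / τ := by positivity
  rw [gammaDensity_eq hτ hx, Real.mul_rpow hϱ.le hX.le,
    show -(x / τ) = -((1 - ϱ) * (x / τ)) + -(ϱ * (x / τ)) by ring, Real.exp_add,
    show 1 - k = -(k - 1) by ring, Real.rpow_neg hϱ.le]
  have := Real.rpow_pos_of_pos hϱ (k - 1)
  field_simp

lemma gammaDensity_le {δ c C : ℝ}
    (hC : ∀ (m : ℕ) (Y : ℝ), c ≤ Y →
      Y ^ ((m : ℝ) + δ - 1) * Real.exp (-Y) / Real.Gamma (m + δ) ≤ C / √Y)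
    {τ x : ℝ} (hτ : 0 < τ) (hx : 0 < x) (hcx : c ≤ x / τ) (m : ℕ) :
    gammaDensity (m + δ) τ x ≤ C / √(x * τ) := by
  rw [gammaDensity_eq hτ hx]
  refine (div_le_div_of_nonneg_right (hC m _ hcx) hτ.le).trans (le_of_eq ?_)
  rw [div_div]
  congr 1
  rw [Real.sqrt_div' _ hτ.le, Real.sqrt_mul' _ hτ.le]
  have : √τ ≠ 0 := (Real.sqrt_pos.2 hτ).ne'
  field_simp
  rw [Real.sq_sqrt hτ.le]

/-- The pointwise Gaussian bound for the density of the kernel away from the boundary. -/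
lemma exists_density_le {δ c : ℝ} (hδ : 0 ≤ δ) (hc : 0 < c) :
    ∃ C : ℝ, 0 < C ∧ ∀ τ x x' : ℝ, 0 < τ → 0 ≤ x → 0 < x' → c ≤ x' / τ →
      Summable (fun m : ℕ => poi (x / τ) m * gammaDensity (m + δ) τ x') ∧
      Real.exp (9 / 10 * ((√x - √x') ^ 2 / τ)) *
        ∑' m : ℕ, poi (x / τ) m * gammaDensity (m + δ) τ x' ≤ C / √(x' * τ) := by
  set c' := √c ^ 2 / (√c + 1) with hc'
  have hsc : 0 < √c := Real.sqrt_pos.2 hc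
  have hc'0 : 0 < c' := by positivity
  obtain ⟨C, hC0, hC⟩ := exists_gamma_bound hδ hc'0
  set p := |1 / 2 - δ| with hp
  have hp0 : 0 ≤ p := abs_nonneg _
  refine ⟨C * Real.exp (10 * (p + 1) ^ 2), by positivity, fun τ x x' hτ hx hx' hcx => ?_⟩
  set s := √(x / τ) with hs
  set ξ := √(x' / τ) with hξ
  have hX0 : 0 < x' / τ := by positivity
  have hs0 : 0 ≤ s := Real.sqrt_nonneg _
  have hξ0 : 0 < ξ := Real.sqrt_pos.2 hX0
  have hz : x / τ = s ^ 2 := (Real.sq_sqrt (by positivity)).symm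
  have hX : x' / τ = ξ ^ 2 := (Real.sq_sqrt (by positivity)).symm
  set ϱ := (s + 1) / (ξ + 1) with hϱ
  have hϱ0 : 0 < ϱ := by positivity
  have hcξ : √c ≤ ξ := Real.sqrt_le_sqrt hcx
  have hY : c' ≤ ϱ * (x' / τ) := by
    rw [hX, hc', hϱ, div_mul_eq_mul_div, div_le_div_iff₀ (by positivity) (by positivity)]
    have h1 : √c ^ 2 * (ξ + 1) ≤ ξ ^ 2 * (√c + 1) := by nlinarith [mul_pos hsc hξ0]
    nlinarith [mul_nonneg hs0 (mul_nonneg (sq_nonneg ξ) (by positivity : 0 ≤ √c + 1))]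
  have hz0 : 0 ≤ x / τ := by positivity
  -- each term is dominated by a term of an exponential series
  have hterm : ∀ m : ℕ, poi (x / τ) m * gammaDensity (m + δ) τ x' ≤
      (ϱ ^ (1 - δ) * Real.exp (-((1 - ϱ) * (x' / τ))) * (C / √(ϱ * (x' / τ))) / τ *
        Real.exp (-(x / τ))) * ((x / τ / ϱ) ^ m / (m.factorial : ℝ)) := by
    intro m
    rw [gammaDensity_tilt hτ hx' hϱ0]
    have h1 : ϱ ^ (1 - ((m : ℝ) + δ)) = ϱ ^ (1 - δ) / ϱ ^ m := by
      rw [← Real.rpow_natCast, ← Real.rpow_sub hϱ0]; congr 1; ring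
    rw [h1]
    have h2 := hC m _ hY
    have h3 := poi_nonneg hz0 m
    calc _ ≤ poi (x / τ) m * (ϱ ^ (1 - δ) / ϱ ^ m * Real.exp (-((1 - ϱ) * (x' / τ))) *
          (C / √(ϱ * (x' / τ))) / τ) := by gcongr
      _ = _ := by
        unfold poi
        rw [div_pow (x / τ) ϱ]
        field_simp
  have hS := (NormedSpace.expSeries_div_hasSum_exp (𝔸 := ℝ) (x / τ / ϱ)).mul_left
    (ϱ ^ (1 - δ) * Real.exp (-((1 - ϱ) * (x' / τ))) * (C / √(ϱ * (x' / τ))) / τ *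
        Real.exp (-(x / τ)))
  have hsum : Summable (fun m : ℕ => poi (x / τ) m * gammaDensity (m + δ) τ x') :=
    Summable.of_nonneg_of_le (fun m => mul_nonneg (poi_nonneg hz0 m)
      (gammaDensity_nonneg (by positivity) hτ hx')) hterm hS.summable
  refine ⟨hsum, ?_⟩
  have hle := hsum.tsum_le_tsum hterm hS.summable
  rw [hS.tsum_eq, ← Real.exp_eq_exp_ℝ] at hle
  have hexp : Real.exp (-((1 - ϱ) * (x' / τ))) * Real.exp (-(x / τ)) * Real.exp (x / τ / ϱ) ≤
      Real.exp (-(ξ - s) ^ 2 + |ξ - s|) := by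
    rw [← Real.exp_add, ← Real.exp_add]
    refine Real.exp_le_exp.2 (le_trans (le_of_eq ?_) (tilt_exponent hs0 hξ0.le))
    rw [← hϱ, hz, hX]
    field_simp
    ring
  have hrp : ϱ ^ (1 - δ) / √ϱ ≤ Real.exp (p * |ξ - s|) := by
    have h1 : ϱ ^ (1 - δ) / √ϱ = ϱ ^ (1 / 2 - δ) := by
      rw [Real.sqrt_eq_rpow, ← Real.rpow_sub hϱ0]; congr 1; ring
    rw [h1]
    refine (rpow_tilt_le hs0 hξ0.le).trans ?_
    rw [← hp, mul_comm, Real.exp_mul]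
    exact Real.rpow_le_rpow (by positivity) (by linarith [Real.add_one_le_exp |ξ - s|]) hp0
  have hsq : √(ϱ * (x' / τ)) = √ϱ * ξ := by rw [Real.sqrt_mul hϱ0.le]
  have hden : ξ * τ = √(x' * τ) := by
    rw [hξ, Real.sqrt_div' _ hτ.le, Real.sqrt_mul' _ hτ.le]
    have : √τ ≠ 0 := (Real.sqrt_pos.2 hτ).ne'
    field_simp
    rw [Real.sq_sqrt hτ.le]
  rw [sqrt_sub_sq_div hτ, ← hs, ← hξ, ← hden]
  have hsϱ : 0 < √ϱ := Real.sqrt_pos.2 hϱ0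
  calc _ ≤ Real.exp (9 / 10 * (ξ - s) ^ 2) * (ϱ ^ (1 - δ) * Real.exp (-((1 - ϱ) * (x' / τ))) *
          (C / √(ϱ * (x' / τ))) / τ * Real.exp (-(x / τ)) * Real.exp (x / τ / ϱ)) := by gcongr
    _ = Real.exp (9 / 10 * (ξ - s) ^ 2) * (ϱ ^ (1 - δ) / √ϱ) *
        (Real.exp (-((1 - ϱ) * (x' / τ))) * Real.exp (-(x / τ)) * Real.exp (x / τ / ϱ)) *
        (C / (ξ * τ)) := by
        rw [hsq]; field_simp
    _ ≤ Real.exp (9 / 10 * (ξ - s) ^ 2) * Real.exp (p * |ξ - s|) *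
        Real.exp (-(ξ - s) ^ 2 + |ξ - s|) * (C / (ξ * τ)) := by gcongr
    _ ≤ Real.exp (10 * (p + 1) ^ 2) * (C / (ξ * τ)) := by
        gcongr
        rw [← Real.exp_add, ← Real.exp_add]
        refine Real.exp_le_exp.2 ?_
        rw [← sq_abs (ξ - s)]
        nlinarith [sq_nonneg (|ξ - s| - 10 * (p + 1)), sq_nonneg (|ξ - s| - 5 * (p + 1)),
          abs_nonneg (ξ - s)]
    _ = _ := by ring

/-! ### Functionals with Gaussian bounds -/

/-- Gaussian bounds, with constant `C`, at time `τ` and starting point `x`, for a measure `μ` on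
`ℝ₊`: a Gaussian moment is finite, and to the right of `c` there is a density that is bounded by
`(x' τ)^{-1/2}` times a Gaussian. -/
structure GaussBound (C c τ x : ℝ) (μ : Measure ℝ) : Prop where
  exp_le : ∫⁻ x', ENNReal.ofReal (Real.exp (9 / 20 * ((√x - √x') ^ 2 / τ))) ∂μ ≤ ENNReal.ofReal C
  density_le : ∀ v : ℝ → ENNReal, Measurable v →
    ∫⁻ x' in Ioi c, ENNReal.ofReal (Real.exp (9 / 20 * ((√x - √x') ^ 2 / τ))) * v x' ∂μ ≤
      ENNReal.ofReal C * ∫⁻ x' in Ioi c, ENNReal.ofReal (1 / √(x' * τ)) * v x'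

/-- The weighted mixtures obey Gaussian bounds as soon as the weight is square integrable for the
Poisson law, because `b e^{9r/20} ≤ b² + e^{9r/10}`. -/
lemma exists_gaussBound {δ c T B : ℝ} (hδ : 0 ≤ δ) (hc : 0 < c) (hT : 0 < T) (hB : 0 ≤ B) :
    ∃ C : ℝ, 0 < C ∧ ∀ (τ x : ℝ) (b : ℕ → ℝ), 0 < τ → τ ≤ T → 0 ≤ x → (∀ m, 0 ≤ b m) →
      GeomBdd b → poiAvg (x / τ) (fun m => b m * b m) ≤ B →
      GaussBound C c τ x (poiGamma δ τ (x / τ) b) := by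
  obtain ⟨C₁, hC₁0, hC₁⟩ := exists_lintegral_exp_sq_le hδ
  obtain ⟨C₂, hC₂0, hC₂⟩ := exists_density_le (c := c / T) hδ (by positivity)
  obtain ⟨C₃, hC₃0, hC₃⟩ := exists_gamma_bound (c := c / T) hδ (by positivity)
  refine ⟨B + C₁ + (B * C₃ + C₂), by positivity, fun τ x b hτ hτT hx hb hbg hbB => ?_⟩
  have hz : 0 ≤ x / τ := by positivity
  set E : ℝ → ℝ := fun x' => Real.exp (9 / 20 * ((√x - √x') ^ 2 / τ)) with hE
  set E2 : ℝ → ℝ := fun x' => Real.exp (9 / 10 * ((√x - √x') ^ 2 / τ)) with hE2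
  have hEm : Measurable fun x' => ENNReal.ofReal (E x') := by fun_prop
  have hE2m : Measurable fun x' => ENNReal.ofReal (E2 x') := by fun_prop
  have hEE : ∀ x', E x' * E x' = E2 x' := fun x' => by
    simp only [hE, hE2]
    rw [← Real.exp_add]; congr 1; ring
  have hpt : ∀ (m : ℕ) (x' : ℝ), ENNReal.ofReal (poi (x / τ) m * b m) * ENNReal.ofReal (E x') ≤
      ENNReal.ofReal (poi (x / τ) m * (b m * b m)) +
        ENNReal.ofReal (poi (x / τ) m * 1) * ENNReal.ofReal (E2 x') := by
    intro m x'
    have hp := poi_nonneg hz m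
    have hE20 : 0 ≤ E2 x' := (Real.exp_pos _).le
    rw [← ENNReal.ofReal_mul (mul_nonneg hp (hb m)), ← ENNReal.ofReal_mul (by simpa using hp),
      ← ENNReal.ofReal_add (mul_nonneg hp (mul_nonneg (hb m) (hb m)))
        (mul_nonneg (by simpa using hp) hE20)]
    refine ENNReal.ofReal_le_ofReal ?_
    rw [← hEE, mul_assoc, mul_assoc, ← mul_add]
    gcongr
    nlinarith [sq_nonneg (b m - E x'), mul_nonneg (hb m) (Real.exp_pos (9 / 20 * ((√x - √x') ^ 2 / τ))).le]
  have hsumB : ∑' m : ℕ, ENNReal.ofReal (poi (x / τ) m * (b m * b m)) ≤ ENNReal.ofReal B := by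
    rw [← ENNReal.ofReal_tsum_of_nonneg
      (fun m => mul_nonneg (poi_nonneg hz m) (mul_nonneg (hb m) (hb m)))
      ((hbg.mul hbg).summable _)]
    exact ENNReal.ofReal_le_ofReal hbB
  have hP : ∀ m : ℕ, IsProbabilityMeasure (gammaLaw (m + δ) τ) := fun m =>
    isProbabilityMeasure_gammaLaw (by positivity) hτ
  constructor
  · refine le_trans ?_ (ENNReal.ofReal_le_ofReal (p := B + C₁) (by nlinarith [mul_nonneg hB hC₃0.le]))
    rw [ENNReal.ofReal_add hB hC₁0.le]
    refine le_trans ?_ (add_le_add hsumB (hC₁ τ x hτ hx))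
    rw [lintegral_poiGamma, lintegral_poiGamma, ← ENNReal.tsum_add]
    refine ENNReal.tsum_le_tsum fun m => ?_
    rw [← lintegral_const_mul _ hEm, ← lintegral_const_mul _ hE2m]
    refine (lintegral_mono (hpt m)).trans ?_
    rw [lintegral_add_left measurable_const]
    simp
  · intro v hv
    have hEv : Measurable fun x' => ENNReal.ofReal (E x') * v x' := hEm.mul hv
    have hE2v : Measurable fun x' => ENNReal.ofReal (E2 x') * v x' := hE2m.mul hv
    refine le_trans ?_ (mul_le_mul_left (ENNReal.ofReal_le_ofReal (p := B * C₃ + C₂)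
      (by linarith)) _)
    rw [ENNReal.ofReal_add (by positivity) hC₂0.le, add_mul, ENNReal.ofReal_mul hB]
    have hdens : ∫⁻ x' in Ioi c, ENNReal.ofReal (E2 x') * v x'
        ∂poiGamma δ τ (x / τ) (fun _ => 1) ≤
        ENNReal.ofReal C₂ * ∫⁻ x' in Ioi c, ENNReal.ofReal (1 / √(x' * τ)) * v x' := by
      rw [setLIntegral_poiGamma _ _ _ _ _ measurableSet_Ioi]
      have e : ∀ m : ℕ, ENNReal.ofReal (poi (x / τ) m * 1) *
          ∫⁻ x' in Ioi c, ENNReal.ofReal (E2 x') * v x' ∂gammaLaw (m + δ) τ =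
          ∫⁻ x' in Ioi c, ENNReal.ofReal (poi (x / τ) m * gammaDensity (m + δ) τ x') *
            (ENNReal.ofReal (E2 x') * v x') := by
        intro m
        rw [setLIntegral_gammaLaw hc hE2v, ← lintegral_const_mul' _ _ ENNReal.ofReal_ne_top]
        refine lintegral_congr fun x' => ?_
        rw [mul_one, ENNReal.ofReal_mul (poi_nonneg hz m), mul_assoc]
      have hm : ∀ m : ℕ, AEMeasurable (fun x' => ENNReal.ofReal (poi (x / τ) m *
          gammaDensity (m + δ) τ x') * (ENNReal.ofReal (E2 x') * v x'))
          (volume.restrict (Ioi c)) := fun m => (Measurable.mul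
        ((measurable_gammaDensity' _ τ).const_mul _).ennreal_ofReal hE2v).aemeasurable
      rw [tsum_congr e, ← lintegral_tsum hm, ← lintegral_const_mul' _ _ ENNReal.ofReal_ne_top]
      refine setLIntegral_mono' measurableSet_Ioi fun x' hx' => ?_
      have hx'c : c < x' := hx'
      have hx'0 : 0 < x' := hc.trans hx'c
      have hcx' : c / T ≤ x' / τ := by gcongr
      obtain ⟨hs, hle⟩ := hC₂ τ x x' hτ hx hx'0 hcx'
      rw [ENNReal.tsum_mul_right, ← ENNReal.ofReal_tsum_of_nonneg (fun m => mul_nonneg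
        (poi_nonneg hz m) (gammaDensity_nonneg (by positivity) hτ hx'0)) hs, ← mul_assoc,
        ← mul_assoc, ← ENNReal.ofReal_mul' (Real.exp_pos _).le, ← ENNReal.ofReal_mul hC₂0.le]
      refine mul_le_mul_left (ENNReal.ofReal_le_ofReal ?_) _
      rw [mul_comm, mul_one_div]
      exact hle
    have hfirst : ∀ m : ℕ, ∫⁻ x' in Ioi c, v x' ∂gammaLaw (m + δ) τ ≤
        ENNReal.ofReal C₃ * ∫⁻ x' in Ioi c, ENNReal.ofReal (1 / √(x' * τ)) * v x' := by
      intro m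
      rw [setLIntegral_gammaLaw hc hv, ← lintegral_const_mul _ (by fun_prop)]
      refine setLIntegral_mono' measurableSet_Ioi fun x' hx' => ?_
      have hx'c : c < x' := hx'
      have hx'0 : 0 < x' := hc.trans hx'c
      have hcx' : c / T ≤ x' / τ := by gcongr
      rw [← mul_assoc, ← ENNReal.ofReal_mul hC₃0.le]
      gcongr
      rw [mul_one_div]
      exact gammaDensity_le hC₃ hτ hx'0 hcx' m
    refine le_trans ?_ (add_le_add (mul_le_mul_left (mul_le_mul_left hsumB _) _) hdens)
    rw [setLIntegral_poiGamma _ _ _ _ _ measurableSet_Ioi,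
      setLIntegral_poiGamma _ _ _ _ _ measurableSet_Ioi, mul_assoc, ← ENNReal.tsum_mul_right,
      ← ENNReal.tsum_add]
    refine ENNReal.tsum_le_tsum fun m => ?_
    refine le_trans ?_ (add_le_add_left (mul_le_mul_right (hfirst m) _) _)
    rw [← lintegral_const_mul' _ _ ENNReal.ofReal_ne_top,
      ← lintegral_const_mul' _ _ ENNReal.ofReal_ne_top,
      ← lintegral_const_mul' _ _ ENNReal.ofReal_ne_top, ← lintegral_add_left (hv.const_mul _)]
    refine lintegral_mono fun x' => ?_
    beta_reduce
    calc _ = ENNReal.ofReal (poi (x / τ) m * b m) * ENNReal.ofReal (E x') * v x' :=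
          (mul_assoc _ _ _).symm
      _ ≤ _ := mul_le_mul_left (hpt m x') _
      _ = _ := by rw [add_mul, mul_assoc (ENNReal.ofReal (poi (x / τ) m * 1))]

lemma GaussBound.mono {C C' c τ x : ℝ} {μ : Measure ℝ} (h : GaussBound C c τ x μ) (hC : C ≤ C') :
    GaussBound C' c τ x μ :=
  ⟨h.exp_le.trans (ENNReal.ofReal_le_ofReal hC), fun v hv => (h.density_le v hv).trans
    (mul_le_mul_left (ENNReal.ofReal_le_ofReal hC) _)⟩

lemma GaussBound.add {C C' c τ x : ℝ} {μ ν : Measure ℝ} (h : GaussBound C c τ x μ)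
    (h' : GaussBound C' c τ x ν) (hC : 0 ≤ C) (hC' : 0 ≤ C') :
    GaussBound (C + C') c τ x (μ + ν) := by
  constructor
  · rw [lintegral_add_measure, ENNReal.ofReal_add hC hC']
    exact add_le_add h.exp_le h'.exp_le
  · intro v hv
    rw [Measure.restrict_add, lintegral_add_measure, ENNReal.ofReal_add hC hC', add_mul]
    exact add_le_add (h.density_le v hv) (h'.density_le v hv)

lemma GaussBound.lintegral_le {C c τ x : ℝ} {μ : Measure ℝ} (h : GaussBound C c τ x μ) {A : ℝ}
    (hA : 0 ≤ A) {f : ℝ → ℝ} (hf : ∀ x', |f x'| ≤ A * Real.exp (9 / 20 * ((√x - √x') ^ 2 / τ))) :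
    ∫⁻ x', ENNReal.ofReal |f x'| ∂μ ≤ ENNReal.ofReal (A * C) := by
  rw [ENNReal.ofReal_mul hA]
  refine le_trans ?_ (mul_le_mul_right h.exp_le _)
  rw [← lintegral_const_mul _ (by fun_prop)]
  refine lintegral_mono fun x' => ?_
  beta_reduce
  rw [← ENNReal.ofReal_mul hA]
  exact ENNReal.ofReal_le_ofReal (hf x')

lemma GaussBound.isFiniteMeasure {C c τ x : ℝ} {μ : Measure ℝ} (h : GaussBound C c τ x μ)
    (hτ : 0 < τ) : IsFiniteMeasure μ := by
  have h1 := h.lintegral_le (A := 1) zero_le_one (f := fun _ => 1) (fun x' => by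
    rw [abs_one, one_mul]
    exact Real.one_le_exp (by positivity))
  simp only [abs_one, ENNReal.ofReal_one, lintegral_one] at h1
  exact ⟨h1.trans_lt ENNReal.ofReal_lt_top⟩

/-- The Gaussian `exp (-θ (√x - w)² / (2 s))` in the variable `√x`. -/
def gauss (θ w s x : ℝ) : ℝ := Real.exp (-(θ * ((√x - w) ^ 2 / (2 * s))))

lemma gauss_pos (θ w s x : ℝ) : 0 < gauss θ w s x := Real.exp_pos _

lemma gauss_le_one {θ w s x : ℝ} (hθ : 0 ≤ θ) (hs : 0 ≤ s) : gauss θ w s x ≤ 1 := by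
  unfold gauss
  rw [Real.exp_le_one_iff, neg_nonpos]
  positivity

lemma gauss_mono_time {θ w s t x : ℝ} (hθ : 0 ≤ θ) (hs : 0 < s) (hst : s ≤ t) :
    gauss θ w s x ≤ gauss θ w t x := by
  unfold gauss
  gcongr

lemma gauss_anti {θ θ' w s x : ℝ} (hθ : θ ≤ θ') (hs : 0 < s) :
    gauss θ' w s x ≤ gauss θ w s x := by
  unfold gauss
  gcongr

@[fun_prop]
lemma measurable_gauss (θ w s : ℝ) : Measurable (gauss θ w s) := by
  unfold gauss; fun_prop

/-- Gaussians at the times `τ` and `s` combine into one at the time `τ + s`. -/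
lemma gauss_conv {θ w s τ x x' : ℝ} (hθ : 0 ≤ θ) (hs : 0 < s) (hτ : 0 < τ) :
    gauss θ w s x' ≤ gauss θ w (τ + s) x * Real.exp (θ / 2 * ((√x - √x') ^ 2 / τ)) := by
  unfold gauss
  rw [← Real.exp_add]
  refine Real.exp_le_exp.2 ?_
  have h : (√x - w) ^ 2 / (τ + s) ≤ (√x - √x') ^ 2 / τ + (√x' - w) ^ 2 / s := by
    rw [div_add_div _ _ hτ.ne' hs.ne', div_le_div_iff₀ (by positivity) (by positivity)]
    nlinarith [sq_nonneg (s * (√x - √x') - τ * (√x' - w))]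
  have e1 : (√x - w) ^ 2 / (2 * (τ + s)) = (√x - w) ^ 2 / (τ + s) / 2 := by
    rw [div_div, mul_comm]
  have e2 : (√x' - w) ^ 2 / (2 * s) = (√x' - w) ^ 2 / s / 2 := by
    rw [div_div, mul_comm]
  rw [e1, e2]
  nlinarith [mul_le_mul_of_nonneg_left h hθ]

lemma gauss_le_exp {w s τ x x' : ℝ} (hs : 0 < s) (hτ : 0 < τ) :
    gauss 1 w s x' ≤ gauss (4 / 5) w (τ + s) x * Real.exp (2 / 5 * ((√x - √x') ^ 2 / τ)) := by
  refine (gauss_anti (by norm_num : (4 / 5 : ℝ) ≤ 1) hs).trans ?_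
  have h := gauss_conv (θ := 4 / 5) (w := w) (x := x) (x' := x') (by norm_num) hs hτ
  norm_num at h ⊢
  exact h

lemma GaussBound.lintegral_gauss_le {C c τ x : ℝ} {μ : Measure ℝ} (h : GaussBound C c τ x μ)
    (hτ : 0 < τ) {A w s : ℝ} (hA : 0 ≤ A) (hs : 0 < s) {f : ℝ → ℝ}
    (hf : ∀ x', |f x'| ≤ A * gauss 1 w s x') :
    ∫⁻ x', ENNReal.ofReal |f x'| ∂μ ≤ ENNReal.ofReal (A * gauss (4 / 5) w (τ + s) x * C) := by
  refine h.lintegral_le (mul_nonneg hA (gauss_pos _ _ _ _).le) fun x' => (hf x').trans ?_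
  rw [mul_assoc]
  refine mul_le_mul_of_nonneg_left ((gauss_le_exp (x := x) hs hτ).trans ?_) hA
  refine mul_le_mul_of_nonneg_left (Real.exp_le_exp.2 ?_) (gauss_pos _ _ _ _).le
  have : 0 ≤ (√x - √x') ^ 2 / τ := by positivity
  linarith

lemma GaussBound.lintegral_holder_le {C c τ x : ℝ} {μ : Measure ℝ} (h : GaussBound C c τ x μ)
    (hτ : 0 < τ) {A w s γ : ℝ} (hA : 0 ≤ A) (hs : 0 < s) (hγ0 : 0 < γ) (hγ1 : γ < 1) {f : ℝ → ℝ}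
    (hf : ∀ x', |f x'| ≤ A * |√x' - √x| ^ γ * (gauss 1 w s x' + gauss 1 w s x)) :
    ∫⁻ x', ENNReal.ofReal |f x'| ∂μ ≤
      ENNReal.ofReal (40 * A * τ ^ (γ / 2) * gauss (4 / 5) w (τ + s) x * C) := by
  refine h.lintegral_le (by have := gauss_pos (4 / 5) w (τ + s) x; positivity)
    fun x' => (hf x').trans ?_
  set y := (√x - √x') ^ 2 / τ with hy
  have hy0 : 0 ≤ y := by positivity
  have h1 : |√x' - √x| ^ γ ≤ τ ^ (γ / 2) * (20 * Real.exp (1 / 20 * y)) := by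
    have e : |√x' - √x| ^ γ = τ ^ (γ / 2) * y ^ (γ / 2) := by
      rw [← Real.mul_rpow hτ.le hy0, hy, mul_div_cancel₀ _ hτ.ne', abs_sub_comm, ← sq_abs,
        ← Real.rpow_natCast, ← Real.rpow_mul (abs_nonneg _)]
      congr 1; push_cast; ring
    rw [e]
    gcongr
    have h2 : y ^ (γ / 2) ≤ 1 + y := by
      rcases le_total y 1 with hy1 | hy1
      · linarith [Real.rpow_le_one hy0 hy1 (by linarith : 0 ≤ γ / 2)]
      · calc y ^ (γ / 2) ≤ y ^ (1 : ℝ) := Real.rpow_le_rpow_of_exponent_le hy1 (by linarith)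
          _ ≤ _ := by rw [Real.rpow_one]; linarith
    linarith [Real.add_one_le_exp (1 / 20 * y)]
  have h2 : gauss 1 w s x' + gauss 1 w s x ≤
      2 * (gauss (4 / 5) w (τ + s) x * Real.exp (2 / 5 * y)) := by
    have h3 : gauss 1 w s x' ≤ _ := gauss_le_exp (x := x) hs hτ
    have h4 : gauss 1 w s x ≤ gauss (4 / 5) w (τ + s) x :=
      (gauss_anti (by norm_num : (4 / 5 : ℝ) ≤ 1) hs).trans
        (gauss_mono_time (by norm_num) hs (by linarith))
    have h5 : gauss (4 / 5) w (τ + s) x ≤ gauss (4 / 5) w (τ + s) x * Real.exp (2 / 5 * y) :=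
      le_mul_of_one_le_right (gauss_pos _ _ _ _).le (Real.one_le_exp (by positivity))
    linarith
  have hg := gauss_pos (4 / 5) w (τ + s) x
  calc _ ≤ A * (τ ^ (γ / 2) * (20 * Real.exp (1 / 20 * y))) *
        (2 * (gauss (4 / 5) w (τ + s) x * Real.exp (2 / 5 * y))) := by
        have := gauss_pos 1 w s x
        have := gauss_pos 1 w s x'
        gcongr
    _ = 40 * A * τ ^ (γ / 2) * gauss (4 / 5) w (τ + s) x *
        (Real.exp (1 / 20 * y) * Real.exp (2 / 5 * y)) := by ring
    _ = _ := by rw [← Real.exp_add]; congr 2; ring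

lemma lintegral_sqrt_gauss_le {c τ w s : ℝ} (hc : 0 < c) (hτ : 0 < τ) (hs : 0 < s) :
    ∫⁻ x' in Ioi c, ENNReal.ofReal (1 / √(x' * τ)) * ENNReal.ofReal (gauss (1 / 5) w s x') ≤
      ENNReal.ofReal (2 * √(Real.pi * 10) * √(s / τ)) := by
  set g : ℝ → ENNReal := fun u =>
    ENNReal.ofReal (2 / √τ * Real.exp (-(1 / (10 * s)) * (u - w) ^ 2)) with hg
  have hsτ : 0 < √τ := Real.sqrt_pos.2 hτ
  have h1 : ∫⁻ x' in Ioi c, ENNReal.ofReal (1 / √(x' * τ)) * ENNReal.ofReal (gauss (1 / 5) w s x') ≤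
      ∫⁻ x' in Ioi (0 : ℝ), ENNReal.ofReal |1 / (2 * √x')| * g (√x') := by
    refine le_trans (setLIntegral_mono' measurableSet_Ioi fun x' hx' => ?_)
      (lintegral_mono_set (Ioi_subset_Ioi hc.le))
    have hx'0 : 0 < x' := hc.trans hx'
    have hsx : 0 < √x' := Real.sqrt_pos.2 hx'0
    rw [hg, abs_of_pos (by positivity), ← ENNReal.ofReal_mul (by positivity),
      ← ENNReal.ofReal_mul (by positivity)]
    refine ENNReal.ofReal_le_ofReal (le_of_eq ?_)
    unfold gauss
    rw [Real.sqrt_mul hx'0.le, show -(1 / 5 * ((√x' - w) ^ 2 / (2 * s))) =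
      -(1 / (10 * s)) * (√x' - w) ^ 2 by field_simp; ring]
    field_simp
  have h2 := lintegral_image_eq_lintegral_abs_deriv_mul (f := Real.sqrt)
    (f' := fun x => 1 / (2 * √x)) (s := Ioi (0 : ℝ)) measurableSet_Ioi
    (fun x hx => (Real.hasDerivAt_sqrt (ne_of_gt hx)).hasDerivWithinAt)
    (fun x hx y hy hxy => (Real.sqrt_inj (le_of_lt hx) (le_of_lt hy)).1 hxy) g
  refine h1.trans (h2.symm.le.trans ((setLIntegral_le_lintegral _ _).trans (le_of_eq ?_)))
  have hb : 0 < 1 / (10 * s) := by positivity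
  have h3 : ∫⁻ u, g u = ∫⁻ u, ENNReal.ofReal (2 / √τ * Real.exp (-(1 / (10 * s)) * u ^ 2)) :=
    lintegral_sub_right_eq_self
      (fun u => ENNReal.ofReal (2 / √τ * Real.exp (-(1 / (10 * s)) * u ^ 2))) w
  rw [h3, ← ofReal_integral_eq_lintegral_ofReal ((integrable_exp_neg_mul_sq hb).const_mul _)
    (Filter.Eventually.of_forall fun u => by simp only [Pi.zero_apply]; positivity),
    integral_const_mul, integral_gaussian]
  congr 1
  rw [show Real.pi / (1 / (10 * s)) = (Real.pi * 10) * s by field_simp,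
    Real.sqrt_mul (by positivity), Real.sqrt_div' _ hτ.le]
  ring

/-- At times `s` much smaller than `τ`, the Gaussian `gauss 1 w s`, being concentrated near `w > 0`
where the kernel has a density of size `τ^{-1/2}`, has a small average. -/
lemma exists_lintegral_gauss_le_sqrt {c w T : ℝ} (hc : 0 < c) (hw : √c < w) (hT : 0 < T) :
    ∃ K : ℝ, 0 < K ∧ ∀ (C τ x A s : ℝ) (μ : Measure ℝ) (f : ℝ → ℝ), 0 ≤ C → 0 < τ → τ ≤ T →
      0 < s → s ≤ T → 0 ≤ A → GaussBound C c τ x μ → (∀ x', |f x'| ≤ A * gauss 1 w s x') →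
      ∫⁻ x', ENNReal.ofReal |f x'| ∂μ ≤
        ENNReal.ofReal (A * gauss (4 / 5) w (τ + s) x * (C * K) * √(s / τ)) := by
  set β := w - √c with hβ
  have hβ0 : 0 < β := by rw [hβ]; linarith
  refine ⟨2 * √(Real.pi * 10) + 10 * T / β ^ 2, by positivity,
    fun C τ x A s μ f hC hτ hτT hs hsT hA hμ hf => ?_⟩
  set G := gauss (4 / 5) w (τ + s) x with hG
  have hG0 : 0 < G := gauss_pos _ _ _ _
  set E : ℝ → ℝ := fun x' => Real.exp (9 / 20 * ((√x - √x') ^ 2 / τ)) with hE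
  have hEm : Measurable E := by fun_prop
  have hE0 : ∀ x', 0 < E x' := fun x' => Real.exp_pos _
  have hpt : ∀ x', |f x'| ≤ A * G * (E x' * gauss (1 / 5) w s x') := by
    intro x'
    refine (hf x').trans ?_
    have h1 : gauss 1 w s x' = gauss (4 / 5) w s x' * gauss (1 / 5) w s x' := by
      unfold gauss
      rw [← Real.exp_add]; congr 1; ring
    have h2 : gauss (4 / 5) w s x' ≤ G * E x' := by
      refine (gauss_conv (x := x) (by norm_num) hs hτ).trans ?_
      refine mul_le_mul_of_nonneg_left (Real.exp_le_exp.2 ?_) hG0.le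
      have : 0 ≤ (√x - √x') ^ 2 / τ := by positivity
      linarith
    rw [h1, mul_assoc A G, ← mul_assoc G]
    have := gauss_pos (1 / 5) w s x'
    gcongr
  have hsplit := lintegral_add_compl (μ := μ) (fun x' => ENNReal.ofReal |f x'|)
    (measurableSet_Ioi (a := c))
  rw [← hsplit]
  have hp1 : ∫⁻ x' in Ioi c, ENNReal.ofReal |f x'| ∂μ ≤
      ENNReal.ofReal (A * G * (C * (2 * √(Real.pi * 10) * √(s / τ)))) := by
    calc _ ≤ ∫⁻ x' in Ioi c, ENNReal.ofReal (A * G) *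
          (ENNReal.ofReal (E x') * ENNReal.ofReal (gauss (1 / 5) w s x')) ∂μ := by
          refine lintegral_mono fun x' => ?_
          beta_reduce
          rw [← ENNReal.ofReal_mul (hE0 x').le, ← ENNReal.ofReal_mul (by positivity)]
          exact ENNReal.ofReal_le_ofReal (hpt x')
      _ = ENNReal.ofReal (A * G) * ∫⁻ x' in Ioi c,
          (ENNReal.ofReal (E x') * ENNReal.ofReal (gauss (1 / 5) w s x')) ∂μ :=
          lintegral_const_mul' _ _ ENNReal.ofReal_ne_top
      _ ≤ ENNReal.ofReal (A * G) * (ENNReal.ofReal C *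
          ENNReal.ofReal (2 * √(Real.pi * 10) * √(s / τ))) := by
          gcongr
          refine (hμ.density_le _ (by fun_prop)).trans ?_
          gcongr
          exact lintegral_sqrt_gauss_le hc hτ hs
      _ = _ := by rw [← ENNReal.ofReal_mul hC, ← ENNReal.ofReal_mul (by positivity)]
  have hsmall : ∀ x', x' ≤ c → gauss (1 / 5) w s x' ≤ 10 * T / β ^ 2 * √(s / τ) := by
    intro x' hx'
    have h1 : √x' ≤ √c := Real.sqrt_le_sqrt hx'
    have h2 : β ^ 2 ≤ (√x' - w) ^ 2 := by
      rw [← neg_sq (√x' - w)]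
      refine pow_le_pow_left₀ hβ0.le ?_ 2
      rw [hβ]; linarith
    have h3 : gauss (1 / 5) w s x' ≤ 10 * s / β ^ 2 := by
      unfold gauss
      have h4 : β ^ 2 / (10 * s) ≤ 1 / 5 * ((√x' - w) ^ 2 / (2 * s)) := by
        rw [show 1 / 5 * ((√x' - w) ^ 2 / (2 * s)) = (√x' - w) ^ 2 / (10 * s) by
          field_simp; ring]
        gcongr
      have h5 : Real.exp (-(β ^ 2 / (10 * s))) ≤ 10 * s / β ^ 2 := by
        rw [Real.exp_neg, show 10 * s / β ^ 2 = (β ^ 2 / (10 * s))⁻¹ from (inv_div _ _).symm]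
        refine inv_anti₀ (by positivity) ?_
        linarith [Real.add_one_le_exp (β ^ 2 / (10 * s))]
      exact (Real.exp_le_exp.2 (neg_le_neg h4)).trans h5
    have h6 : s ≤ T * √(s / τ) := by
      rw [Real.sqrt_div' _ hτ.le]
      have e1 : √s * √s = s := Real.mul_self_sqrt hs.le
      have e2 : √τ * √τ = τ := Real.mul_self_sqrt hτ.le
      have hsτ : 0 < √τ := Real.sqrt_pos.2 hτ
      have hss : 0 < √s := Real.sqrt_pos.2 hs
      rw [← mul_div_assoc, le_div_iff₀ hsτ]
      have e3 : √s * √τ ≤ T := by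
        rw [← Real.sqrt_mul hs.le]
        exact Real.sqrt_le_iff.2 ⟨hT.le, by nlinarith⟩
      nlinarith
    calc _ ≤ 10 * s / β ^ 2 := h3
      _ ≤ 10 * (T * √(s / τ)) / β ^ 2 := by gcongr
      _ = _ := by ring
  have hp2 : ∫⁻ x' in (Ioi c)ᶜ, ENNReal.ofReal |f x'| ∂μ ≤
      ENNReal.ofReal (A * G * (10 * T / β ^ 2 * √(s / τ)) * C) := by
    refine le_trans ?_ (hμ.lintegral_le (A := A * G * (10 * T / β ^ 2 * √(s / τ)))
      (by positivity) (f := fun x' => A * G * (10 * T / β ^ 2 * √(s / τ)) * E x') fun x' => ?_)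
    · refine le_trans (setLIntegral_mono' measurableSet_Ioi.compl fun x' hx' => ?_)
        (setLIntegral_le_lintegral _ _)
      have hx'c : x' ≤ c := not_lt.1 hx'
      have hE0' := hE0 x'
      refine ENNReal.ofReal_le_ofReal ((hpt x').trans (le_trans ?_ (le_abs_self _)))
      calc A * G * (E x' * gauss (1 / 5) w s x')
          ≤ A * G * (E x' * (10 * T / β ^ 2 * √(s / τ))) := by
            gcongr; exact hsmall x' hx'c
        _ = _ := by ring
    · rw [abs_of_nonneg (by have := hE0 x'; positivity)]
  refine (add_le_add hp1 hp2).trans ?_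
  rw [← ENNReal.ofReal_add (by positivity) (by positivity)]
  exact ENNReal.ofReal_le_ofReal (le_of_eq (by ring))

/-- Bounded measurable functions. -/
def BddMeas (f : ℝ → ℝ) : Prop := Measurable f ∧ ∃ M : ℝ, ∀ x, |f x| ≤ M

lemma BddMeas.integrable {f : ℝ → ℝ} (hf : BddMeas f) (μ : Measure ℝ) [IsFiniteMeasure μ] :
    Integrable f μ := by
  obtain ⟨hm, M, hM⟩ := hf
  exact Integrable.of_bound hm.aestronglyMeasurable M (Filter.Eventually.of_forall hM)

lemma BddMeas.sub {f g : ℝ → ℝ} (hf : BddMeas f) (hg : BddMeas g) :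
    BddMeas (fun x => f x - g x) := by
  obtain ⟨hm, M, hM⟩ := hf
  obtain ⟨hm', M', hM'⟩ := hg
  exact ⟨hm.sub hm', M + M', fun x => (abs_sub _ _).trans (add_le_add (hM x) (hM' x))⟩

lemma bddMeas_const (c : ℝ) : BddMeas (fun _ => c) := ⟨measurable_const, |c|, fun _ => le_rfl⟩

/-- The functional `Λ` on bounded measurable functions is integration against a difference of two
positive measures with Gaussian bounds. -/
def GaussFunctional (C c τ x : ℝ) (Λ : (ℝ → ℝ) → ℝ) : Prop :=
  ∃ μ ν : Measure ℝ, GaussBound C c τ x μ ∧ GaussBound C c τ x ν ∧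
    ∀ f, BddMeas f → Λ f = ∫ x', f x' ∂μ - ∫ x', f x' ∂ν

lemma GaussFunctional.mono {C C' c τ x : ℝ} {Λ : (ℝ → ℝ) → ℝ} (h : GaussFunctional C c τ x Λ)
    (hC : C ≤ C') : GaussFunctional C' c τ x Λ := by
  obtain ⟨μ, ν, hμ, hν, hΛ⟩ := h
  exact ⟨μ, ν, hμ.mono hC, hν.mono hC, hΛ⟩

lemma GaussFunctional.sub {C C' c τ x : ℝ} {Λ Λ' : (ℝ → ℝ) → ℝ} (h : GaussFunctional C c τ x Λ)
    (h' : GaussFunctional C' c τ x Λ') (hτ : 0 < τ) (hC : 0 ≤ C) (hC' : 0 ≤ C') :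
    GaussFunctional (C + C') c τ x (fun f => Λ f - Λ' f) := by
  obtain ⟨μ, ν, hμ, hν, hΛ⟩ := h
  obtain ⟨μ', ν', hμ', hν', hΛ'⟩ := h'
  refine ⟨μ + ν', ν + μ', hμ.add hν' hC hC', hν.add hμ' hC hC', fun f hf => ?_⟩
  have := hμ.isFiniteMeasure hτ
  have := hν.isFiniteMeasure hτ
  have := hμ'.isFiniteMeasure hτ
  have := hν'.isFiniteMeasure hτ
  beta_reduce
  rw [hΛ f hf, hΛ' f hf, integral_add_measure (hf.integrable _) (hf.integrable _),
    integral_add_measure (hf.integrable _) (hf.integrable _)]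
  ring

lemma GaussFunctional.add {C C' c τ x : ℝ} {Λ Λ' : (ℝ → ℝ) → ℝ} (h : GaussFunctional C c τ x Λ)
    (h' : GaussFunctional C' c τ x Λ') (hτ : 0 < τ) (hC : 0 ≤ C) (hC' : 0 ≤ C') :
    GaussFunctional (C + C') c τ x (fun f => Λ f + Λ' f) := by
  obtain ⟨μ', ν', hμ', hν', hΛ'⟩ := h'
  have h2 := h.sub (Λ' := fun f => -Λ' f) ⟨ν', μ', hν', hμ', fun f hf => by
    beta_reduce; rw [hΛ' f hf]; ring⟩
    hτ hC hC'
  simpa using h2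

lemma abs_integral_sub_le {μ ν : Measure ℝ} {f : ℝ → ℝ} {B : ℝ} (hB : 0 ≤ B)
    (hμ : ∫⁻ x', ENNReal.ofReal |f x'| ∂μ ≤ ENNReal.ofReal B)
    (hν : ∫⁻ x', ENNReal.ofReal |f x'| ∂ν ≤ ENNReal.ofReal B) :
    |∫ x', f x' ∂μ - ∫ x', f x' ∂ν| ≤ 2 * B := by
  have key : ∀ {ρ : Measure ℝ}, ∫⁻ x', ENNReal.ofReal |f x'| ∂ρ ≤ ENNReal.ofReal B →
      |∫ x', f x' ∂ρ| ≤ B := by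
    intro ρ hρ
    have h1 := norm_integral_le_lintegral_norm (μ := ρ) f
    refine h1.trans ?_
    have h2 := ENNReal.toReal_mono ENNReal.ofReal_ne_top hρ
    rw [ENNReal.toReal_ofReal hB] at h2
    exact h2
  have := abs_sub (∫ x', f x' ∂μ) (∫ x', f x' ∂ν)
  linarith [key hμ, key hν]

/-- Gaussian data at time `s` are spread to Gaussians at time `τ + s`, with exponent `4/5 < 9/10`
to spare. -/
lemma GaussFunctional.abs_le_gauss {C c τ x : ℝ} {Λ : (ℝ → ℝ) → ℝ}
    (h : GaussFunctional C c τ x Λ) (hC : 0 ≤ C) (hτ : 0 < τ) {A w s : ℝ} (hA : 0 ≤ A) (hs : 0 < s)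
    {f : ℝ → ℝ} (hfm : BddMeas f) (hf : ∀ x', |f x'| ≤ A * gauss 1 w s x') :
    |Λ f| ≤ 2 * C * A * gauss (4 / 5) w (τ + s) x := by
  obtain ⟨μ, ν, hμ, hν, hΛ⟩ := h
  have := gauss_pos (4 / 5) w (τ + s) x
  rw [hΛ f hfm]
  exact (abs_integral_sub_le (by positivity) (hμ.lintegral_gauss_le hτ hA hs hf)
    (hν.lintegral_gauss_le hτ hA hs hf)).trans (le_of_eq (by ring))

/-- The factor `√(s/τ)` comes from the concentration of the data near `w > 0`, away from the
boundary. -/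
lemma exists_abs_le_gauss_sqrt {c w T : ℝ} (hc : 0 < c) (hw : √c < w) (hT : 0 < T) :
    ∃ K : ℝ, 0 < K ∧ ∀ (C τ x A s : ℝ) (Λ : (ℝ → ℝ) → ℝ) (f : ℝ → ℝ), 0 ≤ C → 0 < τ → τ ≤ T →
      0 < s → s ≤ T → 0 ≤ A → GaussFunctional C c τ x Λ → BddMeas f →
      (∀ x', |f x'| ≤ A * gauss 1 w s x') →
      |Λ f| ≤ K * C * A * √(s / τ) * gauss (4 / 5) w (τ + s) x := by
  obtain ⟨K, hK0, hK⟩ := exists_lintegral_gauss_le_sqrt hc hw hT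
  refine ⟨2 * K, by positivity, fun C τ x A s Λ f hC hτ hτT hs hsT hA h hfm hf => ?_⟩
  obtain ⟨μ, ν, hμ, hν, hΛ⟩ := h
  have := gauss_pos (4 / 5) w (τ + s) x
  rw [hΛ f hfm]
  exact (abs_integral_sub_le (by positivity) (hK C τ x A s μ f hC hτ hτT hs hsT hA hμ hf)
    (hK C τ x A s ν f hC hτ hτT hs hsT hA hν hf)).trans (le_of_eq (by ring))

/-- A functional that annihilates constants gains `τ^{γ/2}` on Hölder continuous data. -/
lemma GaussFunctional.abs_le_holder {C c τ x : ℝ} {Λ : (ℝ → ℝ) → ℝ}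
    (h : GaussFunctional C c τ x Λ) (hΛ1 : ∀ c, Λ (fun _ => c) = 0) (hC : 0 ≤ C) (hτ : 0 < τ)
    {A w s γ : ℝ} (hA : 0 ≤ A) (hs : 0 < s) (hγ0 : 0 < γ) (hγ1 : γ < 1)
    {f : ℝ → ℝ} (hfm : BddMeas f)
    (hf : ∀ x', |f x' - f x| ≤ A * |√x' - √x| ^ γ * (gauss 1 w s x' + gauss 1 w s x)) :
    |Λ f| ≤ 80 * C * A * τ ^ (γ / 2) * gauss (4 / 5) w (τ + s) x := by
  obtain ⟨μ, ν, hμ, hν, hΛ⟩ := h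
  have := gauss_pos (4 / 5) w (τ + s) x
  have e : Λ f = ∫ x', (f x' - f x) ∂μ - ∫ x', (f x' - f x) ∂ν := by
    have := hμ.isFiniteMeasure hτ
    have := hν.isFiniteMeasure hτ
    have h0 := hΛ1 (f x)
    rw [hΛ _ (bddMeas_const _)] at h0
    rw [hΛ f hfm, integral_sub (hfm.integrable _) (integrable_const _),
      integral_sub (hfm.integrable _) (integrable_const _)]
    linarith
  rw [e]
  exact (abs_integral_sub_le (by positivity) (hμ.lintegral_holder_le hτ hA hs hγ0 hγ1 hf)
    (hν.lintegral_holder_le hτ hA hs hγ0 hγ1 hf)).trans (le_of_eq (by ring))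

/-! ### The kernel and its derivatives in the starting point -/

/-- The iterated differences in the parameter `δ` of the kernel averages `∫ f(x') p_τ^δ(x, dx')`.
Up to the factor `τ^{-k}` they are the `k`-th derivatives in `x`. -/
def kerDiff : ℕ → ℝ → ℝ → (ℝ → ℝ) → ℝ → ℝ
  | 0, δ, τ, f, x => ∫ x', f x' ∂kernel₁ δ τ x
  | k + 1, δ, τ, f, x => kerDiff k (δ + 1) τ f x - kerDiff k δ τ f x

/-- The averages of `f` against the Gamma laws of shapes `m + δ`. -/
def gammaAvg (δ τ : ℝ) (f : ℝ → ℝ) (m : ℕ) : ℝ := ∫ x', f x' ∂gammaLaw (m + δ) τ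

lemma gammaAvg_add_one (δ τ : ℝ) (f : ℝ → ℝ) (m : ℕ) :
    gammaAvg (δ + 1) τ f m = gammaAvg δ τ f (m + 1) := by
  unfold gammaAvg
  rw [show (m : ℝ) + (δ + 1) = ((m + 1 : ℕ) : ℝ) + δ by push_cast; ring]

lemma geomBdd_gammaAvg {δ τ : ℝ} (hδ : 0 ≤ δ) (hτ : 0 < τ) {f : ℝ → ℝ} (hf : BddMeas f) :
    GeomBdd (gammaAvg δ τ f) := by
  obtain ⟨hm, M, hM⟩ := hf
  refine GeomBdd.of_bdd (C := M) fun m => ?_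
  have := isProbabilityMeasure_gammaLaw (k := m + δ) (by positivity) hτ
  have h := norm_integral_le_of_norm_le_const (μ := gammaLaw (m + δ) τ) (f := f) (C := M)
    (Filter.Eventually.of_forall hM)
  simpa [gammaAvg] using h

lemma integral_poiGamma {δ τ z : ℝ} (hδ : 0 ≤ δ) (hτ : 0 < τ) (hz : 0 ≤ z) {b : ℕ → ℝ}
    (hb : ∀ m, 0 ≤ b m) (hbg : GeomBdd b) {f : ℝ → ℝ} (hf : BddMeas f) :
    ∫ x', f x' ∂poiGamma δ τ z b = poiAvg z (fun m => b m * gammaAvg δ τ f m) := by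
  have hfin : IsFiniteMeasure (poiGamma δ τ z b) := by
    constructor
    rw [← lintegral_one, lintegral_poiGamma]
    have : ∀ m : ℕ, ∫⁻ x, 1 ∂gammaLaw (m + δ) τ = 1 := fun m => by
      have := isProbabilityMeasure_gammaLaw (k := m + δ) (by positivity) hτ
      simp
    simp only [this, mul_one]
    rw [← ENNReal.ofReal_tsum_of_nonneg (fun m => mul_nonneg (poi_nonneg hz m) (hb m))
      (hbg.summable z)]
    exact ENNReal.ofReal_lt_top
  have hint := hf.integrable (poiGamma δ τ z b)
  unfold poiGamma at hint ⊢
  rw [integral_sum_measure hint]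
  unfold poiAvg gammaAvg
  refine tsum_congr fun m => ?_
  rw [integral_smul_measure, ENNReal.toReal_ofReal (mul_nonneg (poi_nonneg hz m) (hb m)),
    smul_eq_mul, mul_assoc]

lemma kerDiff_zero_eq {δ τ x : ℝ} (hδ : 0 ≤ δ) (hτ : 0 < τ) (hx : 0 ≤ x) {f : ℝ → ℝ}
    (hf : BddMeas f) : kerDiff 0 δ τ f x = poiAvg (x / τ) (gammaAvg δ τ f) := by
  rw [kerDiff, kernel₁_eq_poiGamma hδ hτ hx, integral_poiGamma hδ hτ (by positivity)
    (fun _ => zero_le_one) (geomBdd_const 1) hf]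
  simp

lemma kerDiff_one_eq {δ τ x : ℝ} (hδ : 0 ≤ δ) (hτ : 0 < τ) (hx : 0 ≤ x) {f : ℝ → ℝ}
    (hf : BddMeas f) : kerDiff 1 δ τ f x =
      poiAvg (x / τ) (fun m => gammaAvg δ τ f (m + 1)) - poiAvg (x / τ) (gammaAvg δ τ f) := by
  rw [kerDiff, kerDiff_zero_eq (by linarith) hτ hx hf, kerDiff_zero_eq hδ hτ hx hf,
    show gammaAvg (δ + 1) τ f = _ from funext (gammaAvg_add_one δ τ f)]

lemma kerDiff_two_eq {δ τ x : ℝ} (hδ : 0 ≤ δ) (hτ : 0 < τ) (hx : 0 ≤ x) {f : ℝ → ℝ}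
    (hf : BddMeas f) : kerDiff 2 δ τ f x =
      poiAvg (x / τ) (fun m => gammaAvg δ τ f (m + 2)) -
      2 * poiAvg (x / τ) (fun m => gammaAvg δ τ f (m + 1)) + poiAvg (x / τ) (gammaAvg δ τ f) := by
  rw [kerDiff, kerDiff_one_eq (by linarith) hτ hx hf, kerDiff_one_eq hδ hτ hx hf,
    show gammaAvg (δ + 1) τ f = _ from funext (gammaAvg_add_one δ τ f)]
  ring

lemma kerDiff_three_eq {δ τ x : ℝ} (hδ : 0 ≤ δ) (hτ : 0 < τ) (hx : 0 ≤ x) {f : ℝ → ℝ}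
    (hf : BddMeas f) : kerDiff 3 δ τ f x =
      poiAvg (x / τ) (fun m => gammaAvg δ τ f (m + 3)) -
      3 * poiAvg (x / τ) (fun m => gammaAvg δ τ f (m + 2)) +
      3 * poiAvg (x / τ) (fun m => gammaAvg δ τ f (m + 1)) - poiAvg (x / τ) (gammaAvg δ τ f) := by
  rw [kerDiff, kerDiff_two_eq (by linarith) hτ hx hf, kerDiff_two_eq hδ hτ hx hf,
    show gammaAvg (δ + 1) τ f = _ from funext (gammaAvg_add_one δ τ f)]
  ring

/-- The derivative in the starting point shifts the parameter `δ`. -/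
lemma hasDerivWithinAt_kerDiff (k : ℕ) {δ τ x : ℝ} (hδ : 0 ≤ δ) (hτ : 0 < τ) (hx : 0 ≤ x)
    {f : ℝ → ℝ} (hf : BddMeas f) :
    HasDerivWithinAt (kerDiff k δ τ f) (kerDiff (k + 1) δ τ f x / τ) (Ici 0) x := by
  induction k generalizing δ with
  | zero =>
    have h1 := hasDerivAt_poiAvg (geomBdd_gammaAvg hδ hτ hf) (x / τ)
    have h2 := h1.comp x ((hasDerivAt_id x).div_const τ)
    have h3 : HasDerivWithinAt (fun x => poiAvg (x / τ) (gammaAvg δ τ f))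
        (kerDiff (0 + 1) δ τ f x / τ) (Ici 0) x := by
      refine (h2.hasDerivWithinAt).congr_deriv ?_
      rw [zero_add, kerDiff_one_eq hδ hτ hx hf]
      ring
    exact h3.congr (fun y hy => kerDiff_zero_eq hδ hτ hy hf) (kerDiff_zero_eq hδ hτ hx hf)
  | succ k ih =>
    refine ((ih (δ := δ + 1) (by linarith)).sub (ih hδ)).congr_deriv ?_
    rw [← sub_div]
    rfl

lemma kerDiff_zero_const {δ τ x : ℝ} (hδ : 0 ≤ δ) (hτ : 0 < τ) (hx : 0 ≤ x) (c : ℝ) :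
    kerDiff 0 δ τ (fun _ => c) x = c := by
  have := isProbabilityMeasure_poiGamma hδ hτ (show 0 ≤ x / τ by positivity)
  rw [kerDiff, kernel₁_eq_poiGamma hδ hτ hx]
  simp

lemma kerDiff_succ_const (k : ℕ) {δ τ x : ℝ} (hδ : 0 ≤ δ) (hτ : 0 < τ) (hx : 0 ≤ x) (c : ℝ) :
    kerDiff (k + 1) δ τ (fun _ => c) x = 0 := by
  induction k generalizing δ with
  | zero => rw [kerDiff, kerDiff_zero_const (by linarith) hτ hx, kerDiff_zero_const hδ hτ hx,
      sub_self]
  | succ k ih => rw [kerDiff, ih (by linarith), ih hδ, sub_self]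

lemma GaussFunctional.congr {C c τ x : ℝ} {Λ Λ' : (ℝ → ℝ) → ℝ} (h : GaussFunctional C c τ x Λ)
    (hΛ : ∀ f, BddMeas f → Λ' f = Λ f) : GaussFunctional C c τ x Λ' := by
  obtain ⟨μ, ν, hμ, hν, h⟩ := h
  exact ⟨μ, ν, hμ, hν, fun f hf => (hΛ f hf).trans (h f hf)⟩

/-- Square integrable multipliers define functionals with Gaussian bounds. -/
lemma exists_gaussFunctional {δ c T : ℝ} (hδ : 0 ≤ δ) (hc : 0 < c) (hT : 0 < T) :
    ∃ C : ℝ, 0 < C ∧ ∀ (τ x : ℝ) (b : ℕ → ℝ), 0 < τ → τ ≤ T → 0 ≤ x → GeomBdd b →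
      poiAvg (x / τ) (fun m => b m * b m) ≤ 6 →
      GaussFunctional C c τ x (fun f => poiAvg (x / τ) (fun m => b m * gammaAvg δ τ f m)) := by
  obtain ⟨C, hC0, hC⟩ := exists_gaussBound (B := 6) hδ hc hT (by norm_num)
  refine ⟨C, hC0, fun τ x b hτ hτT hx hbg hb => ?_⟩
  have hz : 0 ≤ x / τ := by positivity
  have hpos : ∀ b' : ℕ → ℝ, (∀ m, 0 ≤ b' m) → (∀ m, b' m ≤ |b m|) → GeomBdd b' ∧
      GaussBound C c τ x (poiGamma δ τ (x / τ) b') := by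
    intro b' h0 hle
    have hg : GeomBdd b' := by
      obtain ⟨A, K, hK, h⟩ := hbg
      exact ⟨A, K, hK, fun m => by rw [abs_of_nonneg (h0 m)]; exact (hle m).trans (h m)⟩
    refine ⟨hg, hC τ x b' hτ hτT hx h0 hg (le_trans ?_ hb)⟩
    refine ((hg.mul hg).summable _).tsum_le_tsum (fun m => ?_) ((hbg.mul hbg).summable _)
    refine mul_le_mul_of_nonneg_left ?_ (poi_nonneg hz m)
    beta_reduce
    rw [← abs_mul_abs_self (b m)]
    exact mul_self_le_mul_self (h0 m) (hle m)
  obtain ⟨g1, h1⟩ := hpos (fun m => max (b m) 0) (fun m => le_max_right _ _)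
    (fun m => max_le (le_abs_self _) (abs_nonneg _))
  obtain ⟨g2, h2⟩ := hpos (fun m => max (-b m) 0) (fun m => le_max_right _ _)
    (fun m => max_le (neg_le_abs _) (abs_nonneg _))
  refine ⟨_, _, h1, h2, fun f hf => ?_⟩
  have gF := geomBdd_gammaAvg hδ hτ hf
  rw [integral_poiGamma hδ hτ hz (fun m => le_max_right _ _) g1 hf,
    integral_poiGamma hδ hτ hz (fun m => le_max_right _ _) g2 hf,
    ← poiAvg_sub (g1.mul gF) (g2.mul gF)]
  refine congrArg (poiAvg (x / τ)) (funext fun m => ?_)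
  rw [← sub_mul]
  congr 1
  rcases le_total (b m) 0 with h | h
  · rw [max_eq_right h, max_eq_left (by linarith)]; ring
  · rw [max_eq_left h, max_eq_right (by linarith)]; ring

lemma exists_gaussFunctional_kerDiff_zero {δ c T : ℝ} (hδ : 0 ≤ δ) (hc : 0 < c) (hT : 0 < T) :
    ∃ C : ℝ, 0 < C ∧ ∀ τ x : ℝ, 0 < τ → τ ≤ T → 0 ≤ x →
      GaussFunctional C c τ x (fun f => kerDiff 0 δ τ f x) := by
  obtain ⟨C, hC0, hC⟩ := exists_gaussFunctional hδ hc hT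
  refine ⟨C, hC0, fun τ x hτ hτT hx => (hC τ x (fun _ => 1) hτ hτT hx (geomBdd_const 1)
    (by rw [poiAvg_const]; norm_num)).congr fun f hf => ?_⟩
  simp [kerDiff_zero_eq hδ hτ hx hf]

lemma exists_gaussFunctional_kerDiff_one {δ c T : ℝ} (hδ : 0 ≤ δ) (hc : 0 < c) (hT : 0 < T) :
    ∃ C : ℝ, 0 < C ∧ ∀ τ x : ℝ, 0 < τ → τ ≤ T → 0 ≤ x →
      GaussFunctional C c τ x (fun f => kerDiff 1 δ τ f x) := by
  obtain ⟨C, hC0, hC⟩ := exists_gaussFunctional_kerDiff_zero hδ hc hT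
  obtain ⟨C', hC0', hC'⟩ := exists_gaussFunctional_kerDiff_zero (δ := δ + 1) (by linarith) hc hT
  exact ⟨C' + C, by positivity, fun τ x hτ hτT hx =>
    (hC' τ x hτ hτT hx).sub (hC τ x hτ hτT hx) hτ hC0'.le hC0.le⟩

/-- A factor `√(x/τ)` absorbs one difference: this is the multiplier `c₁`. It is the reason why
`√x ∂ₓ` of the kernel costs only `τ^{-1/2}`, up to the boundary. -/
lemma exists_gaussFunctional_sqrt_kerDiff_one {δ c T : ℝ} (hδ : 0 ≤ δ) (hc : 0 < c) (hT : 0 < T) :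
    ∃ C : ℝ, 0 < C ∧ ∀ τ x : ℝ, 0 < τ → τ ≤ T → 0 ≤ x →
      GaussFunctional C c τ x (fun f => √(x / τ) * kerDiff 1 δ τ f x) := by
  obtain ⟨C, hC0, hC⟩ := exists_gaussFunctional hδ hc hT
  refine ⟨C, hC0, fun τ x hτ hτT hx => (hC τ x _ hτ hτT hx (geomBdd_charlier₁ _)
    (poiAvg_charlier₁_sq (by positivity))).congr fun f hf => ?_⟩
  rw [kerDiff_one_eq hδ hτ hx hf,
    poiAvg_charlier₁_mul (geomBdd_gammaAvg hδ hτ hf) (by positivity)]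

lemma exists_gaussFunctional_sqrt_kerDiff_two {δ c T : ℝ} (hδ : 0 ≤ δ) (hc : 0 < c) (hT : 0 < T) :
    ∃ C : ℝ, 0 < C ∧ ∀ τ x : ℝ, 0 < τ → τ ≤ T → 0 ≤ x →
      GaussFunctional C c τ x (fun f => √(x / τ) * kerDiff 2 δ τ f x) := by
  obtain ⟨C, hC0, hC⟩ := exists_gaussFunctional_sqrt_kerDiff_one hδ hc hT
  obtain ⟨C', hC0', hC'⟩ := exists_gaussFunctional_sqrt_kerDiff_one (δ := δ + 1) (by linarith) hc hT
  refine ⟨C' + C, by positivity, fun τ x hτ hτT hx =>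
    ((hC' τ x hτ hτT hx).sub (hC τ x hτ hτT hx) hτ hC0'.le hC0.le).congr fun f hf => ?_⟩
  rw [← mul_sub]
  rfl

lemma exists_gaussFunctional_mul_kerDiff_two {δ c T : ℝ} (hδ : 0 ≤ δ) (hc : 0 < c) (hT : 0 < T) :
    ∃ C : ℝ, 0 < C ∧ ∀ τ x : ℝ, 0 < τ → τ ≤ T → 0 ≤ x →
      GaussFunctional C c τ x (fun f => x / τ * kerDiff 2 δ τ f x) := by
  obtain ⟨C, hC0, hC⟩ := exists_gaussFunctional hδ hc hT
  refine ⟨C, hC0, fun τ x hτ hτT hx => (hC τ x _ hτ hτT hx (geomBdd_charlier₂ _)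
    (poiAvg_charlier₂_sq (by positivity))).congr fun f hf => ?_⟩
  rw [kerDiff_two_eq hδ hτ hx hf,
    poiAvg_charlier₂_mul (geomBdd_gammaAvg hδ hτ hf) (by positivity)]

lemma exists_gaussFunctional_mul_kerDiff_three {δ c T : ℝ} (hδ : 0 ≤ δ) (hc : 0 < c)
    (hT : 0 < T) :
    ∃ C : ℝ, 0 < C ∧ ∀ τ x : ℝ, 0 < τ → τ ≤ T → 0 ≤ x →
      GaussFunctional C c τ x (fun f => x / τ * √(x / τ) * kerDiff 3 δ τ f x) := by
  obtain ⟨C, hC0, hC⟩ := exists_gaussFunctional hδ hc hT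
  refine ⟨C, hC0, fun τ x hτ hτT hx => (hC τ x _ hτ hτT hx (geomBdd_charlier₃ _)
    (poiAvg_charlier₃_sq (by positivity))).congr fun f hf => ?_⟩
  rw [kerDiff_three_eq hδ hτ hx hf,
    poiAvg_charlier₃_mul (geomBdd_gammaAvg hδ hτ hf) (by positivity)]

/-! ### Two-dimensional averages at a fixed time -/

lemma GaussFunctional.map_sub {C c τ x : ℝ} {Λ : (ℝ → ℝ) → ℝ} (h : GaussFunctional C c τ x Λ)
    (hτ : 0 < τ) {f g : ℝ → ℝ} (hf : BddMeas f) (hg : BddMeas g) :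
    Λ (fun y => f y - g y) = Λ f - Λ g := by
  obtain ⟨μ, ν, hμ, hν, hΛ⟩ := h
  have := hμ.isFiniteMeasure hτ
  have := hν.isFiniteMeasure hτ
  rw [hΛ _ (hf.sub hg), hΛ f hf, hΛ g hg, integral_sub (hf.integrable _) (hg.integrable _),
    integral_sub (hf.integrable _) (hg.integrable _)]
  ring

/-- Bounded measurable functions of two variables. -/
def BddMeas₂ (F : ℝ → ℝ → ℝ) : Prop :=
  Measurable (Function.uncurry F) ∧ ∃ M : ℝ, ∀ x y, |F x y| ≤ M

lemma BddMeas₂.left {F : ℝ → ℝ → ℝ} (hF : BddMeas₂ F) (x : ℝ) : BddMeas (F x) :=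
  ⟨hF.1.comp (measurable_const.prodMk measurable_id), hF.2.imp fun _ h y => h x y⟩

lemma BddMeas₂.swap {F : ℝ → ℝ → ℝ} (hF : BddMeas₂ F) : BddMeas₂ (fun y x => F x y) :=
  ⟨hF.1.comp measurable_swap, hF.2.imp fun _ h y x => h x y⟩

lemma BddMeas₂.integral {F : ℝ → ℝ → ℝ} (hF : BddMeas₂ F) (μ : Measure ℝ) [IsFiniteMeasure μ] :
    BddMeas (fun x => ∫ y, F x y ∂μ) := by
  obtain ⟨hm, M, hM⟩ := hF
  refine ⟨(hm.stronglyMeasurable.integral_prod_right (ν := μ)).measurable, M * μ.real univ,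
    fun x => ?_⟩
  exact norm_integral_le_of_norm_le_const (μ := μ) (f := F x)
    (Filter.Eventually.of_forall (hM x))

lemma GaussFunctional.bddMeas {C c τ x : ℝ} {Λ : (ℝ → ℝ) → ℝ} (h : GaussFunctional C c τ x Λ)
    (hτ : 0 < τ) {F : ℝ → ℝ → ℝ} (hF : BddMeas₂ F) : BddMeas (fun x' => Λ (F x')) := by
  obtain ⟨μ, ν, hμ, hν, hΛ⟩ := h
  have := hμ.isFiniteMeasure hτ
  have := hν.isFiniteMeasure hτ
  rw [show (fun x' => Λ (F x')) = fun x' => ∫ y, F x' y ∂μ - ∫ y, F x' y ∂ν from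
    funext fun x' => hΛ _ (hF.left x')]
  exact (hF.integral μ).sub (hF.integral ν)

lemma isProbabilityMeasure_kernel₁ {δ τ x : ℝ} (hδ : 0 ≤ δ) (hτ : 0 < τ) (hx : 0 ≤ x) :
    IsProbabilityMeasure (kernel₁ δ τ x) := by
  rw [kernel₁_eq_poiGamma hδ hτ hx]
  exact isProbabilityMeasure_poiGamma hδ hτ (by positivity)

lemma bddMeas_kerDiff (k : ℕ) {δ τ y : ℝ} (hδ : 0 ≤ δ) (hτ : 0 < τ) (hy : 0 ≤ y) {F : ℝ → ℝ → ℝ}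
    (hF : BddMeas₂ F) : BddMeas (fun x => kerDiff k δ τ (F x) y) := by
  induction k generalizing δ with
  | zero =>
    have := isProbabilityMeasure_kernel₁ hδ hτ hy
    exact hF.integral _
  | succ k ih => exact (ih (by linarith)).sub (ih hδ)

lemma kerDiff_sub (k : ℕ) {δ τ y : ℝ} (hδ : 0 ≤ δ) (hτ : 0 < τ) (hy : 0 ≤ y) {f g : ℝ → ℝ}
    (hf : BddMeas f) (hg : BddMeas g) :
    kerDiff k δ τ (fun x => f x - g x) y = kerDiff k δ τ f y - kerDiff k δ τ g y := by
  induction k generalizing δ with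
  | zero =>
    have := isProbabilityMeasure_kernel₁ hδ hτ hy
    exact integral_sub (hf.integrable _) (hg.integrable _)
  | succ k ih => rw [kerDiff, kerDiff, kerDiff, ih (by linarith), ih hδ]; ring

/-- Fubini's theorem for the kernel differences in the two variables. -/
lemma kerDiff_swap (k l : ℕ) {δ ε σ ς x y : ℝ} (hδ : 0 ≤ δ) (hε : 0 ≤ ε) (hσ : 0 < σ) (hς : 0 < ς)
    (hx : 0 ≤ x) (hy : 0 ≤ y) {F : ℝ → ℝ → ℝ} (hF : BddMeas₂ F) :
    kerDiff k δ σ (fun x' => kerDiff l ε ς (F x') y) x =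
      kerDiff l ε ς (fun y' => kerDiff k δ σ (fun x' => F x' y') x) y := by
  induction k generalizing δ with
  | zero =>
    induction l generalizing ε with
    | zero =>
      have := isProbabilityMeasure_kernel₁ hδ hσ hx
      have := isProbabilityMeasure_kernel₁ hε hς hy
      obtain ⟨hm, M, hM⟩ := hF
      exact integral_integral_swap (Integrable.of_bound hm.aestronglyMeasurable M
        (Filter.Eventually.of_forall fun p => hM p.1 p.2))
    | succ l ih =>
      simp only [kerDiff] at ih ⊢
      have := kerDiff_sub 0 hδ hσ hx (bddMeas_kerDiff l (show 0 ≤ ε + 1 by linarith) hς hy hF)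
        (bddMeas_kerDiff l hε hς hy hF)
      simp only [kerDiff] at this
      rw [this, ih (by linarith), ih hε]
  | succ k ih =>
    rw [kerDiff, ih (by linarith), ih hδ, ← kerDiff_sub l hε hς hy
      (bddMeas_kerDiff k (show 0 ≤ δ + 1 by linarith) hσ hx hF.swap)
      (bddMeas_kerDiff k hδ hσ hx hF.swap)]
    rfl

/-- The assumptions on the right hand side: a Gaussian bound and a weighted Hölder bound in the
first variable. The Gaussians are centred at `(w₁, w₂)` in the variables `(√x, √y)`. -/
structure DataBound (a b w₁ w₂ j γ T : ℝ) (G : ℝ → ℝ → ℝ → ℝ) : Prop where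
  meas : Measurable (fun p : ℝ × ℝ × ℝ => G p.1 p.2.1 p.2.2)
  bound : ∀ s ∈ Ioc 0 T, ∀ x y, |G s x y| ≤ s ^ (-j) * (gauss 1 w₁ (a * s) x * gauss 1 w₂ (b * s) y)
  holder : ∀ s ∈ Ioc 0 T, ∀ x x' y, |G s x y - G s x' y| ≤ s ^ (-(j + γ / 2)) * |√x - √x'| ^ γ *
    ((gauss 1 w₁ (a * s) x + gauss 1 w₁ (a * s) x') * gauss 1 w₂ (b * s) y)

lemma DataBound.bddMeas₂ {a b w₁ w₂ j γ T : ℝ} {G : ℝ → ℝ → ℝ → ℝ}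
    (hG : DataBound a b w₁ w₂ j γ T G) (ha : 0 ≤ a) (hb : 0 ≤ b) {s : ℝ} (hs : s ∈ Ioc 0 T) :
    BddMeas₂ (G s) := by
  refine ⟨hG.meas.comp (measurable_const.prodMk measurable_id), s ^ (-j), fun x y => ?_⟩
  refine (hG.bound s hs x y).trans ?_
  have h1 : gauss 1 w₁ (a * s) x ≤ 1 := gauss_le_one zero_le_one (mul_nonneg ha hs.1.le)
  have h2 : gauss 1 w₂ (b * s) y ≤ 1 := gauss_le_one zero_le_one (mul_nonneg hb hs.1.le)
  have h3 := Real.rpow_nonneg hs.1.le (-j)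
  have h4 := gauss_pos 1 w₁ (a * s) x
  have h5 := gauss_pos 1 w₂ (b * s) y
  have h6 : gauss 1 w₁ (a * s) x * gauss 1 w₂ (b * s) y ≤ 1 := mul_le_one₀ h1 h5.le h2
  exact mul_le_of_le_one_right h3 h6

/-- The integrable majorant in the time variable `s ∈ (0, t)`: for `s < t/2` it comes from the
concentration of the data near one point, for `s ≥ t/2` from their Hölder continuity. -/
def majorant (j γ t s : ℝ) : ℝ :=
  if s < t / 2 then s ^ (1 - j) * t ^ (-2 : ℝ) else t ^ (-(j + γ / 2)) * (t - s) ^ (γ / 2 - 1)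

lemma majorant_nonneg {j γ t s : ℝ} (hs : 0 < s) (hst : s < t) : 0 ≤ majorant j γ t s := by
  have h1 : 0 < t - s := by linarith
  have h2 : 0 < t := by linarith
  unfold majorant
  split_ifs <;> positivity

lemma rpow_neg_le_of_half_le {p s t : ℝ} (ht : 0 < t) (h : t / 2 ≤ s) (hst : s ≤ t) :
    s ^ (-p) ≤ 2 ^ |p| * t ^ (-p) := by
  have hs : 0 < s := by linarith
  have htp : 0 < t ^ (-p) := Real.rpow_pos_of_pos ht _
  rcases le_total 0 p with hp | hp
  · rw [abs_of_nonneg hp]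
    calc s ^ (-p) ≤ (t / 2) ^ (-p) :=
          Real.rpow_le_rpow_of_nonpos (by linarith) h (by linarith)
      _ = 2 ^ p * t ^ (-p) := by
          rw [Real.div_rpow ht.le zero_le_two, Real.rpow_neg zero_le_two]
          field_simp
  · calc s ^ (-p) ≤ t ^ (-p) := Real.rpow_le_rpow hs.le hst (by linarith)
      _ ≤ _ := le_mul_of_one_le_left htp.le (Real.one_le_rpow one_le_two (abs_nonneg _))

/-- Gaussian bound for a product functional on data that are concentrated near one point. -/
lemma exists_abs_product_le_of_concentrated {a b w₁ w₂ T C : ℝ} (ha : 0 < a) (hb : 0 < b)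
    (hw₁ : 0 < w₁) (hw₂ : 0 < w₂) (hT : 0 < T) (hC : 0 < C) :
    ∃ K : ℝ, 0 < K ∧ ∀ t s x y A : ℝ, 0 < s → s < t → t ≤ T → 0 ≤ A → ∀ F, BddMeas₂ F →
      (∀ x y, |F x y| ≤ A * (gauss 1 w₁ (a * s) x * gauss 1 w₂ (b * s) y)) →
      ∀ Λx Λy : (ℝ → ℝ) → ℝ, GaussFunctional C (w₁ ^ 2 / 4) (a * (t - s)) x Λx →
      GaussFunctional C (w₂ ^ 2 / 4) (b * (t - s)) y Λy →
      |Λx (fun x' => Λy (F x'))| ≤ K * (A * (s / (t - s))) *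
        (gauss (4 / 5) w₁ (a * t) x * gauss (4 / 5) w₂ (b * t) y) := by
  have hsq : ∀ w : ℝ, 0 < w → √(w ^ 2 / 4) < w := fun w hw => by
    rw [show w ^ 2 / 4 = (w / 2) ^ 2 by ring, Real.sqrt_sq (by positivity)]; linarith
  obtain ⟨K₁, hK₁0, hK₁⟩ := exists_abs_le_gauss_sqrt (c := w₁ ^ 2 / 4) (w := w₁) (T := a * T)
    (by positivity) (hsq _ hw₁) (by positivity)
  obtain ⟨K₂, hK₂0, hK₂⟩ := exists_abs_le_gauss_sqrt (c := w₂ ^ 2 / 4) (w := w₂) (T := b * T)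
    (by positivity) (hsq _ hw₂) (by positivity)
  refine ⟨K₁ * C * (K₂ * C), by positivity, fun t s x y A hs hst htT hA F hF hFb Λx Λy hx hy => ?_⟩
  have hsT : s ≤ T := by linarith
  have hτ : 0 < t - s := by linarith
  have hσ : 0 < a * (t - s) := by positivity
  have hς : 0 < b * (t - s) := by positivity
  have hΛF := hy.bddMeas hς hF
  have eta : ∀ a' : ℝ, a' * (t - s) + a' * s = a' * t := fun a' => by ring
  have hg2 := gauss_pos (4 / 5) w₂ (b * t) y
  have hin : ∀ x', |Λy (F x')| ≤ (K₂ * C * √(b * s / (b * (t - s))) * A *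
      gauss (4 / 5) w₂ (b * t) y) * gauss 1 w₁ (a * s) x' := by
    intro x'
    have hgx := gauss_pos 1 w₁ (a * s) x'
    have h := hK₂ C (b * (t - s)) y (A * gauss 1 w₁ (a * s) x') (b * s) Λy (F x')
      hC.le hς (by gcongr; linarith) (by positivity) (by gcongr) (by positivity) hy
      (hF.left x') (fun y' => (hFb x' y').trans (le_of_eq (by ring)))
    rw [eta] at h
    exact h.trans (le_of_eq (by ring))
  have h := hK₁ C (a * (t - s)) x _ (a * s) Λx _ hC.le hσ (by gcongr; linarith) (by positivity)
    (by gcongr) (by positivity) hx hΛF hin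
  rw [eta] at h
  refine h.trans (le_of_eq ?_)
  rw [mul_div_mul_left _ _ ha.ne', mul_div_mul_left _ _ hb.ne']
  have e1 : √(s / (t - s)) * √(s / (t - s)) = s / (t - s) :=
    Real.mul_self_sqrt (by positivity)
  linear_combination (K₁ * C * (K₂ * C)) * A *
    (gauss (4 / 5) w₁ (a * t) x * gauss (4 / 5) w₂ (b * t) y) * e1

/-- Gaussian bound for a product functional that annihilates constants in the first variable. -/
lemma exists_abs_product_le {a b w₁ w₂ T C : ℝ} (j : ℝ) {γ : ℝ} (ha : 0 < a) (hb : 0 < b)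
    (hw₁ : 0 < w₁) (hw₂ : 0 < w₂) (hT : 0 < T) (hγ0 : 0 < γ) (hγ1 : γ < 1) (hC : 0 < C) :
    ∃ K : ℝ, 0 < K ∧ ∀ G, DataBound a b w₁ w₂ j γ T G → ∀ t s x y : ℝ, 0 < s → s < t → t ≤ T →
      ∀ Λx Λy : (ℝ → ℝ) → ℝ, GaussFunctional C (w₁ ^ 2 / 4) (a * (t - s)) x Λx →
      (∀ c, Λx (fun _ => c) = 0) → GaussFunctional C (w₂ ^ 2 / 4) (b * (t - s)) y Λy →
      |Λx (fun x' => Λy (G s x'))| ≤ K * ((t - s) * majorant j γ t s) *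
        (gauss (4 / 5) w₁ (a * t) x * gauss (4 / 5) w₂ (b * t) y) := by
  obtain ⟨K₁, hK₁0, hK₁⟩ := exists_abs_product_le_of_concentrated ha hb hw₁ hw₂ hT hC
  have hapos : 0 < a ^ (γ / 2) := Real.rpow_pos_of_pos ha _
  refine ⟨4 * K₁ + 80 * C * (2 * C) * 2 ^ |j + γ / 2| * a ^ (γ / 2),
    by positivity, fun G hG t s x y hs hst htT Λx Λy hx hx1 hy => ?_⟩
  have hsT : s ∈ Ioc 0 T := ⟨hs, by linarith⟩
  have hτ : 0 < t - s := by linarith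
  have ht : 0 < t := by linarith
  have hσ : 0 < a * (t - s) := by positivity
  have hς : 0 < b * (t - s) := by positivity
  have hF := hG.bddMeas₂ ha.le hb.le hsT
  have hΛF := hy.bddMeas hς hF
  have eta : ∀ a' : ℝ, a' * (t - s) + a' * s = a' * t := fun a' => by ring
  have hg1 := gauss_pos (4 / 5) w₁ (a * t) x
  have hg2 := gauss_pos (4 / 5) w₂ (b * t) y
  have hsj := Real.rpow_pos_of_pos hs (-j)
  have hpj := Real.rpow_pos_of_pos hs (-(j + γ / 2))
  have htj := Real.rpow_pos_of_pos ht (-(j + γ / 2))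
  unfold majorant
  split_ifs with hcase
  · have h := hK₁ t s x y (s ^ (-j)) hs hst htT hsj.le (G s) hF (hG.bound s hsT) Λx Λy hx hy
    refine h.trans ?_
    have e2 : s / (t - s) ≤ 4 * (t - s) * s * t ^ (-2 : ℝ) := by
      rw [Real.rpow_neg ht.le, Real.rpow_ofNat, ← div_eq_mul_inv, div_le_div_iff₀ hτ (by positivity)]
      have : t ≤ 2 * (t - s) := by linarith
      nlinarith [mul_le_mul this this ht.le (by linarith)]
    have e3 : s ^ (1 - j) = s * s ^ (-j) := by
      rw [sub_eq_add_neg, Real.rpow_add hs, Real.rpow_one]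
    have ht2 : 0 < t ^ (-2 : ℝ) := Real.rpow_pos_of_pos ht _
    calc _ ≤ K₁ * (s ^ (-j) * (4 * (t - s) * s * t ^ (-2 : ℝ))) *
          (gauss (4 / 5) w₁ (a * t) x * gauss (4 / 5) w₂ (b * t) y) := by gcongr
      _ = 4 * K₁ * ((t - s) * (s ^ (1 - j) * t ^ (-2 : ℝ))) *
          (gauss (4 / 5) w₁ (a * t) x * gauss (4 / 5) w₂ (b * t) y) := by rw [e3]; ring
      _ ≤ _ := by
          gcongr
          exact le_add_of_nonneg_right (by positivity)
  · have hin : ∀ x', |Λy (G s x') - Λy (G s x)| ≤ (2 * C * s ^ (-(j + γ / 2)) *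
        gauss (4 / 5) w₂ (b * t) y) * |√x' - √x| ^ γ *
          (gauss 1 w₁ (a * s) x' + gauss 1 w₁ (a * s) x) := by
      intro x'
      have hgx := gauss_pos 1 w₁ (a * s) x'
      have hgx2 := gauss_pos 1 w₁ (a * s) x
      rw [← hy.map_sub hς (hF.left x') (hF.left x)]
      have h := hy.abs_le_gauss (f := fun y' => G s x' y' - G s x y')
        (A := s ^ (-(j + γ / 2)) * |√x' - √x| ^ γ *
          (gauss 1 w₁ (a * s) x' + gauss 1 w₁ (a * s) x)) (w := w₂) (s := b * s) hC.le hς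
        (by positivity) (by positivity) ((hF.left x').sub (hF.left x))
        (fun y' => (hG.holder s hsT x' x y').trans (le_of_eq (by ring)))
      rw [eta] at h
      exact h.trans (le_of_eq (by ring))
    have h := hx.abs_le_holder hx1 hC.le hσ (by positivity) (show 0 < a * s by positivity)
      hγ0 hγ1 hΛF hin
    rw [eta] at h
    refine h.trans ?_
    have e1 := rpow_neg_le_of_half_le (p := j + γ / 2) ht (not_lt.1 hcase) hst.le
    have e2 : (t - s) * (t - s) ^ (γ / 2 - 1) = (t - s) ^ (γ / 2) := by
      rw [Real.rpow_sub_one hτ.ne']; field_simp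
    calc _ = 80 * C * (2 * C) * a ^ (γ / 2) * (t - s) ^ (γ / 2) * s ^ (-(j + γ / 2)) *
          (gauss (4 / 5) w₁ (a * t) x * gauss (4 / 5) w₂ (b * t) y) := by
          rw [Real.mul_rpow ha.le hτ.le]; ring
      _ ≤ 80 * C * (2 * C) * a ^ (γ / 2) * (t - s) ^ (γ / 2) *
          (2 ^ |j + γ / 2| * t ^ (-(j + γ / 2))) *
          (gauss (4 / 5) w₁ (a * t) x * gauss (4 / 5) w₂ (b * t) y) := by gcongr
      _ = 80 * C * (2 * C) * 2 ^ |j + γ / 2| * a ^ (γ / 2) *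
          ((t - s) * (t ^ (-(j + γ / 2)) * (t - s) ^ (γ / 2 - 1))) *
          (gauss (4 / 5) w₁ (a * t) x * gauss (4 / 5) w₂ (b * t) y) := by
          rw [← e2]; ring
      _ ≤ _ := by
          gcongr
          exact le_add_of_nonneg_left (by positivity)

/-! ### Bounds for the differentiated kernel at a fixed time -/

/-- `∂ₓ` of the product kernel average of `F`, with the times `σ` and `ς` in the two variables. -/
def avgDx (δ ε σ ς : ℝ) (F : ℝ → ℝ → ℝ) (x y : ℝ) : ℝ :=
  kerDiff 1 δ σ (fun x' => kerDiff 0 ε ς (F x') y) x / σ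

/-- `x ∂ₓ²` of the product kernel average of `F`. -/
def avgDxx (δ ε σ ς : ℝ) (F : ℝ → ℝ → ℝ) (x y : ℝ) : ℝ :=
  x * (kerDiff 2 δ σ (fun x' => kerDiff 0 ε ς (F x') y) x / σ ^ 2)

/-- Mean value estimate in the variable `√x`. -/
lemma abs_sub_le_of_sqrt_deriv {v v' : ℝ → ℝ}
    (hv : ∀ x, 0 ≤ x → HasDerivWithinAt v (v' x) (Ici 0) x) {x x' B : ℝ} (hx : 0 ≤ x) (hx' : 0 ≤ x')
    (hB : ∀ ξ, 0 ≤ ξ → |√x - √ξ| ≤ |√x - √x'| → |2 * √ξ * v' ξ| ≤ B) :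
    |v x - v x'| ≤ B * |√x - √x'| := by
  have hφ : ∀ u ∈ uIcc (√x) (√x'), HasDerivWithinAt (fun u => v (u ^ 2)) (v' (u ^ 2) * (2 * u))
      (uIcc (√x) (√x')) u := by
    intro u hu
    have h1 := HasDerivWithinAt.comp (h₂ := v) (h := fun u : ℝ => u ^ 2) u
      (hv (u ^ 2) (sq_nonneg u)) ((hasDerivAt_pow 2 u).hasDerivWithinAt
      (s := uIcc (√x) (√x'))) (fun u _ => sq_nonneg u)
    refine h1.congr_deriv ?_
    norm_num
  have hle : ∀ u ∈ uIcc (√x) (√x'), ‖v' (u ^ 2) * (2 * u)‖ ≤ B := by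
    intro u hu
    have hu0 : 0 ≤ u := le_trans (le_min (Real.sqrt_nonneg x) (Real.sqrt_nonneg x')) hu.1
    have h := hB (u ^ 2) (sq_nonneg u) (by
      rw [Real.sqrt_sq hu0, abs_sub_comm, abs_sub_comm (√x)]
      exact abs_sub_left_of_mem_uIcc hu)
    rw [Real.sqrt_sq hu0] at h
    rw [Real.norm_eq_abs]
    exact (le_of_eq (by congr 1; ring)).trans h
  have h := (convex_uIcc (√x) (√x')).norm_image_sub_le_of_norm_hasDerivWithin_le hφ hle
    right_mem_uIcc left_mem_uIcc
  simpa [Real.sq_sqrt hx, Real.sq_sqrt hx'] using h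

/-- Gaussians at points whose distance in `√x` is at most `√t` are comparable, at the expense of
a smaller exponent. -/
lemma gauss_le_of_close {a w t x ξ : ℝ} (ha : 0 < a) (ht : 0 < t) (h : |√x - √ξ| ^ 2 ≤ t) :
    gauss (4 / 5) w (a * t) ξ ≤ Real.exp (14 / (5 * a)) * gauss (7 / 10) w (a * t) x := by
  unfold gauss
  rw [← Real.exp_add]
  refine Real.exp_le_exp.2 ?_
  rw [sq_abs] at h
  have h1 : 7 / 10 * (√x - w) ^ 2 ≤ 4 / 5 * (√ξ - w) ^ 2 + 28 / 5 * t := by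
    nlinarith [sq_nonneg ((√ξ - w) - 7 * (√x - √ξ))]
  have e1 : 7 / 10 * ((√x - w) ^ 2 / (2 * (a * t))) =
      7 / 10 * (√x - w) ^ 2 / (2 * (a * t)) := by ring
  have e2 : 4 / 5 * ((√ξ - w) ^ 2 / (2 * (a * t))) + 14 / (5 * a) =
      (4 / 5 * (√ξ - w) ^ 2 + 28 / 5 * t) / (2 * (a * t)) := by
    field_simp
    ring
  have h2 : 7 / 10 * ((√x - w) ^ 2 / (2 * (a * t))) ≤
      4 / 5 * ((√ξ - w) ^ 2 / (2 * (a * t))) + 14 / (5 * a) := by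
    rw [e1, e2]
    gcongr
  linarith

/-- The estimates for a differentiated average at a fixed time `s = t - τ`; `m` stands for the
majorant in `s`. -/
structure SliceBound (K a b w₁ w₂ m t τ : ℝ) (v : ℝ → ℝ → ℝ) : Prop where
  bound : ∀ x y, 0 ≤ x → 0 ≤ y →
    |v x y| ≤ K * m * (gauss (4 / 5) w₁ (a * t) x * gauss (4 / 5) w₂ (b * t) y)
  holder_fst : ∀ x x' y, 0 ≤ x → 0 ≤ x' → 0 ≤ y → |√x - √x'| ^ 2 ≤ τ →
    |v x y - v x' y| ≤ K * (m / √τ) * (gauss (7 / 10) w₁ (a * t) x * gauss (7 / 10) w₂ (b * t) y) *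
      |√x - √x'|
  holder_snd : ∀ x y y', 0 ≤ x → 0 ≤ y → 0 ≤ y' → |√y - √y'| ^ 2 ≤ τ →
    |v x y - v x y'| ≤ K * (m / √τ) * (gauss (7 / 10) w₁ (a * t) x * gauss (7 / 10) w₂ (b * t) y) *
      |√y - √y'|

lemma sqrt_eq_sqrt_mul_sqrt_div {σ ξ : ℝ} (hσ : 0 < σ) : √ξ = √σ * √(ξ / σ) := by
  rw [← Real.sqrt_mul hσ.le]; congr 1; field_simp

/-- Common part of the slice estimates, for `v = (aτ)^{-1} Λₓ ⊗ P`, where the functionals that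
represent `Λₓ`, `√x ∂ₓ Λₓ` and `√y ∂_y P` have Gaussian bounds. -/
lemma sliceBound_of_functionals {a b w₁ w₂ j γ C K ε : ℝ} (ha : 0 < a) (hb : 0 < b)
    (hε : 0 ≤ ε) (hK : 0 < K) {G : ℝ → ℝ → ℝ → ℝ}
    {t s : ℝ} (hs : 0 < s) (hst : s < t) (hF : BddMeas₂ (G s))
    (hprod : ∀ x y : ℝ,
      ∀ Λx Λy : (ℝ → ℝ) → ℝ, GaussFunctional C (w₁ ^ 2 / 4) (a * (t - s)) x Λx →
      (∀ c, Λx (fun _ => c) = 0) → GaussFunctional C (w₂ ^ 2 / 4) (b * (t - s)) y Λy →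
      |Λx (fun x' => Λy (G s x'))| ≤ K * ((t - s) * majorant j γ t s) *
        (gauss (4 / 5) w₁ (a * t) x * gauss (4 / 5) w₂ (b * t) y))
    (L L' : (ℝ → ℝ) → ℝ → ℝ)
    (hL : ∀ x, 0 ≤ x → GaussFunctional C (w₁ ^ 2 / 4) (a * (t - s)) x (fun f => L f x))
    (hL1 : ∀ x, 0 ≤ x → ∀ c : ℝ, L (fun _ => c) x = 0)
    (hL' : ∀ x, 0 ≤ x → GaussFunctional C (w₁ ^ 2 / 4) (a * (t - s)) x
      (fun f => √(x / (a * (t - s))) * L' f x))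
    (hL'1 : ∀ x, 0 ≤ x → ∀ c : ℝ, L' (fun _ => c) x = 0)
    (hderiv : ∀ f, BddMeas f → ∀ x, 0 ≤ x →
      HasDerivWithinAt (L f) (L' f x / (a * (t - s))) (Ici 0) x)
    (hswap : ∀ k x y, 0 ≤ x → 0 ≤ y → L (fun x' => kerDiff k ε (b * (t - s)) (G s x') y) x =
      kerDiff k ε (b * (t - s)) (fun y' => L (fun x' => G s x' y') x) y)
    (hLm : ∀ x, 0 ≤ x → BddMeas (fun y' => L (fun x' => G s x' y') x))
    (hP : ∀ y, 0 ≤ y → GaussFunctional C (w₂ ^ 2 / 4) (b * (t - s)) y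
      (fun f => kerDiff 0 ε (b * (t - s)) f y))
    (hP' : ∀ y, 0 ≤ y → GaussFunctional C (w₂ ^ 2 / 4) (b * (t - s)) y
      (fun f => √(y / (b * (t - s))) * kerDiff 1 ε (b * (t - s)) f y)) :
    SliceBound (K * (1 / a) * (1 + 2 / √a * Real.exp (14 / (5 * a)) +
      2 / √b * Real.exp (14 / (5 * b)))) a b w₁ w₂ (majorant j γ t s) t (t - s)
      (fun x y => L (fun x' => kerDiff 0 ε (b * (t - s)) (G s x') y) x / (a * (t - s))) := by
  have hτ : 0 < t - s := by linarith
  have ht : 0 < t := by linarith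
  have hm := majorant_nonneg (j := j) (γ := γ) hs hst
  set τ := t - s with hτd
  set m := majorant j γ t s with hmd
  have hσ : 0 < a * τ := by positivity
  have hς : 0 < b * τ := by positivity
  have hsτ : 0 < √τ := Real.sqrt_pos.2 hτ
  have hsa : 0 < √a := Real.sqrt_pos.2 ha
  have hsb : 0 < √b := Real.sqrt_pos.2 hb
  have hτt : τ ≤ t := by rw [hτd]; linarith
  have hτ2 : √τ * √τ = τ := Real.mul_self_sqrt hτ.le
  have ha2 : √a * √a = a := Real.mul_self_sqrt ha.le
  have hb2 : √b * √b = b := Real.mul_self_sqrt hb.le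
  have hE : ∀ c : ℝ, 0 < Real.exp c := Real.exp_pos
  have hmono : ∀ (w c x : ℝ), 0 < c → gauss (4 / 5) w (c * t) x ≤ gauss (7 / 10) w (c * t) x :=
    fun w c x hc => gauss_anti (by norm_num) (by positivity)
  refine ⟨fun x y hx hy => ?_, fun x x' y hx hx' hy hxx => ?_, fun x y y' hx hy hy' hyy => ?_⟩
  · have h := hprod x y _ _ (hL x hx) (hL1 x hx) (hP y hy)
    have g1 := gauss_pos (4 / 5) w₁ (a * t) x
    have g2 := gauss_pos (4 / 5) w₂ (b * t) y
    rw [abs_div, abs_of_pos hσ, div_le_iff₀ hσ]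
    refine h.trans ?_
    have : K * (τ * m) * (gauss (4 / 5) w₁ (a * t) x * gauss (4 / 5) w₂ (b * t) y) =
        K * (1 / a) * 1 * m * (gauss (4 / 5) w₁ (a * t) x * gauss (4 / 5) w₂ (b * t) y) *
          (a * τ) := by field_simp
    rw [this]
    gcongr
    have : 0 ≤ 2 / √a * Real.exp (14 / (5 * a)) := by positivity
    have : 0 ≤ 2 / √b * Real.exp (14 / (5 * b)) := by positivity
    linarith
  · have g1 := gauss_pos (7 / 10) w₁ (a * t) x
    have g2 := gauss_pos (7 / 10) w₂ (b * t) y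
    have hfm := (hP y hy).bddMeas hς hF
    refine (abs_sub_le_of_sqrt_deriv (fun ξ hξ => (hderiv _ hfm ξ hξ).div_const _) hx hx'
      (B := K * (1 / a) * (2 / √a * Real.exp (14 / (5 * a))) * (m / √τ) *
        (gauss (7 / 10) w₁ (a * t) x * gauss (7 / 10) w₂ (b * t) y)) fun ξ hξ hξx => ?_).trans ?_
    · have h := hprod ξ y _ _ (hL' ξ hξ)
        (fun c => by rw [hL'1 ξ hξ, mul_zero]) (hP y hy)
      have hc := gauss_le_of_close (w := w₁) (x := x) (ξ := ξ) ha ht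
        ((pow_le_pow_left₀ (abs_nonneg _) hξx 2).trans (hxx.trans hτt))
      have hc2 := hmono w₂ b y hb
      have g3 := gauss_pos (4 / 5) w₂ (b * t) y
      have e : 2 * √ξ * (L' (fun x' => kerDiff 0 ε (b * τ) (G s x') y) ξ / (a * τ) / (a * τ)) =
          2 / (a * τ * √a * √τ) *
          (√(ξ / (a * τ)) * L' (fun x' => kerDiff 0 ε (b * τ) (G s x') y) ξ) := by
        rw [sqrt_eq_sqrt_mul_sqrt_div (ξ := ξ) hσ, Real.sqrt_mul ha.le]
        rw [div_div, mul_div_assoc', div_mul_eq_mul_div, div_eq_div_iff (by positivity)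
          (by positivity)]
        linear_combination (2 * √(ξ / (a * τ)) *
          L' (fun x' => kerDiff 0 ε (b * τ) (G s x') y) ξ * a * τ) * (τ * ha2 + √a * √a * hτ2)
      rw [e, abs_mul, abs_of_pos (by positivity)]
      calc _ ≤ 2 / (a * τ * √a * √τ) * (K * (τ * m) *
            (gauss (4 / 5) w₁ (a * t) ξ * gauss (4 / 5) w₂ (b * t) y)) := by gcongr
        _ ≤ 2 / (a * τ * √a * √τ) * (K * (τ * m) *
            ((Real.exp (14 / (5 * a)) * gauss (7 / 10) w₁ (a * t) x) *
              gauss (7 / 10) w₂ (b * t) y)) := by gcongr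
        _ = _ := by field_simp
    · gcongr
      have : 0 ≤ 2 / √b * Real.exp (14 / (5 * b)) := by positivity
      linarith
  · have g1 := gauss_pos (7 / 10) w₁ (a * t) x
    have g2 := gauss_pos (7 / 10) w₂ (b * t) y
    simp only [hswap 0 x _ hx hy, hswap 0 x _ hx hy']
    refine (abs_sub_le_of_sqrt_deriv
      (v := fun y => kerDiff 0 ε (b * τ) (fun y' => L (fun x' => G s x' y') x) y / (a * τ))
      (fun ξ hξ => (hasDerivWithinAt_kerDiff 0 hε hς hξ (hLm x hx)).div_const _) hy hy'
      (B := K * (1 / a) * (2 / √b * Real.exp (14 / (5 * b))) * (m / √τ) *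
        (gauss (7 / 10) w₁ (a * t) x * gauss (7 / 10) w₂ (b * t) y)) fun ξ hξ hξx => ?_).trans ?_
    · have h := hprod x ξ _ _ (hL x hx) (hL1 x hx) (hP' ξ hξ)
      have hc := gauss_le_of_close (w := w₂) (x := y) (ξ := ξ) hb ht
        ((pow_le_pow_left₀ (abs_nonneg _) hξx 2).trans (hyy.trans hτt))
      have hc2 := hmono w₁ a x ha
      have g3 := gauss_pos (4 / 5) w₁ (a * t) x
      have g4 := gauss_pos (4 / 5) w₂ (b * t) ξ
      -- pull the factor out of `L` by linearity on the other side of the swap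
      have e0 : L (fun x' => √(ξ / (b * τ)) * kerDiff 1 ε (b * τ) (G s x') ξ) x =
          √(ξ / (b * τ)) * L (fun x' => kerDiff 1 ε (b * τ) (G s x') ξ) x := by
        obtain ⟨μ, ν, hμ, hν, hΛ⟩ := hL x hx
        have hb1 := bddMeas_kerDiff 1 hε hς hξ hF
        have hb2 := (hP' ξ hξ).bddMeas hς hF
        have h1 := hΛ _ hb1
        have h2 := hΛ _ hb2
        beta_reduce at h1 h2
        rw [h1, h2, integral_const_mul, integral_const_mul]
        ring
      have e : 2 * √ξ * (kerDiff (0 + 1) ε (b * τ) (fun y' => L (fun x' => G s x' y') x) ξ /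
          (b * τ) / (a * τ)) = 2 / (a * τ * √b * √τ) *
          L (fun x' => √(ξ / (b * τ)) * kerDiff 1 ε (b * τ) (G s x') ξ) x := by
        rw [e0, zero_add, ← hswap 1 x ξ hx hξ, sqrt_eq_sqrt_mul_sqrt_div (ξ := ξ) hς,
          Real.sqrt_mul hb.le]
        rw [div_div, mul_div_assoc', div_mul_eq_mul_div, div_eq_div_iff (by positivity)
          (by positivity)]
        linear_combination (2 * √(ξ / (b * τ)) *
          L (fun x' => kerDiff 1 ε (b * τ) (G s x') ξ) x * a * τ) * (τ * hb2 + √b * √b * hτ2)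
      rw [e, abs_mul, abs_of_pos (by positivity)]
      calc _ ≤ 2 / (a * τ * √b * √τ) * (K * (τ * m) *
            (gauss (4 / 5) w₁ (a * t) x * gauss (4 / 5) w₂ (b * t) ξ)) := by gcongr
        _ ≤ 2 / (a * τ * √b * √τ) * (K * (τ * m) * (gauss (7 / 10) w₁ (a * t) x *
            (Real.exp (14 / (5 * b)) * gauss (7 / 10) w₂ (b * t) y))) := by gcongr
        _ = _ := by field_simp
    · gcongr
      have : 0 ≤ 2 / √a * Real.exp (14 / (5 * a)) := by positivity
      linarith

lemma bddMeas_const_mul {f : ℝ → ℝ} (hf : BddMeas f) (r : ℝ) : BddMeas (fun x => r * f x) := by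
  obtain ⟨hm, M, hM⟩ := hf
  refine ⟨hm.const_mul r, |r| * M, fun x => ?_⟩
  rw [abs_mul]
  exact mul_le_mul_of_nonneg_left (hM x) (abs_nonneg r)

lemma kerDiff_const_mul (k : ℕ) (δ τ y r : ℝ) (f : ℝ → ℝ) :
    kerDiff k δ τ (fun x => r * f x) y = r * kerDiff k δ τ f y := by
  induction k generalizing δ with
  | zero => exact integral_const_mul r f
  | succ k ih => rw [kerDiff, kerDiff, ih, ih, mul_sub]

/-- The estimates at a fixed time for `∂ₓ` and `x ∂ₓ²` of the averages. -/
lemma exists_sliceBound {a b w₁ w₂ δ ε T : ℝ} (j : ℝ) {γ : ℝ} (ha : 0 < a) (hb : 0 < b)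
    (hw₁ : 0 < w₁) (hw₂ : 0 < w₂) (hδ : 0 ≤ δ) (hε : 0 ≤ ε) (hT : 0 < T) (hγ0 : 0 < γ)
    (hγ1 : γ < 1) :
    ∃ K : ℝ, 0 < K ∧ ∀ G, DataBound a b w₁ w₂ j γ T G → ∀ t s : ℝ, 0 < s → s < t → t ≤ T →
      SliceBound K a b w₁ w₂ (majorant j γ t s) t (t - s)
        (avgDx δ ε (a * (t - s)) (b * (t - s)) (G s)) ∧
      SliceBound K a b w₁ w₂ (majorant j γ t s) t (t - s)
        (avgDxx δ ε (a * (t - s)) (b * (t - s)) (G s)) := by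
  have hc₁ : 0 < w₁ ^ 2 / 4 := by positivity
  have hc₂ : 0 < w₂ ^ 2 / 4 := by positivity
  have hTa : 0 < a * T := by positivity
  have hTb : 0 < b * T := by positivity
  obtain ⟨C₁, h1, H1⟩ := exists_gaussFunctional_kerDiff_one hδ hc₁ hTa
  obtain ⟨C₂, h2, H2⟩ := exists_gaussFunctional_sqrt_kerDiff_two hδ hc₁ hTa
  obtain ⟨C₃, h3, H3⟩ := exists_gaussFunctional_mul_kerDiff_two hδ hc₁ hTa
  obtain ⟨C₄, h4, H4⟩ := exists_gaussFunctional_mul_kerDiff_three hδ hc₁ hTa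
  obtain ⟨C₅, h5, H5⟩ := exists_gaussFunctional_kerDiff_zero hε hc₂ hTb
  obtain ⟨C₆, h6, H6⟩ := exists_gaussFunctional_sqrt_kerDiff_one hε hc₂ hTb
  set C := C₁ + C₂ + C₃ + C₄ + C₅ + C₆ with hC
  have hC0 : 0 < C := by positivity
  obtain ⟨K, hK0, hK⟩ := exists_abs_product_le j ha hb hw₁ hw₂ hT hγ0 hγ1 hC0
  refine ⟨K * (1 / a) * (1 + 2 / √a * Real.exp (14 / (5 * a)) +
      2 / √b * Real.exp (14 / (5 * b))), ?_, fun G hG t s hs hst htT => ?_⟩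
  · have := Real.sqrt_pos.2 ha
    have := Real.sqrt_pos.2 hb
    positivity
  have hτ : 0 < t - s := by linarith
  have hσ : 0 < a * (t - s) := by positivity
  have hς : 0 < b * (t - s) := by positivity
  have hσT : a * (t - s) ≤ a * T := by gcongr; linarith
  have hςT : b * (t - s) ≤ b * T := by gcongr; linarith
  have hF := hG.bddMeas₂ ha.le hb.le (show s ∈ Ioc 0 T from ⟨hs, by linarith⟩)
  have hP : ∀ y, 0 ≤ y → GaussFunctional C (w₂ ^ 2 / 4) (b * (t - s)) y
      (fun f => kerDiff 0 ε (b * (t - s)) f y) := fun y hy =>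
    (H5 _ y hς hςT hy).mono (by linarith)
  have hP' : ∀ y, 0 ≤ y → GaussFunctional C (w₂ ^ 2 / 4) (b * (t - s)) y
      (fun f => √(y / (b * (t - s))) * kerDiff 1 ε (b * (t - s)) f y) := fun y hy =>
    (H6 _ y hς hςT hy).mono (by linarith)
  constructor
  · exact sliceBound_of_functionals ha hb hε hK0 hs hst hF
      (fun x y => hK G hG t s x y hs hst htT)
      (fun f x => kerDiff 1 δ (a * (t - s)) f x) (fun f x => kerDiff 2 δ (a * (t - s)) f x)
      (fun x hx => (H1 _ x hσ hσT hx).mono (by linarith))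
      (fun x hx c => kerDiff_succ_const 0 hδ hσ hx c)
      (fun x hx => (H2 _ x hσ hσT hx).mono (by linarith))
      (fun x hx c => kerDiff_succ_const 1 hδ hσ hx c)
      (fun f hf x hx => hasDerivWithinAt_kerDiff 1 hδ hσ hx hf)
      (fun k x y hx hy => kerDiff_swap 1 k hδ hε hσ hς hx hy hF)
      (fun x hx => bddMeas_kerDiff 1 hδ hσ hx hF.swap) hP hP'
  · have key := sliceBound_of_functionals ha hb hε hK0 hs hst hF
      (fun x y => hK G hG t s x y hs hst htT)
      (fun f x => x / (a * (t - s)) * kerDiff 2 δ (a * (t - s)) f x)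
      (fun f x => kerDiff 2 δ (a * (t - s)) f x +
        x / (a * (t - s)) * kerDiff 3 δ (a * (t - s)) f x)
      (fun x hx => (H3 _ x hσ hσT hx).mono (by linarith))
      (fun x hx c => by rw [kerDiff_succ_const 1 hδ hσ hx c, mul_zero])
      (fun x hx => (((H2 _ x hσ hσT hx).add (H4 _ x hσ hσT hx) hσ h2.le h4.le).mono
        (by linarith)).congr fun f hf => by ring)
      (fun x hx c => by rw [kerDiff_succ_const 1 hδ hσ hx c, kerDiff_succ_const 2 hδ hσ hx c]; ring)
      (fun f hf x hx => by
        refine (((hasDerivAt_id x).div_const (a * (t - s))).hasDerivWithinAt.mul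
          (hasDerivWithinAt_kerDiff 2 hδ hσ hx hf)).congr_deriv ?_
        simp only [id]
        ring)
      (fun k x y hx hy => by
        rw [kerDiff_const_mul, kerDiff_swap 2 k hδ hε hσ hς hx hy hF])
      (fun x hx => bddMeas_const_mul (bddMeas_kerDiff 2 hδ hσ hx hF.swap) _) hP hP'
    convert key using 1
    funext x y
    unfold avgDxx
    field_simp

/-- Boundedness of the averages themselves, integrable in `s` up to `s = 0`. -/
lemma exists_abs_average_le {a b w₁ w₂ δ ε T : ℝ} (ha : 0 < a) (hb : 0 < b)
    (hw₁ : 0 < w₁) (hw₂ : 0 < w₂) (hδ : 0 ≤ δ) (hε : 0 ≤ ε) (hT : 0 < T) :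
    ∃ K : ℝ, 0 < K ∧ ∀ t s x y A : ℝ, 0 < s → s < t → t ≤ T → 0 ≤ x → 0 ≤ y → 0 ≤ A →
      ∀ F, BddMeas₂ F →
      (∀ x y, |F x y| ≤ A * (gauss 1 w₁ (a * s) x * gauss 1 w₂ (b * s) y)) →
      |kerDiff 0 δ (a * (t - s)) (fun x' => kerDiff 0 ε (b * (t - s)) (F x') y) x| ≤
        K * (A * s) / t := by
  have hc₁ : 0 < w₁ ^ 2 / 4 := by positivity
  have hc₂ : 0 < w₂ ^ 2 / 4 := by positivity
  have hTa : 0 < a * T := by positivity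
  have hTb : 0 < b * T := by positivity
  obtain ⟨C₁, h1, H1⟩ := exists_gaussFunctional_kerDiff_zero hδ hc₁ hTa
  obtain ⟨C₅, h5, H5⟩ := exists_gaussFunctional_kerDiff_zero hε hc₂ hTb
  set C := C₁ + C₅ with hC
  have hC0 : 0 < C := by positivity
  obtain ⟨K, hK0, hK⟩ := exists_abs_product_le_of_concentrated ha hb hw₁ hw₂ hT hC0
  refine ⟨2 * K + 2, by positivity, fun t s x y A hs hst htT hx hy hA F hF hFb => ?_⟩
  have hτ : 0 < t - s := by linarith
  have ht : 0 < t := by linarith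
  have hσ : 0 < a * (t - s) := by positivity
  have hς : 0 < b * (t - s) := by positivity
  have hσT : a * (t - s) ≤ a * T := by gcongr; linarith
  have hςT : b * (t - s) ≤ b * T := by gcongr; linarith
  rcases lt_or_ge s (t / 2) with hcase | hcase
  · have h := hK t s x y A hs hst htT hA F hF hFb _ _ ((H1 _ x hσ hσT hx).mono (by linarith))
      ((H5 _ y hς hςT hy).mono (by linarith))
    refine h.trans ?_
    have g1 : gauss (4 / 5) w₁ (a * t) x ≤ 1 := gauss_le_one (by norm_num) (by positivity)
    have g2 : gauss (4 / 5) w₂ (b * t) y ≤ 1 := gauss_le_one (by norm_num) (by positivity)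
    have g3 := gauss_pos (4 / 5) w₂ (b * t) y
    have h2 : s / (t - s) ≤ 2 * s / t := by
      rw [div_le_div_iff₀ hτ ht]; nlinarith
    have hs0 : 0 ≤ s / (t - s) := by positivity
    calc _ ≤ K * (A * (s / (t - s))) * 1 := by
          gcongr
          exact mul_le_one₀ g1 g3.le g2
      _ ≤ K * (A * (2 * s / t)) * 1 := by gcongr
      _ = 2 * K * (A * s) / t := by ring
      _ ≤ _ := by gcongr; linarith
  · have hp1 := isProbabilityMeasure_kernel₁ hδ hσ hx
    have hp2 := isProbabilityMeasure_kernel₁ hε hς hy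
    have hFA : ∀ x y, |F x y| ≤ A := fun x y => (hFb x y).trans
      (mul_le_of_le_one_right hA (mul_le_one₀ (gauss_le_one (by norm_num) (by positivity))
        (gauss_pos _ _ _ _).le (gauss_le_one (by norm_num) (by positivity))))
    have h1 : ∀ x', |kerDiff 0 ε (b * (t - s)) (F x') y| ≤ A := fun x' => by
      have h := norm_integral_le_of_norm_le_const (μ := kernel₁ ε (b * (t - s)) y) (f := F x')
        (Filter.Eventually.of_forall (hFA x'))
      simpa [kerDiff] using h
    have h2 : |kerDiff 0 δ (a * (t - s)) (fun x' => kerDiff 0 ε (b * (t - s)) (F x') y) x| ≤ A := by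
      have h := norm_integral_le_of_norm_le_const (μ := kernel₁ δ (a * (t - s)) x)
        (f := fun x' => kerDiff 0 ε (b * (t - s)) (F x') y) (Filter.Eventually.of_forall h1)
      simpa [kerDiff] using h
    refine h2.trans ?_
    rw [le_div_iff₀ ht]
    nlinarith [mul_le_mul_of_nonneg_left hcase hA, mul_nonneg hK0.le (mul_nonneg hA hs.le)]

/-! ### Integration in time -/

lemma measurable_poi (m : ℕ) : Measurable (fun z => poi z m) := by
  unfold poi; fun_prop

lemma measurable_gammaLaw {k : ℝ} : Measurable (fun τ => gammaLaw k τ) := by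
  by_cases hk : k = 0
  · simp only [gammaLaw, hk, if_true]
    exact measurable_const
  · refine Measure.measurable_of_measurable_coe _ fun s hs => ?_
    simp only [gammaLaw, hk, if_false]
    have e : ∀ τ, (volume.restrict (Ioi 0)).withDensity
        (fun x => ENNReal.ofReal (gammaDensity k τ x)) s =
        ∫⁻ x in s, ENNReal.ofReal (gammaDensity k τ x) ∂(volume.restrict (Ioi 0)) :=
      fun τ => withDensity_apply _ hs
    simp only [e]
    exact Measurable.lintegral_prod_right' (f := fun p : ℝ × ℝ =>
      ENNReal.ofReal (gammaDensity k p.1 p.2)) (measurable_gammaDensity k).ennreal_ofReal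

lemma measurable_poiGamma {α : Type*} [MeasurableSpace α] {δ : ℝ} {τ z : α → ℝ}
    (hτ : Measurable τ) (hz : Measurable z) :
    Measurable (fun s => poiGamma δ (τ s) (z s) (fun _ => 1)) := by
  refine Measure.measurable_of_measurable_coe _ fun A hA => ?_
  unfold poiGamma
  simp only [Measure.sum_apply _ hA, Measure.smul_apply, smul_eq_mul]
  refine Measurable.tsum fun m => ?_
  refine Measurable.mul ?_ ?_
  · exact (((measurable_poi m).comp hz).mul measurable_const).ennreal_ofReal
  · exact (Measure.measurable_coe hA).comp (measurable_gammaLaw.comp hτ)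

/-- The kernel at the time `a (t - s)`, as a Markov kernel in `s < t`. -/
def timeKernel (δ a t x : ℝ) : ProbabilityTheory.Kernel ℝ ℝ where
  toFun s := if 0 < a * (t - s) then poiGamma δ (a * (t - s)) (x / (a * (t - s))) (fun _ => 1)
    else 0
  measurable' := Measurable.ite (measurableSet_lt measurable_const (by fun_prop))
    (measurable_poiGamma (by fun_prop) (by fun_prop)) measurable_const

lemma timeKernel_apply {δ a t x s : ℝ} (hδ : 0 ≤ δ) (hx : 0 ≤ x) (h : 0 < a * (t - s)) :
    timeKernel δ a t x s = kernel₁ δ (a * (t - s)) x := by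
  rw [kernel₁_eq_poiGamma hδ h hx]
  exact if_pos h

lemma isFiniteKernel_timeKernel {δ a t x : ℝ} (hδ : 0 ≤ δ) (hx : 0 ≤ x) :
    ProbabilityTheory.IsFiniteKernel (timeKernel δ a t x) := by
  refine ⟨1, by norm_num, fun s => ?_⟩
  by_cases h : 0 < a * (t - s)
  · have := isProbabilityMeasure_kernel₁ hδ h hx
    rw [timeKernel_apply hδ hx h]
    exact prob_le_one
  · have : timeKernel δ a t x s = 0 := if_neg h
    simp [this]

lemma aestronglyMeasurable_kerDiff (k l : ℕ) {a b δ ε t x y : ℝ} (ha : 0 < a) (hb : 0 < b)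
    (hδ : 0 ≤ δ) (hε : 0 ≤ ε) (hx : 0 ≤ x) (hy : 0 ≤ y) {G : ℝ → ℝ → ℝ → ℝ}
    (hG : Measurable (fun p : ℝ × ℝ × ℝ => G p.1 p.2.1 p.2.2))
    (hGb : ∀ s ∈ Ioo 0 t, BddMeas₂ (G s)) :
    AEStronglyMeasurable (fun s => kerDiff k δ (a * (t - s))
      (fun x' => kerDiff l ε (b * (t - s)) (G s x') y) x) (volume.restrict (Ioo 0 t)) := by
  induction k generalizing δ with
  | zero =>
    induction l generalizing ε with
    | zero =>
      have := isFiniteKernel_timeKernel (a := a) (t := t) hδ hx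
      have := isFiniteKernel_timeKernel (a := b) (t := t) hε hy
      set κ : ProbabilityTheory.Kernel (ℝ × ℝ) ℝ :=
        (timeKernel ε b t y).comap Prod.fst measurable_fst with hκ
      have h1 : StronglyMeasurable (fun p : ℝ × ℝ => ∫ y', G p.1 p.2 y' ∂κ p) :=
        StronglyMeasurable.integral_kernel_prod_right' (κ := κ)
          (f := fun q : (ℝ × ℝ) × ℝ => G q.1.1 q.1.2 q.2)
          (hG.comp (by fun_prop : Measurable fun q : (ℝ × ℝ) × ℝ =>
            (q.1.1, q.1.2, q.2))).stronglyMeasurable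
      have h2 := h1.integral_kernel_prod_right' (κ := timeKernel δ a t x)
      refine h2.aestronglyMeasurable.congr ?_
      refine (ae_restrict_mem measurableSet_Ioo).mono fun s hs => ?_
      have hτ : 0 < t - s := by linarith [hs.2]
      have e : ∀ x', κ (s, x') = kernel₁ ε (b * (t - s)) y := fun x' =>
        timeKernel_apply hε hy (by positivity)
      simp only [kerDiff, e, timeKernel_apply hδ hx (show 0 < a * (t - s) by positivity)]
    | succ l ih =>
      refine ((ih (ε := ε + 1) (by linarith)).sub (ih hε)).congr ?_
      refine (ae_restrict_mem measurableSet_Ioo).mono fun s hs => ?_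
      have hτ : 0 < t - s := by linarith [hs.2]
      have hς : 0 < b * (t - s) := by positivity
      exact (kerDiff_sub 0 hδ (show 0 < a * (t - s) by positivity) hx
        (bddMeas_kerDiff l (show 0 ≤ ε + 1 by linarith) hς hy (hGb s hs))
        (bddMeas_kerDiff l hε hς hy (hGb s hs))).symm
  | succ k ih => exact (ih (by linarith)).sub (ih hδ)

/-- Differentiation under the integral sign on a convex set, possibly at a boundary point. -/
lemma hasDerivWithinAt_integral_of_dominated {α : Type*} [MeasurableSpace α] {μ : Measure α}
    {S : Set ℝ} (hS : Convex ℝ S) {F F' : ℝ → α → ℝ} {bound : α → ℝ} {x : ℝ} (hx : x ∈ S)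
    (hF : ∀ y ∈ S, Integrable (F y) μ) (hb : Integrable bound μ)
    (hd : ∀ᵐ s ∂μ, ∀ y ∈ S, HasDerivWithinAt (fun y => F y s) (F' y s) S y)
    (hle : ∀ᵐ s ∂μ, ∀ y ∈ S, |F' y s| ≤ bound s) :
    HasDerivWithinAt (fun y => ∫ s, F y s ∂μ) (∫ s, F' x s ∂μ) S x := by
  rw [hasDerivWithinAt_iff_tendsto_slope]
  have hmem : ∀ᶠ y in nhdsWithin x (S \ {x}), y ∈ S \ {x} := self_mem_nhdsWithin
  have e : (slope (fun y => ∫ s, F y s ∂μ) x) =ᶠ[nhdsWithin x (S \ {x})]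
      fun y => ∫ s, slope (fun y => F y s) x y ∂μ := by
    filter_upwards [hmem] with y hy
    simp only [slope_def_field]
    rw [integral_div, integral_sub (hF y hy.1) (hF x hx)]
  refine Filter.Tendsto.congr' e.symm ?_
  refine tendsto_integral_filter_of_dominated_convergence bound ?_ ?_ hb ?_
  · filter_upwards [hmem] with y hy
    simp only [slope_def_field]
    exact (((hF y hy.1).sub (hF x hx)).div_const _).aestronglyMeasurable
  · filter_upwards [hmem] with y hy
    filter_upwards [hd, hle] with s hs1 hs2
    have h := hS.norm_image_sub_le_of_norm_hasDerivWithin_le (f := fun y => F y s) hs1 hs2 hx hy.1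
    have hne : 0 < ‖y - x‖ := norm_pos_iff.2 (sub_ne_zero.2 hy.2)
    rw [slope_def_field, norm_div, div_le_iff₀ hne]
    exact h
  · filter_upwards [hd] with s hs
    exact hasDerivWithinAt_iff_tendsto_slope.1 (hs x hx)

lemma integrableOn_rpow_Ioo {p t : ℝ} (hp : -1 < p) (ht : 0 < t) :
    IntegrableOn (fun s : ℝ => s ^ p) (Ioo 0 t) ∧
      ∫ s in Ioo 0 t, s ^ p = t ^ (p + 1) / (p + 1) := by
  have h1 := intervalIntegral.intervalIntegrable_rpow' (a := 0) (b := t) hp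
  have h2 := integral_rpow (a := 0) (b := t) (Or.inl hp)
  rw [intervalIntegrable_iff_integrableOn_Ioo_of_le ht.le] at h1
  rw [intervalIntegral.integral_of_le ht.le, integral_Ioc_eq_integral_Ioo,
    Real.zero_rpow (by linarith), sub_zero] at h2
  exact ⟨h1, h2⟩

/-- Reflection `s ↦ t - s` of an integral over `(0, t)`. -/
lemma integral_reflect {f : ℝ → ℝ} {t : ℝ} (ht : 0 < t) (hf : IntegrableOn f (Ioo 0 t)) :
    IntegrableOn (fun s => f (t - s)) (Ioo 0 t) ∧
      ∫ s in Ioo 0 t, f (t - s) = ∫ s in Ioo 0 t, f s := by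
  constructor
  · have h := (intervalIntegrable_iff_integrableOn_Ioo_of_le ht.le).2 hf
    have h2 := (h.comp_sub_left t).symm
    rw [sub_self, sub_zero, intervalIntegrable_iff_integrableOn_Ioo_of_le ht.le] at h2
    exact h2
  · rw [← integral_Ioc_eq_integral_Ioo, ← integral_Ioc_eq_integral_Ioo,
      ← intervalIntegral.integral_of_le ht.le, ← intervalIntegral.integral_of_le ht.le,
      intervalIntegral.integral_comp_sub_left]
    simp

lemma exists_integral_majorant_le {j γ : ℝ} (hj : j < 2) (hγ0 : 0 < γ) :
    ∃ K : ℝ, 0 < K ∧ ∀ t : ℝ, 0 < t → IntegrableOn (majorant j γ t) (Ioo 0 t) ∧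
      ∫ s in Ioo 0 t, majorant j γ t s ≤ K * t ^ (-j) := by
  refine ⟨1 / (2 - j) + 2 / γ, by have : 0 < 2 - j := by linarith
                                  positivity, fun t ht => ?_⟩
  obtain ⟨i1, e1⟩ := integrableOn_rpow_Ioo (p := 1 - j) (by linarith) ht
  obtain ⟨i2, e2⟩ := integrableOn_rpow_Ioo (p := γ / 2 - 1) (by linarith) ht
  obtain ⟨i3, e3⟩ := integral_reflect ht i2
  have i1' := i1.mul_const (t ^ (-2 : ℝ))
  have i3' := i3.const_mul (t ^ (-(j + γ / 2)))
  have hle : ∀ s ∈ Ioo 0 t, majorant j γ t s ≤ s ^ (1 - j) * t ^ (-2 : ℝ) +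
      t ^ (-(j + γ / 2)) * (t - s) ^ (γ / 2 - 1) := by
    intro s hs
    have h1 : 0 < s := hs.1
    have h2 : 0 < t - s := by linarith [hs.2]
    have h3 : 0 ≤ s ^ (1 - j) * t ^ (-2 : ℝ) := by positivity
    have h4 : 0 ≤ t ^ (-(j + γ / 2)) * (t - s) ^ (γ / 2 - 1) := by positivity
    unfold majorant
    split_ifs <;> linarith
  have hmeas : Measurable (majorant j γ t) := by
    unfold majorant
    exact Measurable.ite measurableSet_Iio (by fun_prop) (by fun_prop)
  have hint : IntegrableOn (majorant j γ t) (Ioo 0 t) := by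
    refine Integrable.mono' (i1'.add i3') hmeas.aestronglyMeasurable ?_
    refine (ae_restrict_mem measurableSet_Ioo).mono fun s hs => ?_
    rw [Real.norm_eq_abs, abs_of_nonneg (majorant_nonneg hs.1 hs.2)]
    exact hle s hs
  refine ⟨hint, ?_⟩
  refine (setIntegral_mono_on hint (i1'.add i3') measurableSet_Ioo hle).trans (le_of_eq ?_)
  rw [integral_add' i1' i3', integral_mul_const, integral_const_mul, e3, e1, e2]
  have f1 : t ^ (1 - j + 1) * t ^ (-2 : ℝ) = t ^ (-j) := by
    rw [← Real.rpow_add ht]; congr 1; ring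
  have f2 : t ^ (-(j + γ / 2)) * t ^ (γ / 2 - 1 + 1) = t ^ (-j) := by
    rw [← Real.rpow_add ht]; congr 1; ring
  have h2j : 1 - j + 1 ≠ 0 := by linarith
  have h2j' : 2 - j ≠ 0 := by linarith
  calc _ = (t ^ (1 - j + 1) * t ^ (-2 : ℝ)) / (1 - j + 1) +
        (t ^ (-(j + γ / 2)) * t ^ (γ / 2 - 1 + 1)) / (γ / 2 - 1 + 1) := by ring
    _ = _ := by
      rw [f1, f2, show 1 - j + 1 = 2 - j by ring, show γ / 2 - 1 + 1 = γ / 2 by ring]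
      field_simp

/-- The singular integral behind the Hölder estimate: near the singularity one uses the bound
`1`, away from it the bound `D / √τ`. -/
lemma integral_min_le {γ D t : ℝ} (hγ0 : 0 < γ) (hγ1 : γ < 1) (hD : 0 < D) :
    IntegrableOn (fun τ : ℝ => τ ^ (γ / 2 - 1) * min 1 (D / √τ)) (Ioo 0 t) ∧
      ∫ τ in Ioo 0 t, τ ^ (γ / 2 - 1) * min 1 (D / √τ) ≤ (2 / γ + 2 / (1 - γ)) * D ^ γ := by
  have hD2 : 0 < D ^ 2 := by positivity
  have hmeas : Measurable (fun τ : ℝ => τ ^ (γ / 2 - 1) * min 1 (D / √τ)) := by fun_prop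
  obtain ⟨i1, e1⟩ := integrableOn_rpow_Ioo (p := γ / 2 - 1) (by linarith) hD2
  have i2 := (integrableOn_Ioi_rpow_of_lt (a := γ / 2 - 3 / 2) (c := D ^ 2) (by linarith) hD2).const_mul D
  have e2 := integral_Ioi_rpow_of_lt (a := γ / 2 - 3 / 2) (c := D ^ 2) (by linarith) hD2
  have hnn : ∀ τ : ℝ, 0 < τ → 0 ≤ τ ^ (γ / 2 - 1) * min 1 (D / √τ) := fun τ hτ => by positivity
  have hle1 : ∀ τ ∈ Ioo 0 (D ^ 2), τ ^ (γ / 2 - 1) * min 1 (D / √τ) ≤ τ ^ (γ / 2 - 1) :=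
    fun τ hτ => mul_le_of_le_one_right (Real.rpow_nonneg hτ.1.le _) (min_le_left _ _)
  have hle2 : ∀ τ ∈ Ioi (D ^ 2), τ ^ (γ / 2 - 1) * min 1 (D / √τ) ≤ D * τ ^ (γ / 2 - 3 / 2) := by
    intro τ hτ
    have hτ0 : 0 < τ := hD2.trans hτ
    calc _ ≤ τ ^ (γ / 2 - 1) * (D / √τ) := by
          gcongr; exact min_le_right _ _
      _ = D * (τ ^ (γ / 2 - 1) / τ ^ (1 / 2 : ℝ)) := by rw [Real.sqrt_eq_rpow]; ring
      _ = _ := by rw [← Real.rpow_sub hτ0]; congr 2; ring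
  have I1 : IntegrableOn (fun τ : ℝ => τ ^ (γ / 2 - 1) * min 1 (D / √τ)) (Ioo 0 (D ^ 2)) := by
    refine Integrable.mono' i1 hmeas.aestronglyMeasurable ?_
    refine (ae_restrict_mem measurableSet_Ioo).mono fun τ hτ => ?_
    rw [Real.norm_eq_abs, abs_of_nonneg (hnn τ hτ.1)]
    exact hle1 τ hτ
  have I1' : IntegrableOn (fun τ : ℝ => τ ^ (γ / 2 - 1) * min 1 (D / √τ)) (Ioc 0 (D ^ 2)) :=
    (integrableOn_Ioc_iff_integrableOn_Ioo).2 I1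
  have I2 : IntegrableOn (fun τ : ℝ => τ ^ (γ / 2 - 1) * min 1 (D / √τ)) (Ioi (D ^ 2)) := by
    refine Integrable.mono' i2 hmeas.aestronglyMeasurable ?_
    refine (ae_restrict_mem measurableSet_Ioi).mono fun τ hτ => ?_
    rw [Real.norm_eq_abs, abs_of_nonneg (hnn τ (hD2.trans hτ))]
    exact hle2 τ hτ
  have I : IntegrableOn (fun τ : ℝ => τ ^ (γ / 2 - 1) * min 1 (D / √τ)) (Ioi 0) := by
    rw [← Ioc_union_Ioi_eq_Ioi hD2.le]
    exact I1'.union I2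
  refine ⟨I.mono_set Ioo_subset_Ioi_self, ?_⟩
  calc _ ≤ ∫ τ in Ioi 0, τ ^ (γ / 2 - 1) * min 1 (D / √τ) := by
        refine setIntegral_mono_set I ?_ Ioo_subset_Ioi_self.eventuallyLE
        exact (ae_restrict_mem measurableSet_Ioi).mono fun τ hτ => hnn τ hτ
    _ = (∫ τ in Ioo 0 (D ^ 2), τ ^ (γ / 2 - 1) * min 1 (D / √τ)) +
        ∫ τ in Ioi (D ^ 2), τ ^ (γ / 2 - 1) * min 1 (D / √τ) := by
        rw [← Ioc_union_Ioi_eq_Ioi hD2.le, setIntegral_union (Ioc_disjoint_Ioi le_rfl)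
          measurableSet_Ioi I1' I2, integral_Ioc_eq_integral_Ioo]
    _ ≤ (∫ τ in Ioo 0 (D ^ 2), τ ^ (γ / 2 - 1)) + ∫ τ in Ioi (D ^ 2), D * τ ^ (γ / 2 - 3 / 2) :=
        add_le_add (setIntegral_mono_on I1 i1 measurableSet_Ioo hle1)
          (setIntegral_mono_on I2 i2 measurableSet_Ioi hle2)
    _ = _ := by
        rw [integral_const_mul, e1, e2]
        have f1 : (D ^ 2) ^ (γ / 2 - 1 + 1) = D ^ γ := by
          rw [← Real.rpow_natCast, ← Real.rpow_mul hD.le]; congr 1; push_cast; ring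
        have f2 : D * (D ^ 2) ^ (γ / 2 - 3 / 2 + 1) = D ^ γ := by
          rw [← Real.rpow_natCast, ← Real.rpow_mul hD.le, ← Real.rpow_one_add' hD.le]
          · congr 1; push_cast; ring
          · push_cast; intro h; linarith
        have h1 : 1 - γ ≠ 0 := by linarith
        rw [f1, show D * (-(D ^ 2) ^ (γ / 2 - 3 / 2 + 1) / (γ / 2 - 3 / 2 + 1)) =
          -(D * (D ^ 2) ^ (γ / 2 - 3 / 2 + 1)) / (γ / 2 - 3 / 2 + 1) by ring, f2,
          show γ / 2 - 1 + 1 = γ / 2 by ring,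
          show γ / 2 - 3 / 2 + 1 = -((1 - γ) / 2) by ring]
        field_simp

lemma exists_integral_majorant_min_le {j γ : ℝ} (hj : j < 2) (hγ0 : 0 < γ) (hγ1 : γ < 1) :
    ∃ K : ℝ, 0 < K ∧ ∀ t D : ℝ, 0 < t → 0 < D →
      IntegrableOn (fun s => majorant j γ t s * min 1 (D / √(t - s))) (Ioo 0 t) ∧
      ∫ s in Ioo 0 t, majorant j γ t s * min 1 (D / √(t - s)) ≤ K * t ^ (-(j + γ / 2)) * D ^ γ := by
  have h2j : 0 < 2 - j := by linarith
  have h1γ : 0 < 1 - γ := by linarith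
  refine ⟨2 ^ (γ / 2) / (2 - j) + (2 / γ + 2 / (1 - γ)), by positivity, fun t D ht hD => ?_⟩
  obtain ⟨i1, e1⟩ := integrableOn_rpow_Ioo (p := 1 - j) (by linarith) ht
  obtain ⟨i2, e2⟩ := integral_min_le (t := t) hγ0 hγ1 hD
  obtain ⟨i3, e3⟩ := integral_reflect ht i2
  have i1' := i1.mul_const (t ^ (-2 : ℝ) * (D ^ γ * (t / 2) ^ (-(γ / 2))))
  have i3' := i3.const_mul (t ^ (-(j + γ / 2)))
  have hle : ∀ s ∈ Ioo 0 t, majorant j γ t s * min 1 (D / √(t - s)) ≤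
      s ^ (1 - j) * (t ^ (-2 : ℝ) * (D ^ γ * (t / 2) ^ (-(γ / 2)))) +
      t ^ (-(j + γ / 2)) * ((t - s) ^ (γ / 2 - 1) * min 1 (D / √(t - s))) := by
    intro s hs
    have h1 : 0 < s := hs.1
    have h2 : 0 < t - s := by linarith [hs.2]
    have hsq : 0 < √(t - s) := Real.sqrt_pos.2 h2
    have h3 : 0 ≤ s ^ (1 - j) * (t ^ (-2 : ℝ) * (D ^ γ * (t / 2) ^ (-(γ / 2)))) := by positivity
    have h4 : 0 ≤ t ^ (-(j + γ / 2)) * ((t - s) ^ (γ / 2 - 1) * min 1 (D / √(t - s))) := by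
      positivity
    unfold majorant
    split_ifs with hc
    · refine le_trans ?_ (le_add_of_nonneg_right h4)
      rw [mul_assoc]
      gcongr
      have hq : 0 ≤ D / √(t - s) := by positivity
      calc min 1 (D / √(t - s)) ≤ (D / √(t - s)) ^ γ := by
            rcases le_total (D / √(t - s)) 1 with h | h
            · rw [min_eq_right h]
              calc D / √(t - s) = (D / √(t - s)) ^ (1 : ℝ) := (Real.rpow_one _).symm
                _ ≤ _ := Real.rpow_le_rpow_of_exponent_ge' hq h hγ0.le hγ1.le
            · rw [min_eq_left h]
              exact Real.one_le_rpow h hγ0.le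
        _ = D ^ γ * (t - s) ^ (-(γ / 2)) := by
            rw [Real.div_rpow hD.le hsq.le, Real.sqrt_eq_rpow, ← Real.rpow_mul h2.le,
              Real.rpow_neg h2.le, div_eq_mul_inv]
            congr 3; ring
        _ ≤ _ := by
            refine mul_le_mul_of_nonneg_left ?_ (by positivity)
            exact Real.rpow_le_rpow_of_nonpos (by linarith) (by linarith) (by linarith)
    · rw [mul_assoc]
      linarith
  have hmeas : Measurable (fun s => majorant j γ t s * min 1 (D / √(t - s))) := by
    refine Measurable.mul ?_ (by fun_prop)
    unfold majorant
    exact Measurable.ite measurableSet_Iio (by fun_prop) (by fun_prop)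
  have hint : IntegrableOn (fun s => majorant j γ t s * min 1 (D / √(t - s))) (Ioo 0 t) := by
    refine Integrable.mono' (i1'.add i3') hmeas.aestronglyMeasurable ?_
    refine (ae_restrict_mem measurableSet_Ioo).mono fun s hs => ?_
    rw [Real.norm_eq_abs, abs_of_nonneg (mul_nonneg (majorant_nonneg hs.1 hs.2) (by positivity))]
    exact hle s hs
  refine ⟨hint, ?_⟩
  refine (setIntegral_mono_on hint (i1'.add i3') measurableSet_Ioo hle).trans ?_
  rw [integral_add' i1' i3', integral_mul_const, integral_const_mul, e3, e1]
  have f1 : t ^ (1 - j + 1) * t ^ (-2 : ℝ) * t ^ (-(γ / 2)) = t ^ (-(j + γ / 2)) := by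
    rw [← Real.rpow_add ht, ← Real.rpow_add ht]; congr 1; ring
  have f2 : (t / 2) ^ (-(γ / 2)) = 2 ^ (γ / 2) * t ^ (-(γ / 2)) := by
    rw [Real.div_rpow ht.le zero_le_two, Real.rpow_neg zero_le_two, div_inv_eq_mul, mul_comm]
  have htp : 0 < t ^ (-(j + γ / 2)) := Real.rpow_pos_of_pos ht _
  calc _ ≤ t ^ (1 - j + 1) / (1 - j + 1) * (t ^ (-2 : ℝ) * (D ^ γ * (t / 2) ^ (-(γ / 2)))) +
        t ^ (-(j + γ / 2)) * ((2 / γ + 2 / (1 - γ)) * D ^ γ) := by gcongr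
    _ = (t ^ (1 - j + 1) * t ^ (-2 : ℝ) * t ^ (-(γ / 2))) * D ^ γ * 2 ^ (γ / 2) / (2 - j) +
        t ^ (-(j + γ / 2)) * ((2 / γ + 2 / (1 - γ)) * D ^ γ) := by
        rw [f2, show 1 - j + 1 = 2 - j by ring]; ring
    _ = _ := by rw [f1]; ring

/-! ### Derivatives of the solution operator of the model problem -/

/-- Gaussian and Hölder bounds for a function on the quadrant, with the singular weights in `t`
that result from integrating `SliceBound`s over `(0, t)`. -/
structure TimeBound (C a b w₁ w₂ j γ t : ℝ) (u : ℝ → ℝ → ℝ) : Prop where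
  bound : ∀ x y, 0 ≤ x → 0 ≤ y →
    |u x y| ≤ C * t ^ (-j) * (gauss (4 / 5) w₁ (a * t) x * gauss (4 / 5) w₂ (b * t) y)
  holder_fst : ∀ x x' y, 0 ≤ x → 0 ≤ x' → 0 ≤ y → |u x y - u x' y| ≤
    C * t ^ (-(j + γ / 2)) * |√x - √x'| ^ γ *
      (gauss (7 / 10) w₁ (a * t) x * gauss (7 / 10) w₂ (b * t) y +
        gauss (7 / 10) w₁ (a * t) x' * gauss (7 / 10) w₂ (b * t) y)
  holder_snd : ∀ x y y', 0 ≤ x → 0 ≤ y → 0 ≤ y' → |u x y - u x y'| ≤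
    C * t ^ (-(j + γ / 2)) * |√y - √y'| ^ γ *
      (gauss (7 / 10) w₁ (a * t) x * gauss (7 / 10) w₂ (b * t) y +
        gauss (7 / 10) w₁ (a * t) x * gauss (7 / 10) w₂ (b * t) y')

lemma TimeBound.mono {C C' a b w₁ w₂ j γ t : ℝ} {u : ℝ → ℝ → ℝ} (ht : 0 < t)
    (h : TimeBound C a b w₁ w₂ j γ t u) (hC : C ≤ C') : TimeBound C' a b w₁ w₂ j γ t u := by
  have g := gauss_pos
  refine ⟨fun x y hx hy => (h.bound x y hx hy).trans ?_,
    fun x x' y hx hx' hy => (h.holder_fst x x' y hx hx' hy).trans ?_,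
    fun x y y' hx hy hy' => (h.holder_snd x y y' hx hy hy').trans ?_⟩
  · have := g (4 / 5) w₁ (a * t) x
    have := g (4 / 5) w₂ (b * t) y
    gcongr
  · have := g (7 / 10) w₁ (a * t) x
    have := g (7 / 10) w₁ (a * t) x'
    have := g (7 / 10) w₂ (b * t) y
    gcongr
  · have := g (7 / 10) w₁ (a * t) x
    have := g (7 / 10) w₂ (b * t) y
    have := g (7 / 10) w₂ (b * t) y'
    gcongr

lemma TimeBound.swap {C a b w₁ w₂ j γ t : ℝ} {u : ℝ → ℝ → ℝ}
    (h : TimeBound C a b w₁ w₂ j γ t u) :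
    TimeBound C b a w₂ w₁ j γ t (fun y x => u x y) := by
  refine ⟨fun y x hy hx => (h.bound x y hx hy).trans (le_of_eq (by ring)),
    fun y y' x hy hy' hx => (h.holder_snd x y y' hx hy hy').trans (le_of_eq (by ring)),
    fun y x x' hy hx hx' => (h.holder_fst x x' y hx hx' hy).trans (le_of_eq (by ring))⟩

/-- Increments at distance `D` for a slice at time `t - s = τ`: if `D² ≤ τ` use the Lipschitz
estimate, otherwise the bounds of the two values. -/
lemma abs_sub_le_mul_min {u u' K m D τ e₁ e₁' e₂ E : ℝ} (hK : 0 ≤ K) (hm : 0 ≤ m) (hD : 0 < D)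
    (hτ : 0 < τ) (h1 : |u| ≤ K * m * e₁) (h1' : |u'| ≤ K * m * e₁')
    (h2 : D ^ 2 ≤ τ → |u - u'| ≤ K * (m / √τ) * e₂ * D) (hE₁ : e₁ + e₁' ≤ E) (hE₂ : e₂ ≤ E) :
    |u - u'| ≤ K * E * (m * min 1 (D / √τ)) := by
  have hsτ : 0 < √τ := Real.sqrt_pos.2 hτ
  rcases le_total (D ^ 2) τ with h | h
  · have h3 : D / √τ ≤ 1 := (div_le_one hsτ).2 (Real.le_sqrt_of_sq_le h)
    rw [min_eq_right h3]
    calc _ ≤ K * (m / √τ) * e₂ * D := h2 h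
      _ ≤ K * (m / √τ) * E * D := by gcongr
      _ = _ := by ring
  · have h3 : 1 ≤ D / √τ := (one_le_div hsτ).2 (Real.sqrt_le_iff.2 ⟨hD.le, h⟩)
    rw [min_eq_left h3, mul_one]
    calc _ ≤ |u| + |u'| := abs_sub _ _
      _ ≤ K * m * (e₁ + e₁') := by linarith
      _ ≤ K * m * E := by gcongr
      _ = _ := by ring

/-- Integration of the slice estimates over `s ∈ (0, t)`. -/
lemma exists_timeBound_integral {a b j γ K : ℝ} (w₁ w₂ : ℝ) (ha : 0 < a) (hb : 0 < b)
    (hj : j < 2) (hγ0 : 0 < γ) (hγ1 : γ < 1) (hK : 0 < K) :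
    ∃ C : ℝ, 0 < C ∧ ∀ t : ℝ, 0 < t → ∀ v : ℝ → ℝ → ℝ → ℝ,
      (∀ s ∈ Ioo 0 t, SliceBound K a b w₁ w₂ (majorant j γ t s) t (t - s) (v s)) →
      (∀ x y, 0 ≤ x → 0 ≤ y →
        AEStronglyMeasurable (fun s => v s x y) (volume.restrict (Ioo 0 t))) →
      (∀ x y, 0 ≤ x → 0 ≤ y → IntegrableOn (fun s => v s x y) (Ioo 0 t)) ∧
      TimeBound C a b w₁ w₂ j γ t (fun x y => ∫ s in Ioo 0 t, v s x y) := by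
  obtain ⟨C₁, h1, H1⟩ := exists_integral_majorant_le hj hγ0
  obtain ⟨C₂, h2, H2⟩ := exists_integral_majorant_min_le hj hγ0 hγ1
  refine ⟨K * C₁ + K * C₂, by positivity, fun t ht v hv hm => ?_⟩
  obtain ⟨i1, e1⟩ := H1 t ht
  have g := gauss_pos
  have hint : ∀ x y, 0 ≤ x → 0 ≤ y → IntegrableOn (fun s => v s x y) (Ioo 0 t) := by
    intro x y hx hy
    refine Integrable.mono' ((i1.const_mul K).mul_const
      (gauss (4 / 5) w₁ (a * t) x * gauss (4 / 5) w₂ (b * t) y)) (hm x y hx hy) ?_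
    exact (ae_restrict_mem measurableSet_Ioo).mono fun s hs => (hv s hs).bound x y hx hy
  have hpow : ∀ p : ℝ, 0 < t ^ p := fun p => Real.rpow_pos_of_pos ht p
  have hmon : ∀ w a' z, 0 < a' → gauss (4 / 5) w (a' * t) z ≤ gauss (7 / 10) w (a' * t) z :=
    fun w a' z ha' => gauss_anti (by norm_num) (by positivity)
  -- the increments, for either variable
  have hhol : ∀ (f f' : ℝ → ℝ) (D E : ℝ), 0 < D → 0 ≤ E → IntegrableOn f (Ioo 0 t) →
      IntegrableOn f' (Ioo 0 t) →
      (∀ s ∈ Ioo 0 t, |f s - f' s| ≤ K * E * (majorant j γ t s * min 1 (D / √(t - s)))) →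
      |(∫ s in Ioo 0 t, f s) - ∫ s in Ioo 0 t, f' s| ≤
        (K * C₁ + K * C₂) * t ^ (-(j + γ / 2)) * D ^ γ * E := by
    intro f f' D E hD hE hf hf' hff
    obtain ⟨i2, e2⟩ := H2 t D ht hD
    rw [← integral_sub hf hf']
    have := hpow (-(j + γ / 2))
    calc |∫ s in Ioo 0 t, (f s - f' s)| ≤ ∫ s in Ioo 0 t, K * E * (majorant j γ t s * min 1 (D / √(t - s))) :=
          norm_integral_le_of_norm_le (f := fun s => f s - f' s) (i2.const_mul _)
            ((ae_restrict_mem measurableSet_Ioo).mono hff)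
      _ ≤ K * E * (C₂ * t ^ (-(j + γ / 2)) * D ^ γ) := by
          rw [integral_const_mul]; gcongr
      _ = (K * C₂) * t ^ (-(j + γ / 2)) * D ^ γ * E := by ring
      _ ≤ _ := by gcongr; exact le_add_of_nonneg_left (by positivity)
  refine ⟨hint, fun x y hx hy => ?_, fun x x' y hx hx' hy => ?_, fun x y y' hx hy hy' => ?_⟩
  · have := g (4 / 5) w₁ (a * t) x
    have := g (4 / 5) w₂ (b * t) y
    have := hpow (-j)
    calc |∫ s in Ioo 0 t, v s x y| ≤ ∫ s in Ioo 0 t, K * majorant j γ t s *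
            (gauss (4 / 5) w₁ (a * t) x * gauss (4 / 5) w₂ (b * t) y) :=
          norm_integral_le_of_norm_le (f := fun s => v s x y) ((i1.const_mul _).mul_const _)
            ((ae_restrict_mem measurableSet_Ioo).mono fun s hs => (hv s hs).bound x y hx hy)
      _ = K * (∫ s in Ioo 0 t, majorant j γ t s) *
            (gauss (4 / 5) w₁ (a * t) x * gauss (4 / 5) w₂ (b * t) y) := by
          rw [integral_mul_const, integral_const_mul]
      _ ≤ K * (C₁ * t ^ (-j)) *
            (gauss (4 / 5) w₁ (a * t) x * gauss (4 / 5) w₂ (b * t) y) := by gcongr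
      _ = K * C₁ * t ^ (-j) *
            (gauss (4 / 5) w₁ (a * t) x * gauss (4 / 5) w₂ (b * t) y) := by ring
      _ ≤ _ := by gcongr; exact le_add_of_nonneg_right (by positivity)
  · have g1 := g (7 / 10) w₁ (a * t) x
    have g1' := g (7 / 10) w₁ (a * t) x'
    have g2 := g (7 / 10) w₂ (b * t) y
    rcases eq_or_ne x x' with rfl | hne
    · rw [sub_self, abs_zero]
      have := hpow (-(j + γ / 2))
      positivity
    have hD : 0 < |√x - √x'| := abs_pos.2 (sub_ne_zero.2 fun h => hne ((Real.sqrt_inj hx hx').1 h))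
    refine hhol _ _ _ _ hD (by positivity) (hint x y hx hy) (hint x' y hx' hy) fun s hs => ?_
    have g4 := g (4 / 5) w₁ (a * t) x
    have g4' := g (4 / 5) w₁ (a * t) x'
    have g5 := g (4 / 5) w₂ (b * t) y
    refine abs_sub_le_mul_min hK.le (majorant_nonneg hs.1 hs.2) hD (by linarith [hs.2])
      ((hv s hs).bound x y hx hy) ((hv s hs).bound x' y hx' hy)
      ((hv s hs).holder_fst x x' y hx hx' hy) ?_ ?_
    · gcongr ?_ * ?_ + ?_ * ?_
      exacts [hmon _ _ _ ha, hmon _ _ _ hb, hmon _ _ _ ha, hmon _ _ _ hb]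
    · exact le_add_of_nonneg_right (by positivity)
  · have g1 := g (7 / 10) w₁ (a * t) x
    have g2' := g (7 / 10) w₂ (b * t) y'
    have g2 := g (7 / 10) w₂ (b * t) y
    rcases eq_or_ne y y' with rfl | hne
    · rw [sub_self, abs_zero]
      have := hpow (-(j + γ / 2))
      positivity
    have hD : 0 < |√y - √y'| := abs_pos.2 (sub_ne_zero.2 fun h => hne ((Real.sqrt_inj hy hy').1 h))
    refine hhol _ _ _ _ hD (by positivity) (hint x y hx hy) (hint x y' hx hy') fun s hs => ?_
    have g4 := g (4 / 5) w₁ (a * t) x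
    have g5' := g (4 / 5) w₂ (b * t) y'
    have g5 := g (4 / 5) w₂ (b * t) y
    refine abs_sub_le_mul_min hK.le (majorant_nonneg hs.1 hs.2) hD (by linarith [hs.2])
      ((hv s hs).bound x y hx hy) ((hv s hs).bound x y' hx hy')
      ((hv s hs).holder_snd x y y' hx hy hy') ?_ ?_
    · gcongr ?_ * ?_ + ?_ * ?_
      exacts [hmon _ _ _ ha, hmon _ _ _ hb, hmon _ _ _ ha, hmon _ _ _ hb]
    · exact le_add_of_nonneg_right (by positivity)

/-- The space-time average `∫₀ᵗ ∫∫ G(s, x', y') p_{b(t-s)}(y, dy') p_{a(t-s)}(x, dx') ds`. -/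
def potential (a b δ ε t : ℝ) (G : ℝ → ℝ → ℝ → ℝ) (x y : ℝ) : ℝ :=
  ∫ s in Ioo 0 t, kerDiff 0 δ (a * (t - s)) (fun x' => kerDiff 0 ε (b * (t - s)) (G s x') y) x

/-- The formal `x`-derivative of `potential`, taken under the integral. -/
def potentialDx (a b δ ε t : ℝ) (G : ℝ → ℝ → ℝ → ℝ) (x y : ℝ) : ℝ :=
  ∫ s in Ioo 0 t, avgDx δ ε (a * (t - s)) (b * (t - s)) (G s) x y

/-- The formal `x ∂ₓ²` of `potential`, taken under the integral. -/
def potentialDxx (a b δ ε t : ℝ) (G : ℝ → ℝ → ℝ → ℝ) (x y : ℝ) : ℝ :=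
  ∫ s in Ioo 0 t, avgDxx δ ε (a * (t - s)) (b * (t - s)) (G s) x y

lemma integrableOn_average {a b w₁ w₂ δ ε T j : ℝ} (ha : 0 < a) (hb : 0 < b)
    (hw₁ : 0 < w₁) (hw₂ : 0 < w₂) (hδ : 0 ≤ δ) (hε : 0 ≤ ε) (hT : 0 < T) (hj : j < 2)
    {G : ℝ → ℝ → ℝ → ℝ} (hm : Measurable (fun p : ℝ × ℝ × ℝ => G p.1 p.2.1 p.2.2))
    (hG : ∀ s ∈ Ioc 0 T, ∀ x y,
      |G s x y| ≤ s ^ (-j) * (gauss 1 w₁ (a * s) x * gauss 1 w₂ (b * s) y))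
    (hGb : ∀ s ∈ Ioc 0 T, BddMeas₂ (G s)) {t x y : ℝ} (ht : t ∈ Ioc 0 T) (hx : 0 ≤ x)
    (hy : 0 ≤ y) :
    IntegrableOn (fun s => kerDiff 0 δ (a * (t - s))
      (fun x' => kerDiff 0 ε (b * (t - s)) (G s x') y) x) (Ioo 0 t) := by
  have hsub : ∀ s ∈ Ioo 0 t, s ∈ Ioc 0 T := fun s hs => ⟨hs.1, hs.2.le.trans ht.2⟩
  obtain ⟨K, hK0, hK⟩ := exists_abs_average_le ha hb hw₁ hw₂ hδ hε hT
  refine Integrable.mono' (((integrableOn_rpow_Ioo (p := 1 - j) (by linarith) ht.1).1.const_mul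
    K).div_const t) (aestronglyMeasurable_kerDiff 0 0 ha hb hδ hε hx hy hm
    fun s hs => hGb s (hsub s hs)) ?_
  refine (ae_restrict_mem measurableSet_Ioo).mono fun s hs => ?_
  refine (hK t s x y (s ^ (-j)) hs.1 hs.2 ht.2 hx hy (Real.rpow_nonneg hs.1.le _) (G s)
    (hGb s (hsub s hs)) (hG s (hsub s hs))).trans (le_of_eq ?_)
  rw [sub_eq_neg_add, Real.rpow_add hs.1, Real.rpow_one]

/-- Existence of `∂ₓ` and `x ∂ₓ²` of the space-time average, with their estimates. -/
lemma exists_potential_estimates {a b w₁ w₂ δ ε T j γ : ℝ} (ha : 0 < a) (hb : 0 < b)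
    (hw₁ : 0 < w₁) (hw₂ : 0 < w₂) (hδ : 0 ≤ δ) (hε : 0 ≤ ε) (hT : 0 < T) (hj : j < 2)
    (hγ0 : 0 < γ) (hγ1 : γ < 1) :
    ∃ C : ℝ, 0 < C ∧ ∀ G, DataBound a b w₁ w₂ j γ T G → ∀ t ∈ Ioc 0 T,
      (∀ x y, 0 ≤ x → 0 ≤ y → HasDerivWithinAt (fun x => potential a b δ ε t G x y)
        (potentialDx a b δ ε t G x y) (Ici 0) x) ∧
      (∀ x y, 0 < x → 0 ≤ y → HasDerivAt (fun x => potentialDx a b δ ε t G x y)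
        (potentialDxx a b δ ε t G x y / x) x) ∧
      TimeBound C a b w₁ w₂ j γ t (potentialDx a b δ ε t G) ∧
      TimeBound C a b w₁ w₂ j γ t (potentialDxx a b δ ε t G) := by
  obtain ⟨K, hK0, hK⟩ := exists_sliceBound (δ := δ) (ε := ε) j ha hb hw₁ hw₂ hδ hε hT hγ0 hγ1
  obtain ⟨C, hC0, hC⟩ := exists_timeBound_integral w₁ w₂ ha hb hj hγ0 hγ1 hK0
  obtain ⟨C', -, hC'⟩ := exists_integral_majorant_le hj hγ0
  refine ⟨C, hC0, fun G hG t ht => ?_⟩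
  have ht0 : 0 < t := ht.1
  have hsub : ∀ s ∈ Ioo 0 t, s ∈ Ioc 0 T := fun s hs => ⟨hs.1, hs.2.le.trans ht.2⟩
  have hF : ∀ s ∈ Ioo 0 t, BddMeas₂ (G s) := fun s hs => hG.bddMeas₂ ha.le hb.le (hsub s hs)
  have hmeas := fun k x y (hx : 0 ≤ x) (hy : 0 ≤ y) =>
    aestronglyMeasurable_kerDiff k 0 (t := t) ha hb hδ hε hx hy hG.meas hF
  have hm : Measurable fun s => a * (t - s) := by fun_prop
  obtain ⟨J1, B1⟩ := hC t ht0 (fun s => avgDx δ ε (a * (t - s)) (b * (t - s)) (G s))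
    (fun s hs => (hK G hG t s hs.1 hs.2 ht.2).1)
    (fun x y hx hy => by
      simp only [avgDx, div_eq_mul_inv]
      exact (hmeas 1 x y hx hy).mul hm.inv.aestronglyMeasurable)
  obtain ⟨J2, B2⟩ := hC t ht0 (fun s => avgDxx δ ε (a * (t - s)) (b * (t - s)) (G s))
    (fun s hs => (hK G hG t s hs.1 hs.2 ht.2).2)
    (fun x y hx hy => by
      simp only [avgDxx, div_eq_mul_inv]
      exact ((hmeas 2 x y hx hy).mul (hm.pow_const 2).inv.aestronglyMeasurable).const_mul x)
  have hi := (hC' t ht0).1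
  have hle1 : ∀ x y, gauss (4 / 5) w₁ (a * t) x * gauss (4 / 5) w₂ (b * t) y ≤ 1 := fun x y =>
    mul_le_one₀ (gauss_le_one (by norm_num) (by positivity)) (gauss_pos _ _ _ _).le
      (gauss_le_one (by norm_num) (by positivity))
  have hpos : ∀ s ∈ Ioo 0 t, 0 < a * (t - s) ∧ 0 < b * (t - s) := fun s hs =>
    ⟨mul_pos ha (by linarith [hs.2]), mul_pos hb (by linarith [hs.2])⟩
  have hin : ∀ s ∈ Ioo 0 t, ∀ y, 0 ≤ y →
      BddMeas (fun x' => kerDiff 0 ε (b * (t - s)) (G s x') y) := fun s hs y hy =>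
    bddMeas_kerDiff 0 hε (hpos s hs).2 hy (hF s hs)
  refine ⟨fun x y hx hy => ?_, fun x y hx hy => ?_, B1, B2⟩
  · refine hasDerivWithinAt_integral_of_dominated (convex_Ici 0) hx
      (bound := fun s => K * majorant j γ t s)
      (F' := fun x s => avgDx δ ε (a * (t - s)) (b * (t - s)) (G s) x y)
      (fun x' hx' => integrableOn_average ha hb hw₁ hw₂ hδ hε hT hj hG.meas hG.bound
        (fun s hs => hG.bddMeas₂ ha.le hb.le hs) ht hx' hy)
      (hi.const_mul K) ?_ ?_
    · refine (ae_restrict_mem measurableSet_Ioo).mono fun s hs x' hx' => ?_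
      exact hasDerivWithinAt_kerDiff 0 hδ (hpos s hs).1 hx' (hin s hs y hy)
    · refine (ae_restrict_mem measurableSet_Ioo).mono fun s hs x' hx' => ?_
      exact ((hK G hG t s hs.1 hs.2 ht.2).1.bound x' y hx' hy).trans
        (mul_le_of_le_one_right (mul_nonneg hK0.le (majorant_nonneg hs.1 hs.2)) (hle1 x' y))
  · have hx2 : x ∈ Ici (x / 2) := by simp only [mem_Ici]; linarith
    have hnn : ∀ x' ∈ Ici (x / 2), 0 < x' := fun x' hx' => lt_of_lt_of_le (by positivity) hx'
    have h := hasDerivWithinAt_integral_of_dominated (convex_Ici (x / 2)) hx2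
      (F := fun x s => avgDx δ ε (a * (t - s)) (b * (t - s)) (G s) x y)
      (bound := fun s => K * majorant j γ t s * (2 / x))
      (F' := fun x s => avgDxx δ ε (a * (t - s)) (b * (t - s)) (G s) x y / x)
      (fun x' hx' => J1 x' y (hnn x' hx').le hy) ((hi.const_mul K).mul_const _) ?_ ?_
    · rw [integral_div] at h
      exact h.hasDerivAt (Ici_mem_nhds (by linarith))
    · refine (ae_restrict_mem measurableSet_Ioo).mono fun s hs x' hx' => ?_
      have h1 := ((hasDerivWithinAt_kerDiff 1 hδ (hpos s hs).1 (hnn x' hx').le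
        (hin s hs y hy)).mono (Ici_subset_Ici.2 (by positivity : 0 ≤ x / 2))).div_const
        (a * (t - s))
      refine h1.congr_deriv ?_
      have := (hpos s hs).1
      have := hnn x' hx'
      unfold avgDxx
      field_simp
    · refine (ae_restrict_mem measurableSet_Ioo).mono fun s hs x' hx' => ?_
      have hx0 := hnn x' hx'
      have hmaj := majorant_nonneg (j := j) (γ := γ) hs.1 hs.2
      rw [abs_div, abs_of_pos hx0, div_eq_mul_inv]
      have h1 := ((hK G hG t s hs.1 hs.2 ht.2).2.bound x' y hx0.le hy).trans
        (mul_le_of_le_one_right (mul_nonneg hK0.le hmaj) (hle1 x' y))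
      gcongr
      rw [← one_div, div_le_div_iff₀ hx0 hx]
      have : x / 2 ≤ x' := hx'
      linarith

lemma potential_swap {a b δ ε t x y : ℝ} (ha : 0 < a) (hb : 0 < b) (hδ : 0 ≤ δ) (hε : 0 ≤ ε)
    (hx : 0 ≤ x) (hy : 0 ≤ y) {G : ℝ → ℝ → ℝ → ℝ} (hF : ∀ s ∈ Ioo 0 t, BddMeas₂ (G s)) :
    potential a b δ ε t G x y = potential b a ε δ t (fun s y x => G s x y) y x := by
  refine setIntegral_congr_fun measurableSet_Ioo fun s hs => ?_
  exact kerDiff_swap 0 0 hδ hε (mul_pos ha (by linarith [hs.2])) (mul_pos hb (by linarith [hs.2]))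
    hx hy (hF s hs)

/-! ### Coefficients that vanish at the centre -/

/-- Lipschitz continuity in `(√x, √y)` together with vanishing at `(w₁, w₂)`. -/
structure CoeffBound (M w₁ w₂ : ℝ) (κ : ℝ → ℝ → ℝ) : Prop where
  bound : ∀ x y, 0 ≤ x → 0 ≤ y → |κ x y| ≤ M * (|√x - w₁| + |√y - w₂|)
  lip_fst : ∀ x x' y, 0 ≤ x → 0 ≤ x' → 0 ≤ y → |κ x y - κ x' y| ≤ M * |√x - √x'|
  lip_snd : ∀ x y y', 0 ≤ x → 0 ≤ y → 0 ≤ y' → |κ x y - κ x y'| ≤ M * |√y - √y'|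

lemma abs_min_sub_min_le {x x' R : ℝ} (hx : 0 ≤ x) (hx' : 0 ≤ x') (hR : 0 ≤ R) :
    |min x R - min x' R| ≤ 2 * √R * |√x - √x'| := by
  have e : ∀ z, √(min z R) = min √z √R := fun z => Real.sqrt_monotone.map_min
  have h1 : min x R - min x' R = (min √x √R - min √x' √R) * (min √x √R + min √x' √R) := by
    rw [← e, ← e]
    have h := Real.mul_self_sqrt (le_min hx hR)
    have h' := Real.mul_self_sqrt (le_min hx' hR)
    linear_combination h' - h
  have h2 : |min √x √R - min √x' √R| ≤ |√x - √x'| := by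
    simpa using abs_min_sub_min_le_max √x √R √x' √R
  have h3 : 0 ≤ min √x √R + min √x' √R := by positivity
  have h4 : min √x √R + min √x' √R ≤ 2 * √R := by
    linarith [min_le_right √x √R, min_le_right √x' √R]
  rw [h1, abs_mul, abs_of_nonneg h3, mul_comm]
  gcongr

/-- A cut-off coefficient `h (c - c(q))` is smooth with compact support, hence Lipschitz in
`(√x, √y)`, and it vanishes at `q`. -/
lemma exists_coeffBound {U : Set (ℝ × ℝ)} (hU : ∃ V : Set (ℝ × ℝ), IsOpen V ∧ U = V ∩ quadrant)
    {h c : ℝ × ℝ → ℝ} (hh : IsCutoff h U) (hc : ContDiffOn ℝ ∞ c U) {q : ℝ × ℝ} (hq : q ∈ U) :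
    ∃ M : ℝ, 0 < M ∧ CoeffBound M √q.1 √q.2 (fun x y => h (x, y) * (c (x, y) - c q)) := by
  obtain ⟨V, hV, rfl⟩ := hU
  obtain ⟨hh, K, hK, hKU, hK0⟩ := hh
  set κ : ℝ × ℝ → ℝ := fun p => h p * (c p - c q) with hκ
  have hκ0 : ∀ p ∈ quadrant, p ∉ K → κ p = 0 := fun p hp hpK => by
    simp only [hκ, hK0 p ⟨hp, hpK⟩, zero_mul]
  have hsm : ContDiffOn ℝ 1 κ quadrant := by
    intro p hp
    by_cases hpV : p ∈ V
    · have h1 : ContDiffOn ℝ 1 κ (V ∩ quadrant) :=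
        (hh.mul (hc.sub contDiffOn_const)).of_le (by exact_mod_cast le_top)
      have h2 := h1 p ⟨hpV, hp⟩
      rwa [inter_comm, contDiffWithinAt_inter (hV.mem_nhds hpV)] at h2
    · have hpK : p ∉ K := fun hpK => hpV (hKU hpK).1
      have h1 : κ =ᶠ[nhdsWithin p quadrant] fun _ => 0 := by
        filter_upwards [self_mem_nhdsWithin,
          mem_nhdsWithin_of_mem_nhds (hK.isClosed.isOpen_compl.mem_nhds hpK)] with z hz hzK
        exact hκ0 z hz hzK
      exact contDiffWithinAt_const.congr_of_eventuallyEq h1 (hκ0 p hp hpK)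
  obtain ⟨R₀, hR₀⟩ := hK.isBounded.subset_closedBall 0
  set R : ℝ := |R₀| + 1 with hR
  have hRpos : 0 < R := by positivity
  have hKR : ∀ p ∈ K, p.1 < R ∧ p.2 < R := by
    intro p hp
    have h1 := hR₀ hp
    rw [mem_closedBall_zero_iff, Prod.norm_def, max_le_iff] at h1
    have h2 := le_abs_self R₀
    constructor
    · linarith [h1.1, Real.le_norm_self p.1]
    · linarith [h1.2, Real.le_norm_self p.2]
  set B : Set (ℝ × ℝ) := Icc 0 R ×ˢ Icc 0 R with hB
  have hBq : B ⊆ quadrant := prod_mono Icc_subset_Ici_self Icc_subset_Ici_self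
  obtain ⟨N, hN⟩ := (hsm.mono hBq).exists_lipschitzOnWith one_ne_zero
    ((convex_Icc 0 R).prod (convex_Icc 0 R)) (isCompact_Icc.prod isCompact_Icc)
  -- outside of the box `κ` vanishes, so that it is unchanged by the projection to the box
  have hproj : ∀ x y, 0 ≤ x → 0 ≤ y → κ (x, y) = κ (min x R, min y R) := by
    intro x y hx hy
    by_cases h1 : x ≤ R ∧ y ≤ R
    · rw [min_eq_left h1.1, min_eq_left h1.2]
    · rw [hκ0 (x, y) ⟨hx, hy⟩ fun hp => h1 ⟨(hKR _ hp).1.le, (hKR _ hp).2.le⟩,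
        hκ0 (min x R, min y R) ⟨le_min hx hRpos.le, le_min hy hRpos.le⟩ fun hp => ?_]
      obtain ⟨h2, h3⟩ := hKR _ hp
      rcases not_and_or.1 h1 with h | h
      · exact absurd h2 (by simp [min_eq_right (not_le.1 h).le])
      · exact absurd h3 (by simp [min_eq_right (not_le.1 h).le])
  have hlip : ∀ x y x' y', 0 ≤ x → 0 ≤ y → 0 ≤ x' → 0 ≤ y' →
      |κ (x, y) - κ (x', y')| ≤ (N * (2 * √R) + 1) * (|√x - √x'| + |√y - √y'|) := by
    intro x y x' y' hx hy hx' hy'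
    rw [hproj x y hx hy, hproj x' y' hx' hy']
    have h1 := hN.dist_le_mul (min x R, min y R)
      ⟨⟨le_min hx hRpos.le, min_le_right _ _⟩, ⟨le_min hy hRpos.le, min_le_right _ _⟩⟩
      (min x' R, min y' R)
      ⟨⟨le_min hx' hRpos.le, min_le_right _ _⟩, ⟨le_min hy' hRpos.le, min_le_right _ _⟩⟩
    rw [Real.dist_eq, Prod.dist_eq, Real.dist_eq, Real.dist_eq] at h1
    refine h1.trans ?_
    have h2 := abs_min_sub_min_le hx hx' hRpos.le
    have h3 := abs_min_sub_min_le hy hy' hRpos.le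
    have h4 : max |min x R - min x' R| |min y R - min y' R| ≤
        2 * √R * (|√x - √x'| + |√y - √y'|) := by
      refine max_le (h2.trans ?_) (h3.trans ?_)
      · gcongr; exact le_add_of_nonneg_right (abs_nonneg _)
      · gcongr; exact le_add_of_nonneg_left (abs_nonneg _)
    calc _ ≤ N * (2 * √R * (|√x - √x'| + |√y - √y'|)) := by gcongr
      _ = N * (2 * √R) * (|√x - √x'| + |√y - √y'|) := by ring
      _ ≤ _ := by gcongr; linarith
  refine ⟨N * (2 * √R) + 1, by positivity, fun x y hx hy => ?_, fun x x' y hx hx' hy => ?_,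
    fun x y y' hx hy hy' => ?_⟩
  · have h1 := hlip x y q.1 q.2 hx hy hq.2.1 hq.2.2
    have h2 : κ (q.1, q.2) = 0 := by simp [hκ]
    rwa [h2, sub_zero] at h1
  · simpa using hlip x y x' y hx hy hx' hy
  · simpa using hlip x y x y' hx hy hx hy'

/-- A factor `|√x - w|` costs part of the Gaussian and gains `√s`. -/
lemma abs_mul_gauss_le {w s : ℝ} (hs : 0 < s) (x : ℝ) :
    |√x - w| * gauss (7 / 10) w s x ≤ 2 * √s * gauss (1 / 2) w s x := by
  have h0 : 0 < √s := Real.sqrt_pos.2 hs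
  set z := |√x - w| / √s with hz
  have hzr : |√x - w| = z * √s := by rw [hz]; field_simp
  have hz2 : (√x - w) ^ 2 = z ^ 2 * s := by
    rw [← sq_abs, hzr, mul_pow, Real.sq_sqrt hs.le]
  have h1 : z ≤ 2 * Real.exp (z ^ 2 / 10) := by
    have := Real.add_one_le_exp (z ^ 2 / 10)
    nlinarith [sq_nonneg (z - 5 / 2)]
  have e : gauss (1 / 2) w s x = Real.exp (z ^ 2 / 10) * gauss (7 / 10) w s x := by
    unfold gauss
    rw [hz2, ← Real.exp_add]
    congr 1
    field_simp
    ring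
  have hg := gauss_pos (7 / 10) w s x
  rw [e, hzr]
  calc _ = z * (√s * gauss (7 / 10) w s x) := by ring
    _ ≤ 2 * Real.exp (z ^ 2 / 10) * (√s * gauss (7 / 10) w s x) := by gcongr
    _ = _ := by ring

lemma CoeffBound.abs_mul_gauss_le {M w₁ w₂ a b t x y : ℝ} {κ : ℝ → ℝ → ℝ}
    (h : CoeffBound M w₁ w₂ κ) (hM : 0 ≤ M) (ha : 0 < a) (hb : 0 < b) (ht : 0 < t) (hx : 0 ≤ x)
    (hy : 0 ≤ y) :
    |κ x y| * (gauss (7 / 10) w₁ (a * t) x * gauss (7 / 10) w₂ (b * t) y) ≤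
      2 * M * (√a + √b) * √t * (gauss (1 / 2) w₁ (a * t) x * gauss (1 / 2) w₂ (b * t) y) := by
  have hat : 0 < a * t := by positivity
  have hbt : 0 < b * t := by positivity
  have g1 := gauss_pos (7 / 10) w₁ (a * t) x
  have g2 := gauss_pos (7 / 10) w₂ (b * t) y
  have g1' := gauss_pos (1 / 2) w₁ (a * t) x
  have g2' := gauss_pos (1 / 2) w₂ (b * t) y
  have h1 := Kimura.abs_mul_gauss_le (w := w₁) hat x
  have h2 := Kimura.abs_mul_gauss_le (w := w₂) hbt y
  have m1 : gauss (7 / 10) w₁ (a * t) x ≤ gauss (1 / 2) w₁ (a * t) x :=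
    gauss_anti (by norm_num) hat
  have m2 : gauss (7 / 10) w₂ (b * t) y ≤ gauss (1 / 2) w₂ (b * t) y :=
    gauss_anti (by norm_num) hbt
  rw [Real.sqrt_mul ha.le] at h1
  rw [Real.sqrt_mul hb.le] at h2
  calc _ ≤ M * (|√x - w₁| + |√y - w₂|) *
        (gauss (7 / 10) w₁ (a * t) x * gauss (7 / 10) w₂ (b * t) y) := by
        gcongr; exact h.bound x y hx hy
    _ = M * ((|√x - w₁| * gauss (7 / 10) w₁ (a * t) x) * gauss (7 / 10) w₂ (b * t) y +
        gauss (7 / 10) w₁ (a * t) x * (|√y - w₂| * gauss (7 / 10) w₂ (b * t) y)) := by ring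
    _ ≤ M * ((2 * (√a * √t) * gauss (1 / 2) w₁ (a * t) x) * gauss (1 / 2) w₂ (b * t) y +
        gauss (1 / 2) w₁ (a * t) x * (2 * (√b * √t) * gauss (1 / 2) w₂ (b * t) y)) := by
        gcongr
    _ = _ := by ring

/-- The weighted Hölder estimate for a product of a Lipschitz coefficient `κ` and a Hölder
continuous `D`, at two points with distance `Δ` in the variables `(√x, √y)`. -/
lemma abs_mul_sub_mul_le {κ κ' D D' C M N Δ E E' e e' t j γ : ℝ} (ht : 0 < t) (hγ0 : 0 < γ)
    (hγ1 : γ < 1) (hC : 0 ≤ C) (hM : 0 ≤ M) (hN : 0 ≤ N) (hΔ : 0 ≤ Δ) (hE : 0 ≤ E) (hE' : 0 ≤ E')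
    (h1 : |D| ≤ C * t ^ (-j) * E) (h1' : |D'| ≤ C * t ^ (-j) * E')
    (h2 : |D - D'| ≤ C * t ^ (-(j + γ / 2)) * Δ ^ γ * (E + E'))
    (hκ : |κ| * E ≤ N * √t * e) (hκ' : |κ'| * E' ≤ N * √t * e') (he : E ≤ e) (he' : E' ≤ e')
    (hκκ : |κ - κ'| ≤ M * Δ) :
    |κ * D - κ' * D'| ≤ C * (N + 2 * M) * t ^ (-(j + (γ - 1) / 2)) * Δ ^ γ * (e + e') := by
  have hpow : ∀ p : ℝ, 0 < t ^ p := fun p => Real.rpow_pos_of_pos ht p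
  have hp := hpow (-(j + (γ - 1) / 2))
  have hpj := hpow (-j)
  have hpg := hpow (-(j + γ / 2))
  have he0 : 0 ≤ e := hE.trans he
  have he0' : 0 ≤ e' := hE'.trans he'
  have hΔγ : 0 ≤ Δ ^ γ := Real.rpow_nonneg hΔ γ
  have hst : √t = t ^ (1 / 2 : ℝ) := Real.sqrt_eq_rpow t
  rcases le_total t (Δ ^ 2) with h | h
  · have h3 : t ^ (-j) * √t ≤ t ^ (-(j + (γ - 1) / 2)) * Δ ^ γ := by
      calc t ^ (-j) * √t = t ^ (-(j + (γ - 1) / 2)) * t ^ (γ / 2) := by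
            rw [hst, ← Real.rpow_add ht, ← Real.rpow_add ht]; congr 1; ring
        _ ≤ t ^ (-(j + (γ - 1) / 2)) * (Δ ^ 2) ^ (γ / 2) := by gcongr
        _ = _ := by
            rw [← Real.rpow_natCast, ← Real.rpow_mul hΔ]; congr 2; push_cast; ring
    have h4 : ∀ κ D E e : ℝ, |D| ≤ C * t ^ (-j) * E → |κ| * E ≤ N * √t * e → 0 ≤ e →
        |κ * D| ≤ C * N * (t ^ (-(j + (γ - 1) / 2)) * Δ ^ γ) * e := by
      intro κ D E e hD hκ he
      calc |κ * D| ≤ |κ| * (C * t ^ (-j) * E) := by rw [abs_mul]; gcongr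
        _ = C * t ^ (-j) * (|κ| * E) := by ring
        _ ≤ C * t ^ (-j) * (N * √t * e) := by gcongr
        _ = C * N * (t ^ (-j) * √t) * e := by ring
        _ ≤ _ := by gcongr
    calc _ ≤ |κ * D| + |κ' * D'| := abs_sub _ _
      _ ≤ C * N * (t ^ (-(j + (γ - 1) / 2)) * Δ ^ γ) * (e + e') := by
          linarith [h4 κ D E e h1 hκ he0, h4 κ' D' E' e' h1' hκ' he0']
      _ = C * N * t ^ (-(j + (γ - 1) / 2)) * Δ ^ γ * (e + e') := by ring
      _ ≤ _ := by gcongr; linarith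
  · have hΔt : Δ ≤ √t := Real.le_sqrt_of_sq_le h
    have h3 : Δ * t ^ (-j) ≤ t ^ (-(j + (γ - 1) / 2)) * Δ ^ γ := by
      have h5 : Δ ^ (1 - γ) ≤ t ^ ((1 - γ) / 2) := by
        calc Δ ^ (1 - γ) ≤ √t ^ (1 - γ) := by
              exact Real.rpow_le_rpow hΔ hΔt (by linarith)
          _ = _ := by rw [hst, ← Real.rpow_mul ht.le]; congr 1; ring
      calc Δ * t ^ (-j) = Δ ^ γ * Δ ^ (1 - γ) * t ^ (-j) := by
            rw [← Real.rpow_add_of_nonneg hΔ hγ0.le (by linarith),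
              show γ + (1 - γ) = 1 by ring, Real.rpow_one]
        _ ≤ Δ ^ γ * t ^ ((1 - γ) / 2) * t ^ (-j) := by gcongr
        _ = Δ ^ γ * (t ^ ((1 - γ) / 2) * t ^ (-j)) := by ring
        _ = _ := by
            rw [← Real.rpow_add ht, mul_comm]; congr 2; ring
    have h4 : t ^ (-(j + γ / 2)) * √t = t ^ (-(j + (γ - 1) / 2)) := by
      rw [hst, ← Real.rpow_add ht]; congr 1; ring
    have h6 : |κ| * E' ≤ (N + M) * √t * e' := by
      have h7 : |κ| ≤ |κ'| + M * √t := by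
        have := abs_sub_abs_le_abs_sub κ κ'
        have : M * Δ ≤ M * √t := by gcongr
        linarith
      calc |κ| * E' ≤ (|κ'| + M * √t) * E' := by gcongr
        _ = |κ'| * E' + M * √t * E' := by ring
        _ ≤ N * √t * e' + M * √t * e' := by gcongr
        _ = _ := by ring
    have h8 : |κ| * E ≤ (N + M) * √t * e := hκ.trans (by gcongr; linarith)
    calc |κ * D - κ' * D'| = |κ * (D - D') + (κ - κ') * D'| := by ring_nf
      _ ≤ |κ| * |D - D'| + |κ - κ'| * |D'| := by
          rw [← abs_mul, ← abs_mul]; exact abs_add_le _ _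
      _ ≤ |κ| * (C * t ^ (-(j + γ / 2)) * Δ ^ γ * (E + E')) + M * Δ * (C * t ^ (-j) * E') := by
          gcongr
      _ = C * t ^ (-(j + γ / 2)) * Δ ^ γ * (|κ| * E + |κ| * E') + C * M * (Δ * t ^ (-j)) * E' := by
          ring
      _ ≤ C * t ^ (-(j + γ / 2)) * Δ ^ γ * ((N + M) * √t * e + (N + M) * √t * e') +
          C * M * (t ^ (-(j + (γ - 1) / 2)) * Δ ^ γ) * (e + e') := by
          gcongr
          linarith
      _ = C * (N + M) * (t ^ (-(j + γ / 2)) * √t) * Δ ^ γ * (e + e') +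
          C * M * t ^ (-(j + (γ - 1) / 2)) * Δ ^ γ * (e + e') := by ring
      _ = _ := by rw [h4]; ring

/-- The estimates claimed for the perturbation term. -/
structure GainBound (C a b w₁ w₂ j γ t : ℝ) (u : ℝ → ℝ → ℝ) : Prop where
  bound : ∀ x y, 0 ≤ x → 0 ≤ y →
    |u x y| ≤ C * (√t * t ^ (-j)) * (gauss (1 / 2) w₁ (a * t) x * gauss (1 / 2) w₂ (b * t) y)
  holder_fst : ∀ x x' y, 0 ≤ x → 0 ≤ x' → 0 ≤ y → |u x y - u x' y| ≤
    C * t ^ (-(j + (γ - 1) / 2)) * |√x - √x'| ^ γ *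
      (gauss (1 / 2) w₁ (a * t) x * gauss (1 / 2) w₂ (b * t) y +
        gauss (1 / 2) w₁ (a * t) x' * gauss (1 / 2) w₂ (b * t) y)
  holder_snd : ∀ x y y', 0 ≤ x → 0 ≤ y → 0 ≤ y' → |u x y - u x y'| ≤
    C * t ^ (-(j + (γ - 1) / 2)) * |√y - √y'| ^ γ *
      (gauss (1 / 2) w₁ (a * t) x * gauss (1 / 2) w₂ (b * t) y +
        gauss (1 / 2) w₁ (a * t) x * gauss (1 / 2) w₂ (b * t) y')

lemma GainBound.add {C C' a b w₁ w₂ j γ t : ℝ} {u u' : ℝ → ℝ → ℝ}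
    (h : GainBound C a b w₁ w₂ j γ t u) (h' : GainBound C' a b w₁ w₂ j γ t u') :
    GainBound (C + C') a b w₁ w₂ j γ t (fun x y => u x y + u' x y) := by
  refine ⟨fun x y hx hy => ?_, fun x x' y hx hx' hy => ?_, fun x y y' hx hy hy' => ?_⟩
  · refine (abs_add_le _ _).trans ((add_le_add (h.bound x y hx hy) (h'.bound x y hx hy)).trans
      (le_of_eq (by ring)))
  · rw [add_sub_add_comm]
    refine (abs_add_le _ _).trans ((add_le_add (h.holder_fst x x' y hx hx' hy)
      (h'.holder_fst x x' y hx hx' hy)).trans (le_of_eq (by ring)))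
  · rw [add_sub_add_comm]
    refine (abs_add_le _ _).trans ((add_le_add (h.holder_snd x y y' hx hy hy')
      (h'.holder_snd x y y' hx hy hy')).trans (le_of_eq (by ring)))

lemma GainBound.congr {C a b w₁ w₂ j γ t : ℝ} {u u' : ℝ → ℝ → ℝ}
    (h : GainBound C a b w₁ w₂ j γ t u) (he : ∀ x y, 0 ≤ x → 0 ≤ y → u' x y = u x y) :
    GainBound C a b w₁ w₂ j γ t u' := by
  refine ⟨fun x y hx hy => ?_, fun x x' y hx hx' hy => ?_, fun x y y' hx hy hy' => ?_⟩
  · rw [he x y hx hy]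
    exact h.bound x y hx hy
  · rw [he x y hx hy, he x' y hx' hy]
    exact h.holder_fst x x' y hx hx' hy
  · rw [he x y hx hy, he x y' hx hy']
    exact h.holder_snd x y y' hx hy hy'

lemma CoeffBound.gainBound_mul {M C a b w₁ w₂ j γ t : ℝ} {κ u : ℝ → ℝ → ℝ}
    (hκ : CoeffBound M w₁ w₂ κ) (hu : TimeBound C a b w₁ w₂ j γ t u) (hM : 0 ≤ M) (hC : 0 ≤ C)
    (ha : 0 < a) (hb : 0 < b) (ht : 0 < t) (hγ0 : 0 < γ) (hγ1 : γ < 1) :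
    GainBound (C * (2 * M * (√a + √b) + 2 * M)) a b w₁ w₂ j γ t (fun x y => κ x y * u x y) := by
  have g := gauss_pos
  have hN : 0 ≤ 2 * M * (√a + √b) := by positivity
  have hpj : 0 < t ^ (-j) := Real.rpow_pos_of_pos ht _
  have hmon : ∀ θ θ' w a' z, θ' ≤ θ → 0 < a' → gauss θ w (a' * t) z ≤ gauss θ' w (a' * t) z :=
    fun θ θ' w a' z hθ ha' => gauss_anti hθ (by positivity)
  have h7 : ∀ x y, gauss (7 / 10) w₁ (a * t) x * gauss (7 / 10) w₂ (b * t) y ≤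
      gauss (1 / 2) w₁ (a * t) x * gauss (1 / 2) w₂ (b * t) y := fun x y =>
    mul_le_mul (hmon _ _ _ _ _ (by norm_num) ha) (hmon _ _ _ _ _ (by norm_num) hb)
      (g _ _ _ _).le (g _ _ _ _).le
  have h0 : ∀ x y, 0 ≤ gauss (7 / 10) w₁ (a * t) x * gauss (7 / 10) w₂ (b * t) y := fun x y =>
    (mul_pos (g _ _ _ _) (g _ _ _ _)).le
  have hb1 : ∀ x y, 0 ≤ x → 0 ≤ y → |u x y| ≤
      C * t ^ (-j) * (gauss (7 / 10) w₁ (a * t) x * gauss (7 / 10) w₂ (b * t) y) := by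
    intro x y hx hy
    refine (hu.bound x y hx hy).trans ?_
    have := g (4 / 5) w₂ (b * t) y
    have := g (7 / 10) w₁ (a * t) x
    gcongr ?_ * (?_ * ?_)
    exacts [hmon _ _ _ _ _ (by norm_num) ha, hmon _ _ _ _ _ (by norm_num) hb]
  have hk := fun x y (hx : 0 ≤ x) (hy : 0 ≤ y) => hκ.abs_mul_gauss_le hM ha hb ht hx hy
  refine ⟨fun x y hx hy => ?_, fun x x' y hx hx' hy => ?_, fun x y y' hx hy hy' => ?_⟩
  · have h1 := h0 x y
    have h2 := h7 x y
    rw [abs_mul]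
    calc _ ≤ |κ x y| * (C * t ^ (-j) *
          (gauss (7 / 10) w₁ (a * t) x * gauss (7 / 10) w₂ (b * t) y)) := by
          gcongr; exact hb1 x y hx hy
      _ = C * t ^ (-j) * (|κ x y| *
          (gauss (7 / 10) w₁ (a * t) x * gauss (7 / 10) w₂ (b * t) y)) := by ring
      _ ≤ C * t ^ (-j) * (2 * M * (√a + √b) * √t *
          (gauss (1 / 2) w₁ (a * t) x * gauss (1 / 2) w₂ (b * t) y)) := by
          exact mul_le_mul_of_nonneg_left (hk x y hx hy) (by positivity)
      _ = C * (2 * M * (√a + √b)) * (√t * t ^ (-j)) *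
          (gauss (1 / 2) w₁ (a * t) x * gauss (1 / 2) w₂ (b * t) y) := by ring
      _ ≤ _ := by
          have := h1.trans h2
          gcongr
          linarith
  · exact abs_mul_sub_mul_le ht hγ0 hγ1 hC hM hN (abs_nonneg _) (h0 x y) (h0 x' y)
      (hb1 x y hx hy) (hb1 x' y hx' hy) (hu.holder_fst x x' y hx hx' hy) (hk x y hx hy)
      (hk x' y hx' hy) (h7 x y) (h7 x' y) (hκ.lip_fst x x' y hx hx' hy)
  · exact abs_mul_sub_mul_le ht hγ0 hγ1 hC hM hN (abs_nonneg _) (h0 x y) (h0 x y')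
      (hb1 x y hx hy) (hb1 x y' hx hy') (hu.holder_snd x y y' hx hy hy') (hk x y hx hy)
      (hk x y' hx hy') (h7 x y) (h7 x y') (hκ.lip_snd x y y' hx hy hy')

/-! ### The solution operator in terms of iterated averages -/

lemma ae_nonneg_kernel₁ (δ τ x : ℝ) : ∀ᵐ x' ∂kernel₁ δ τ x, 0 ≤ x' := by
  unfold kernel₁
  rw [ae_add_measure_iff]
  constructor
  · refine (withDensity_absolutelyContinuous _ _).ae_le ?_
    exact (ae_restrict_mem measurableSet_Ioi).mono fun x' hx' => le_of_lt hx'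
  · split_ifs
    · refine Measure.ae_smul_measure ?_ _
      rw [ae_dirac_iff measurableSet_Ici]
    · exact ae_zero.symm ▸ Filter.eventually_bot

/-- The extension of the data from the quadrant to the plane that is constant along the outer
normals. As `√` vanishes on negative numbers, the bounds on the quadrant extend to the plane. -/
def dataExt (g : ℝ → ℝ × ℝ → ℝ) (s x y : ℝ) : ℝ := g s (max x 0, max y 0)

lemma sqrt_max_zero (x : ℝ) : √(max x 0) = √x := by
  rcases le_total x 0 with h | h
  · rw [max_eq_right h, Real.sqrt_zero, Real.sqrt_eq_zero_of_nonpos h]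
  · rw [max_eq_left h]

lemma exp_neg_mul_dist (L : Coeffs) (q : ℝ × ℝ) (θ t x y : ℝ) :
    Real.exp (-(θ * L.dist q t (x, y))) =
      gauss θ √q.1 (L.a q * t) x * gauss θ √q.2 (L.b q * t) y := by
  unfold gauss Coeffs.dist
  rw [← Real.exp_add, mul_assoc, mul_assoc]
  congr 1
  ring

lemma exp_neg_dist (L : Coeffs) (q : ℝ × ℝ) (t x y : ℝ) :
    Real.exp (-L.dist q t (x, y)) =
      gauss 1 √q.1 (L.a q * t) x * gauss 1 √q.2 (L.b q * t) y := by
  rw [← exp_neg_mul_dist, one_mul]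

lemma exp_neg_dist_half (L : Coeffs) (q : ℝ × ℝ) (t x y : ℝ) :
    Real.exp (-(L.dist q t (x, y) / 2)) =
      gauss (1 / 2) √q.1 (L.a q * t) x * gauss (1 / 2) √q.2 (L.b q * t) y := by
  rw [← exp_neg_mul_dist, div_eq_inv_mul, one_div]

lemma measurable_dataExt {g : ℝ → ℝ × ℝ → ℝ} (hg : Measurable (fun w : ℝ × ℝ × ℝ => g w.1 w.2)) :
    Measurable (fun p : ℝ × ℝ × ℝ => dataExt g p.1 p.2.1 p.2.2) :=
  hg.comp (by fun_prop : Measurable fun p : ℝ × ℝ × ℝ => (p.1, max p.2.1 0, max p.2.2 0))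

lemma dataBound_dataExt {L : Coeffs} {q : ℝ × ℝ} {j γ T : ℝ} {g : ℝ → ℝ × ℝ → ℝ}
    (hg : Measurable (fun w : ℝ × ℝ × ℝ => g w.1 w.2))
    (h0 : ∀ t ∈ Set.Ioc 0 T, ∀ x y : ℝ, 0 ≤ x → 0 ≤ y →
      |g t (x, y)| ≤ 1 / t ^ j * Real.exp (-L.dist q t (x, y)))
    (h1 : ∀ t ∈ Set.Ioc 0 T, ∀ x x' y : ℝ, 0 ≤ x → 0 ≤ x' → 0 ≤ y →
      |g t (x, y) - g t (x', y)| ≤ 1 / t ^ (j + γ / 2) * |√x - √x'| ^ γ *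
        (Real.exp (-L.dist q t (x, y)) + Real.exp (-L.dist q t (x', y)))) :
    DataBound (L.a q) (L.b q) √q.1 √q.2 j γ T (dataExt g) := by
  have hgm : ∀ θ w s x, gauss θ w s (max x 0) = gauss θ w s x := fun θ w s x => by
    unfold gauss; rw [sqrt_max_zero]
  refine ⟨measurable_dataExt hg, fun s hs x y => ?_, fun s hs x x' y => ?_⟩
  · have h := h0 s hs (max x 0) (max y 0) (le_max_right _ _) (le_max_right _ _)
    rwa [exp_neg_dist, hgm, hgm, one_div, ← Real.rpow_neg hs.1.le] at h
  · have h := h1 s hs (max x 0) (max x' 0) (max y 0) (le_max_right _ _) (le_max_right _ _)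
      (le_max_right _ _)
    rwa [exp_neg_dist, exp_neg_dist, hgm, hgm, hgm, one_div, ← Real.rpow_neg hs.1.le,
      sqrt_max_zero, sqrt_max_zero, ← add_mul] at h

/-- The data with the two variables exchanged are data for the operator with exchanged
coefficients. -/
lemma dataBound_dataExt_swap {L : Coeffs} {q : ℝ × ℝ} {j γ T : ℝ} {g : ℝ → ℝ × ℝ → ℝ}
    (hg : Measurable (fun w : ℝ × ℝ × ℝ => g w.1 w.2))
    (h0 : ∀ t ∈ Set.Ioc 0 T, ∀ x y : ℝ, 0 ≤ x → 0 ≤ y →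
      |g t (x, y)| ≤ 1 / t ^ j * Real.exp (-L.dist q t (x, y)))
    (h1 : ∀ t ∈ Set.Ioc 0 T, ∀ x y y' : ℝ, 0 ≤ x → 0 ≤ y → 0 ≤ y' →
      |g t (x, y) - g t (x, y')| ≤ 1 / t ^ (j + γ / 2) * |√y - √y'| ^ γ *
        (Real.exp (-L.dist q t (x, y)) + Real.exp (-L.dist q t (x, y')))) :
    DataBound (L.b q) (L.a q) √q.2 √q.1 j γ T (fun s y x => dataExt g s x y) := by
  set L' : Coeffs := ⟨fun p => L.b p.swap, fun p => L.a p.swap, L.e, L.d⟩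
  have hdist : ∀ t x y, L'.dist q.swap t (y, x) = L.dist q t (x, y) := fun t x y => add_comm _ _
  exact dataBound_dataExt (L := L') (q := q.swap) (g := fun s p => g s p.swap)
    (hg.comp (by fun_prop : Measurable fun w : ℝ × ℝ × ℝ => (w.1, w.2.swap)))
    (fun t ht y x hy hx => by rw [hdist]; exact h0 t ht x y hx hy)
    (fun t ht y y' x hy hy' hx => by rw [hdist, hdist]; exact h1 t ht x y y' hx hy hy')

lemma isProbabilityMeasure_modelKernel {L : Coeffs} {q p : ℝ × ℝ} {τ : ℝ} (ha : 0 < L.a q)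
    (hb : 0 < L.b q) (hd : 0 ≤ L.d q) (he : 0 ≤ L.e q) (hτ : 0 < τ) (hp : p ∈ quadrant) :
    IsProbabilityMeasure (L.modelKernel q τ p) := by
  have := isProbabilityMeasure_kernel₁ (div_nonneg hd ha.le) (mul_pos ha hτ) hp.1
  have := isProbabilityMeasure_kernel₁ (div_nonneg he hb.le) (mul_pos hb hτ) hp.2
  unfold Coeffs.modelKernel
  infer_instance

lemma ae_dataExt_eq {L : Coeffs} {q p : ℝ × ℝ} {τ : ℝ} (ha : 0 < L.a q)
    (hb : 0 < L.b q) (hd : 0 ≤ L.d q) (he : 0 ≤ L.e q) (hτ : 0 < τ) (hp : p ∈ quadrant)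
    (g : ℝ → ℝ × ℝ → ℝ) (s : ℝ) :
    (fun z : ℝ × ℝ => dataExt g s z.1 z.2) =ᵐ[L.modelKernel q τ p] g s := by
  have := isProbabilityMeasure_kernel₁ (div_nonneg hd ha.le) (mul_pos ha hτ) hp.1
  have := isProbabilityMeasure_kernel₁ (div_nonneg he hb.le) (mul_pos hb hτ) hp.2
  have h1 := (Measure.quasiMeasurePreserving_fst (μ := kernel₁ (L.d q / L.a q) (L.a q * τ) p.1)
    (ν := kernel₁ (L.e q / L.b q) (L.b q * τ) p.2)).ae (ae_nonneg_kernel₁ _ _ _)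
  have h2 := (Measure.quasiMeasurePreserving_snd (μ := kernel₁ (L.d q / L.a q) (L.a q * τ) p.1)
    (ν := kernel₁ (L.e q / L.b q) (L.b q * τ) p.2)).ae (ae_nonneg_kernel₁ _ _ _)
  unfold Coeffs.modelKernel
  filter_upwards [h1, h2] with z hz1 hz2
  simp only [dataExt, max_eq_left hz1, max_eq_left hz2]

lemma integrable_uncurry_modelKernel {L : Coeffs} {q p : ℝ × ℝ} {τ : ℝ} (ha : 0 < L.a q)
    (hb : 0 < L.b q) (hd : 0 ≤ L.d q) (he : 0 ≤ L.e q) (hτ : 0 < τ) (hp : p ∈ quadrant)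
    {F : ℝ → ℝ → ℝ} (hF : BddMeas₂ F) :
    Integrable (fun z : ℝ × ℝ => F z.1 z.2) (L.modelKernel q τ p) := by
  have := isProbabilityMeasure_modelKernel ha hb hd he hτ hp
  obtain ⟨hm, M, hM⟩ := hF
  exact Integrable.of_bound hm.aestronglyMeasurable M
    (Filter.Eventually.of_forall fun z => hM z.1 z.2)

lemma integral_modelKernel {L : Coeffs} {q p : ℝ × ℝ} {τ : ℝ} (ha : 0 < L.a q)
    (hb : 0 < L.b q) (hd : 0 ≤ L.d q) (he : 0 ≤ L.e q) (hτ : 0 < τ) (hp : p ∈ quadrant)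
    {F : ℝ → ℝ → ℝ} (hF : BddMeas₂ F) :
    ∫ z, F z.1 z.2 ∂(L.modelKernel q τ p) = kerDiff 0 (L.d q / L.a q) (L.a q * τ)
      (fun x' => kerDiff 0 (L.e q / L.b q) (L.b q * τ) (F x') p.2) p.1 := by
  have := isProbabilityMeasure_kernel₁ (div_nonneg hd ha.le) (mul_pos ha hτ) hp.1
  have := isProbabilityMeasure_kernel₁ (div_nonneg he hb.le) (mul_pos hb hτ) hp.2
  exact integral_prod _ (integrable_uncurry_modelKernel ha hb hd he hτ hp hF)

lemma solution_eq_potential {L : Coeffs} {q p : ℝ × ℝ} {t : ℝ} (ha : 0 < L.a q)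
    (hb : 0 < L.b q) (hd : 0 ≤ L.d q) (he : 0 ≤ L.e q) (hp : p ∈ quadrant)
    {g : ℝ → ℝ × ℝ → ℝ} (hG : ∀ s ∈ Ioo 0 t, BddMeas₂ (dataExt g s)) :
    L.solution q g t p =
      potential (L.a q) (L.b q) (L.d q / L.a q) (L.e q / L.b q) t (dataExt g) p.1 p.2 := by
  refine setIntegral_congr_fun measurableSet_Ioo fun s hs => ?_
  have hτ : 0 < t - s := by linarith [hs.2]
  rw [← integral_congr_ae (ae_dataExt_eq ha hb hd he hτ hp g s),
    integral_modelKernel ha hb hd he hτ hp (hG s hs)]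

lemma BddMeas₂.abs {F : ℝ → ℝ → ℝ} (hF : BddMeas₂ F) : BddMeas₂ (fun x y => |F x y|) :=
  ⟨measurable_norm.comp hF.1, hF.2.imp fun _ h x y => by rw [abs_abs]; exact h x y⟩

lemma solutionConverges_of_dataBound {L : Coeffs} {q p : ℝ × ℝ} {j γ T t : ℝ} (ha : 0 < L.a q)
    (hb : 0 < L.b q) (hd : 0 ≤ L.d q) (he : 0 ≤ L.e q) (hq₁ : 0 < q.1) (hq₂ : 0 < q.2)
    (hj : j < 2) (ht : t ∈ Ioc 0 T) (hp : p ∈ quadrant) {g : ℝ → ℝ × ℝ → ℝ}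
    (hG : DataBound (L.a q) (L.b q) √q.1 √q.2 j γ T (dataExt g)) :
    L.SolutionConverges q g t p := by
  have hb₂ : ∀ s ∈ Ioc 0 T, BddMeas₂ (dataExt g s) := fun s hs => hG.bddMeas₂ ha.le hb.le hs
  have hsub : ∀ s ∈ Ioo 0 t, s ∈ Ioc 0 T := fun s hs => ⟨hs.1, hs.2.le.trans ht.2⟩
  constructor
  · intro s hs
    have hτ : 0 < t - s := by linarith [hs.2]
    exact (integrable_uncurry_modelKernel ha hb hd he hτ hp (hb₂ s (hsub s hs))).congr
      (ae_dataExt_eq ha hb hd he hτ hp g s)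
  · refine (integrableOn_average (G := fun s x y => |dataExt g s x y|) ha hb
      (Real.sqrt_pos.2 hq₁) (Real.sqrt_pos.2 hq₂) (div_nonneg hd ha.le) (div_nonneg he hb.le)
      (ht.1.trans_le ht.2) hj (measurable_norm.comp hG.meas)
      (fun s hs x y => by rw [abs_abs]; exact hG.bound s hs x y)
      (fun s hs => (hb₂ s hs).abs) ht hp.1 hp.2).congr_fun (fun s hs => ?_) measurableSet_Ioo
    have hτ : 0 < t - s := by linarith [hs.2]
    beta_reduce
    rw [← integral_modelKernel ha hb hd he hτ hp (hb₂ s (hsub s hs)).abs]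
    refine integral_congr_ae ?_
    filter_upwards [ae_dataExt_eq ha hb hd he hτ hp g s] with z hz
    rw [hz]

/-- The one-sided derivatives of a function on `[0, ∞)` that coincides there with `f`, if `f₁` is
the derivative of `f`, and `f₂ = x f₁'` vanishes at `0`. -/
lemma derivs_of_eqOn_Ici {u f f₁ f₂ : ℝ → ℝ} (h0 : EqOn u f (Ici 0))
    (h1 : ∀ x, 0 ≤ x → HasDerivWithinAt f (f₁ x) (Ici 0) x)
    (h2 : ∀ x, 0 < x → HasDerivAt f₁ (f₂ x / x) x) (h3 : f₂ 0 = 0) {x : ℝ} (hx : 0 ≤ x) :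
    DifferentiableWithinAt ℝ u (Ici 0) x ∧ derivWithin u (Ici 0) x = f₁ x ∧
      (0 < x → DifferentiableAt ℝ (fun x => derivWithin u (Ici 0) x) x) ∧
      x * derivWithin (fun x => derivWithin u (Ici 0) x) (Ici 0) x = f₂ x := by
  have hu : ∀ x, 0 ≤ x → HasDerivWithinAt u (f₁ x) (Ici 0) x := fun x hx =>
    (h1 x hx).congr h0 (h0 hx)
  have hd : ∀ x, 0 ≤ x → derivWithin u (Ici 0) x = f₁ x := fun x hx =>
    (hu x hx).derivWithin (uniqueDiffOn_Ici 0 x hx)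
  have h4 : ∀ x, 0 < x → HasDerivAt (fun x => derivWithin u (Ici 0) x) (f₂ x / x) x := by
    intro x hx
    refine (h2 x hx).congr_of_eventuallyEq ?_
    filter_upwards [Ici_mem_nhds hx] with z hz
    exact hd z hz
  refine ⟨(hu x hx).differentiableWithinAt, hd x hx, fun hx => (h4 x hx).differentiableAt, ?_⟩
  rcases hx.eq_or_lt with rfl | hx'
  · rw [zero_mul, h3]
  · rw [(h4 x hx').hasDerivWithinAt.derivWithin (uniqueDiffOn_Ici 0 x hx)]
    field_simp

lemma potentialDxx_zero (a b δ ε t : ℝ) (G : ℝ → ℝ → ℝ → ℝ) (y : ℝ) :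
    potentialDxx a b δ ε t G 0 y = 0 := by
  simp [potentialDxx, avgDxx]

/-- The derivatives of `𝐊 g` in the model operator exist and satisfy the weighted bounds. -/
lemma exists_solution_estimates {L : Coeffs} {q : ℝ × ℝ} {j γ T : ℝ} (ha : 0 < L.a q)
    (hb : 0 < L.b q) (hd : 0 ≤ L.d q) (he : 0 ≤ L.e q) (hq₁ : 0 < q.1) (hq₂ : 0 < q.2)
    (hT : 0 < T) (hj : j < 2) (hγ0 : 0 < γ) (hγ1 : γ < 1) :
    ∃ C : ℝ, 0 < C ∧ ∀ g : ℝ → ℝ × ℝ → ℝ,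
      DataBound (L.a q) (L.b q) √q.1 √q.2 j γ T (dataExt g) →
      DataBound (L.b q) (L.a q) √q.2 √q.1 j γ T (fun s y x => dataExt g s x y) →
      ∀ t ∈ Ioc 0 T, (∀ p ∈ quadrant, HasKimuraDerivs (L.solution q g t) p) ∧
        ∃ u₁ u₁₁ u₂ u₂₂ : ℝ → ℝ → ℝ,
          TimeBound C (L.a q) (L.b q) √q.1 √q.2 j γ t u₁ ∧
          TimeBound C (L.a q) (L.b q) √q.1 √q.2 j γ t u₁₁ ∧
          TimeBound C (L.a q) (L.b q) √q.1 √q.2 j γ t u₂ ∧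
          TimeBound C (L.a q) (L.b q) √q.1 √q.2 j γ t u₂₂ ∧
          ∀ x y, 0 ≤ x → 0 ≤ y → dx (L.solution q g t) (x, y) = u₁ x y ∧
            x * dx (dx (L.solution q g t)) (x, y) = u₁₁ x y ∧
            dy (L.solution q g t) (x, y) = u₂ x y ∧
            y * dy (dy (L.solution q g t)) (x, y) = u₂₂ x y := by
  have hδ := div_nonneg hd ha.le
  have hε := div_nonneg he hb.le
  have hw₁ := Real.sqrt_pos.2 hq₁
  have hw₂ := Real.sqrt_pos.2 hq₂
  obtain ⟨C, hC, H⟩ := exists_potential_estimates ha hb hw₁ hw₂ hδ hε hT hj hγ0 hγ1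
  -- the derivatives in `y` are the derivatives in the first variable for the exchanged data
  obtain ⟨C', hC', H'⟩ := exists_potential_estimates hb ha hw₂ hw₁ hε hδ hT hj hγ0 hγ1
  refine ⟨C + C', by positivity, fun g hG hG' t ht => ?_⟩
  obtain ⟨h1, h2, h3, h4⟩ := H _ hG t ht
  obtain ⟨h1', h2', h3', h4'⟩ := H' _ hG' t ht
  have hF : ∀ s ∈ Ioo 0 t, BddMeas₂ (dataExt g s) := fun s hs =>
    hG.bddMeas₂ ha.le hb.le ⟨hs.1, hs.2.le.trans ht.2⟩
  have hx := fun x y (hx : 0 ≤ x) (hy : 0 ≤ y) =>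
    derivs_of_eqOn_Ici (u := fun x => L.solution q g t (x, y))
      (fun x hx => solution_eq_potential ha hb hd he (p := (x, y)) ⟨hx, hy⟩ hF)
      (fun x hx => h1 x y hx hy) (fun x hx => h2 x y hx hy) (potentialDxx_zero _ _ _ _ _ _ y) hx
  have hy := fun x y (hx : 0 ≤ x) (hy : 0 ≤ y) =>
    derivs_of_eqOn_Ici (u := fun y => L.solution q g t (x, y))
      (fun y hy => (solution_eq_potential ha hb hd he (p := (x, y)) ⟨hx, hy⟩ hF).trans
        (potential_swap ha hb hδ hε hx hy hF))
      (fun y hy => h1' y x hy hx) (fun y hy => h2' y x hy hx) (potentialDxx_zero _ _ _ _ _ _ x) hy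
  refine ⟨fun p hp => ⟨(hx p.1 p.2 hp.1 hp.2).1, (hy p.1 p.2 hp.1 hp.2).1,
    (hx p.1 p.2 hp.1 hp.2).2.2.1, (hy p.1 p.2 hp.1 hp.2).2.2.1⟩,
    _, _, _, _, h3.mono ht.1 (by linarith), h4.mono ht.1 (by linarith),
    (h3'.mono ht.1 (by linarith)).swap, (h4'.mono ht.1 (by linarith)).swap,
    fun x y hx0 hy0 => ⟨(hx x y hx0 hy0).2.1, (hx x y hx0 hy0).2.2.2,
      (hy x y hx0 hy0).2.1, (hy x y hx0 hy0).2.2.2⟩⟩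

end Kimura

end

theorem proposition5p2
    (U : Set (ℝ × ℝ)) (hU : ∃ V : Set (ℝ × ℝ), IsOpen V ∧ U = V ∩ Kimura.quadrant)
    (L : Kimura.Coeffs) (hL : L.IsKimuraOn U)
    (h : ℝ × ℝ → ℝ) (hh : Kimura.IsCutoff h U)
    (q : ℝ × ℝ) (hqU : q ∈ U) (hq₁ : 0 < q.1) (hq₂ : 0 < q.2)
    (hd : 0 ≤ L.d q) (he : 0 ≤ L.e q)
    (T : ℝ) (hT : 0 < T) (j : ℝ) (hj : j ≤ 3 / 2) (γ : ℝ) (hγ₀ : 0 < γ) (hγ₁ : γ < 1) :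
    ∃ C : ℝ, 0 < C ∧ ∀ g : ℝ → ℝ × ℝ → ℝ,
      Measurable (fun w : ℝ × ℝ × ℝ => g w.1 w.2) →
      (∀ t ∈ Set.Ioc 0 T, ∀ x y : ℝ, 0 ≤ x → 0 ≤ y →
        |g t (x, y)| ≤ 1 / t ^ j * Real.exp (-L.dist q t (x, y))) →
      (∀ t ∈ Set.Ioc 0 T, ∀ x x' y : ℝ, 0 ≤ x → 0 ≤ x' → 0 ≤ y →
        |g t (x, y) - g t (x', y)| ≤ 1 / t ^ (j + γ / 2) * |√x - √x'| ^ γ *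
          (Real.exp (-L.dist q t (x, y)) + Real.exp (-L.dist q t (x', y)))) →
      (∀ t ∈ Set.Ioc 0 T, ∀ x y y' : ℝ, 0 ≤ x → 0 ≤ y → 0 ≤ y' →
        |g t (x, y) - g t (x, y')| ≤ 1 / t ^ (j + γ / 2) * |√y - √y'| ^ γ *
          (Real.exp (-L.dist q t (x, y)) + Real.exp (-L.dist q t (x, y')))) →
      (∀ t ∈ Set.Ioc 0 T, ∀ x y : ℝ, 0 ≤ x → 0 ≤ y →
        L.SolutionConverges q g t (x, y) ∧ Kimura.HasKimuraDerivs (L.solution q g t) (x, y)) ∧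
      (∀ t ∈ Set.Ioc 0 T, ∀ x y : ℝ, 0 ≤ x → 0 ≤ y →
        |L.perturbation h q g t (x, y)| ≤
          C * (√t / t ^ j) * Real.exp (-(L.dist q t (x, y) / 2))) ∧
      (∀ t ∈ Set.Ioc 0 T, ∀ x x' y : ℝ, 0 ≤ x → 0 ≤ x' → 0 ≤ y →
        |L.perturbation h q g t (x, y) - L.perturbation h q g t (x', y)| ≤
          C / t ^ (j + (γ - 1) / 2) * |√x - √x'| ^ γ *
            (Real.exp (-(L.dist q t (x, y) / 2)) + Real.exp (-(L.dist q t (x', y) / 2)))) ∧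
      (∀ t ∈ Set.Ioc 0 T, ∀ x y y' : ℝ, 0 ≤ x → 0 ≤ y → 0 ≤ y' →
        |L.perturbation h q g t (x, y) - L.perturbation h q g t (x, y')| ≤
          C / t ^ (j + (γ - 1) / 2) * |√y - √y'| ^ γ *
            (Real.exp (-(L.dist q t (x, y) / 2)) + Real.exp (-(L.dist q t (x, y') / 2)))) := by
  open Kimura in
  have ha := hL.pos_a q hqU
  have hb := hL.pos_b q hqU
  obtain ⟨M₁, hM₁, k₁⟩ := exists_coeffBound hU hh hL.smooth_a hqU
  obtain ⟨M₂, hM₂, k₂⟩ := exists_coeffBound hU hh hL.smooth_b hqU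
  obtain ⟨M₃, hM₃, k₃⟩ := exists_coeffBound hU hh hL.smooth_d hqU
  obtain ⟨M₄, hM₄, k₄⟩ := exists_coeffBound hU hh hL.smooth_e hqU
  obtain ⟨C, hC, H⟩ := exists_solution_estimates (L := L) (γ := γ) ha hb hd he hq₁ hq₂ hT
    (show j < 2 by linarith) hγ₀ hγ₁
  set N := fun M : ℝ => C * (2 * M * (√(L.a q) + √(L.b q)) + 2 * M) with hN
  refine ⟨N M₁ + N M₂ + N M₃ + N M₄, by positivity, fun g hg h0 h1 h2 => ?_⟩
  have hG := dataBound_dataExt hg h0 h1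
  have hG' := dataBound_dataExt_swap hg h0 h2
  have key : ∀ t ∈ Set.Ioc 0 T, GainBound (N M₁ + N M₂ + N M₃ + N M₄) (L.a q) (L.b q) √q.1 √q.2
      j γ t (fun x y => L.perturbation h q g t (x, y)) := by
    intro t ht
    obtain ⟨-, u₁, u₁₁, u₂, u₂₂, b₁, b₁₁, b₂, b₂₂, hu⟩ := H g hG hG' t ht
    have hsum := (((k₁.gainBound_mul b₁₁ hM₁.le hC.le ha hb ht.1 hγ₀ hγ₁).add
      (k₂.gainBound_mul b₂₂ hM₂.le hC.le ha hb ht.1 hγ₀ hγ₁)).add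
      (k₃.gainBound_mul b₁ hM₃.le hC.le ha hb ht.1 hγ₀ hγ₁)).add
      (k₄.gainBound_mul b₂ hM₄.le hC.le ha hb ht.1 hγ₀ hγ₁)
    refine hsum.congr fun x y hx hy => ?_
    obtain ⟨e₁, e₁₁, e₂, e₂₂⟩ := hu x y hx hy
    rw [← e₁, ← e₁₁, ← e₂, ← e₂₂]
    -- `𝐁 g` is the sum of the four products of a cut-off coefficient and a derivative of `𝐊 g`
    simp only [Coeffs.perturbation, Coeffs.localized, Coeffs.op, Coeffs.model]
    ring
  refine ⟨fun t ht x y hx hy => ⟨solutionConverges_of_dataBound ha hb hd he hq₁ hq₂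
    (by linarith) ht (p := (x, y)) ⟨hx, hy⟩ hG, (H g hG hG' t ht).1 (x, y) ⟨hx, hy⟩⟩,
    fun t ht x y hx hy => ?_, fun t ht x x' y hx hx' hy => ?_, fun t ht x y y' hx hy hy' => ?_⟩
  · rw [exp_neg_dist_half, div_eq_mul_inv, ← Real.rpow_neg ht.1.le]
    exact (key t ht).bound x y hx hy
  · rw [exp_neg_dist_half, exp_neg_dist_half, div_eq_mul_inv, ← Real.rpow_neg ht.1.le]
    exact (key t ht).holder_fst x x' y hx hx' hy
  · rw [exp_neg_dist_half, exp_neg_dist_half, div_eq_mul_inv, ← Real.rpow_neg ht.1.le]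
    exact (key t ht).holder_snd x y y' hx hy hy'
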